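/- Manifolds are Hausdorff, second countable and without boundary, and smooth means $C^\infty$. Let $n\ge 2$. Let $G$ be a countable, connected, locally finite graph with vertex set $V$ and edge set $E$, in which loops and multiple edges are allowed, and fix for each edge $e$ an order $(s(e),t(e))$ of its two ends. To each vertex $v$ assign a connected smooth $n$-manifold $X_v$, and choose an orientation of each $X_v$ that is orientable. Fix an orientation of $\mathbb{R}^n$. Gluing data consist of smooth embeddings $f_e:\mathbb{R}^n\to X_{s(e)}$ and $g_e:\mathbb{R}^n\to X_{t(e)}$ for every $e\in E$, where all the images, of all the $f_e$ and $g_e$, are pairwise disjoint, $f_e$ is orientation-preserving if $X_{s(e)}$ is orientable, and $g_e$ is orientation-reversing if $X_{t(e)}$ is orientable. Let $D^n\subset\mathbb{R}^n$ be the closed unit ball. Given gluing data, put $$Y_v:=X_v\setminus\Big(\bigcup_{s(e)=v}f_e(\tfrac13D^n)\cup\bigcup_{t(e)=v}g_e(\tfrac13D^n)\Big),$$ and let the connected sum $\sharp_G X_v(f_e,g_e)$ be the quotient space of $\bigsqcup_{v\in V}Y_v$ by the equivalence relation generated by $f_e(tu)\sim g_e((1-t)u)$ for $e\in E$, $t\in(\tfrac13,\tfrac23)$,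 $u\in\mathbb{S}^{n-1}$. **Theorem 2.2.** 1. For all gluing data, $\sharp_G X_v(f_e,g_e)$ is a connected, Hausdorff, second countable space, and it has exactly one structure of a smooth $n$-manifold for which all the canonical maps $Y_v\to\sharp_G X_v(f_e,g_e)$ are local diffeomorphisms. If all the $X_v$ are orientable (hence oriented), then this manifold has exactly one orientation for which all these maps are orientation-preserving. 2. For any two choices $(f_e,g_e)$ and $(\tilde f_e,\tilde g_e)$ of gluing data (with the same graph, ordered ends, manifolds and chosen orientations), there is a diffeomorphism $\sharp_G X_v(f_e,g_e)\to\sharp_G X_v(\tilde f_e,\tilde g_e)$. If all the $X_v$ are orientable, it can be chosen orientation-preserving for the orientations of part 1. -/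

import Mathlib

open Set Topology TopologicalSpace
open scoped Manifold ContDiff

noncomputable section

/-- Euclidean `n`-space. -/
abbrev EucSpace (n : ℕ) : Type := EuclideanSpace ℝ (Fin n)

/-- The linear map `A` is an isomorphism that carries the orientation `o` of its source to the
orientation `o'` of its target. -/
def CarriesOrientation {n : ℕ} {T T' : Type*} [AddCommGroup T] [Module ℝ T] [AddCommGroup T']
    [Module ℝ T'] (A : T →ₗ[ℝ] T') (o : Orientation ℝ T (Fin n)) (o' : Orientation ℝ T' (Fin n)) :
    Prop :=
  ∃ L : T ≃ₗ[ℝ] T', (L : T →ₗ[ℝ] T') = A ∧ Orientation.map (Fin n) L o = o'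

/-- The constant orientation `ρ` of the manifold `ℝⁿ`, at the point `p`; recall that the tangent
space of `ℝⁿ` at `p` is `ℝⁿ` itself. -/
def constOrientation {n : ℕ} (ρ : Orientation ℝ (EucSpace n) (Fin n)) (p : EucSpace n) :
    Orientation ℝ (TangentSpace (𝓡 n) p) (Fin n) := ρ

/-- An orientation of a smooth `n`-manifold `M`: an orientation of every tangent space, such that
around every point there is a smooth chart in which it is constant. -/
structure ManifoldOrientation (n : ℕ) (M : Type*) [TopologicalSpace M]
    [ChartedSpace (EucSpace n) M] where
  orient : ∀ x : M, Orientation ℝ (TangentSpace (𝓡 n) x) (Fin n)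
  locally_const : ∀ x : M, ∃ φ ∈ IsManifold.maximalAtlas (𝓡 n) ∞ M, x ∈ φ.source ∧
    ∃ σ : Orientation ℝ (EucSpace n) (Fin n), ∀ y ∈ φ.source,
      CarriesOrientation (mfderiv (𝓡 n) (𝓡 n) φ y).toLinearMap (orient y)
        (constOrientation σ (φ y))

/-- `M` is orientable. -/
def IsOrientable (n : ℕ) (M : Type*) [TopologicalSpace M] [ChartedSpace (EucSpace n) M] : Prop :=
  Nonempty (ManifoldOrientation n M)

/-- A locally finite graph with vertex set `V` and edge set `E`; loops and multiple edges are
allowed. Every edge `e` is given with an order of its two ends, namely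
`vert e false` (first end) and `vert e true` (second end). -/
structure LocFinGraph (V E : Type*) where
  vert : E → Bool → V
  locally_finite : ∀ v : V, {h : E × Bool | vert h.1 h.2 = v}.Finite

/-- Connectedness (in particular there is at least one vertex). -/
def LocFinGraph.IsConnected {V E : Type*} (G : LocFinGraph V E) : Prop :=
  (SimpleGraph.fromRel fun v w => ∃ e, G.vert e false = v ∧ G.vert e true = w).Connected

section

variable {n : ℕ} {V E : Type*} (G : LocFinGraph V E) (X : V → Type*)
  [∀ v, TopologicalSpace (X v)] [∀ v, ChartedSpace (EucSpace n) (X v)]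

/-- Gluing data along `G`: every edge `e` carries two smooth embeddings of `ℝⁿ`,
`emb e false` into the manifold at its first end and `emb e true` into the manifold at its second
end. Here `ρ` is the fixed orientation of `ℝⁿ`, and `σ` is a chosen orientation of those `X v` that
are orientable. On orientable pieces `emb e false` preserves and `emb e true` reverses the
orientation. The images of all these embeddings are pairwise disjoint. -/
structure GluingData (ρ : Orientation ℝ (EucSpace n) (Fin n))
    (σ : ∀ v, IsOrientable n (X v) → ManifoldOrientation n (X v)) where
  emb : ∀ (e : E) (b : Bool), EucSpace n → X (G.vert e b)
  smooth_emb : ∀ e b, Manifold.IsSmoothEmbedding (𝓡 n) (𝓡 n) ∞ (emb e b)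
  preserves : ∀ e (h : IsOrientable n (X (G.vert e false))) (p : EucSpace n),
    CarriesOrientation (mfderiv (𝓡 n) (𝓡 n) (emb e false) p).toLinearMap
      (constOrientation ρ p) ((σ _ h).orient (emb e false p))
  reverses : ∀ e (h : IsOrientable n (X (G.vert e true))) (p : EucSpace n),
    CarriesOrientation (mfderiv (𝓡 n) (𝓡 n) (emb e true) p).toLinearMap
      (constOrientation ρ p) (-(σ _ h).orient (emb e true p))
  disjoint_range : ∀ h h' : E × Bool, h ≠ h' → ∀ p p' : EucSpace n,
    (⟨G.vert h.1 h.2, emb h.1 h.2 p⟩ : Σ v, X v) ≠ ⟨G.vert h'.1 h'.2, emb h'.1 h'.2 p'⟩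

end

namespace GluingData

variable {n : ℕ} {V E : Type*} {G : LocFinGraph V E} {X : V → Type*}
  [∀ v, TopologicalSpace (X v)] [∀ v, ChartedSpace (EucSpace n) (X v)]
  {ρ : Orientation ℝ (EucSpace n) (Fin n)}
  {σ : ∀ v, IsOrientable n (X v) → ManifoldOrientation n (X v)}

/-- The point `emb e b p`, in the disjoint union of all the manifolds `X v`. -/
def point (Γ : GluingData G X ρ σ) (e : E) (b : Bool) (p : EucSpace n) : Σ v, X v :=
  ⟨G.vert e b, Γ.emb e b p⟩

/-- The union in `X v` of the images of the closed ball of radius `1/3` under all the embeddings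
into `X v`. -/
def removed (Γ : GluingData G X ρ σ) (v : V) : Set (X v) :=
  {x | ∃ e b, ∃ p ∈ Metric.closedBall (0 : EucSpace n) (1 / 3), Γ.point e b p = ⟨v, x⟩}

theorem isClosed_removed [∀ v, T2Space (X v)] (Γ : GluingData G X ρ σ) (v : V) :
    IsClosed (Γ.removed v) := by
  have key : Γ.removed v = ⋃ h ∈ {h : E × Bool | G.vert h.1 h.2 = v},
      Sigma.mk v ⁻¹' (Γ.point h.1 h.2 '' Metric.closedBall (0 : EucSpace n) (1 / 3)) := by
    ext x
    simp only [removed, mem_ofPred_eq, mem_iUnion, mem_preimage, mem_image, exists_prop,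
      Prod.exists]
    constructor
    · rintro ⟨e, b, p, hp, h⟩
      exact ⟨e, b, congrArg Sigma.fst h, p, hp, h⟩
    · rintro ⟨e, b, -, p, hp, h⟩
      exact ⟨e, b, p, hp, h⟩
  rw [key]
  refine (G.locally_finite v).isClosed_biUnion fun h _ => ?_
  have hc : Continuous (Γ.point h.1 h.2) :=
    continuous_sigmaMk.comp (Γ.smooth_emb h.1 h.2).isEmbedding.continuous
  exact ((isCompact_closedBall _ _).image hc).isClosed.preimage continuous_sigmaMk

variable [∀ v, T2Space (X v)]

/-- `X v` with the images of the closed balls of radius `1/3` removed: an open submanifold. -/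
def piece (Γ : GluingData G X ρ σ) (v : V) : Opens (X v) :=
  ⟨(Γ.removed v)ᶜ, (Γ.isClosed_removed v).isOpen_compl⟩

/-- The identification of `emb e false (t u)` with `emb e true ((1 - t) u)`, for `1/3 < t < 2/3` and
`u` in the unit sphere, on the disjoint union of the pieces. -/
def Glue (Γ : GluingData G X ρ σ) (y z : Σ v, Γ.piece v) : Prop :=
  ∃ (e : E) (t : ℝ) (u : EucSpace n), 1 / 3 < t ∧ t < 2 / 3 ∧ ‖u‖ = 1 ∧
    (⟨y.1, y.2.1⟩ : Σ v, X v) = Γ.point e false (t • u) ∧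
    (⟨z.1, z.2.1⟩ : Σ v, X v) = Γ.point e true ((1 - t) • u)

/-- The connected sum of the `X v` along `G` as a topological space: the quotient of the disjoint
union of the pieces by the equivalence relation generated by the gluing. -/
def Space (Γ : GluingData G X ρ σ) : Type _ := Quot Γ.Glue

instance (Γ : GluingData G X ρ σ) : TopologicalSpace Γ.Space :=
  inferInstanceAs (TopologicalSpace (Quot Γ.Glue))

/-- The canonical map from a piece to the connected sum. -/
def proj (Γ : GluingData G X ρ σ) (v : V) (y : Γ.piece v) : Γ.Space := Quot.mk _ ⟨v, y⟩

/-- A quotient smooth structure on the connected sum: a smooth `n`-manifold structure for which the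
canonical maps from the pieces are local diffeomorphisms. -/
structure SmoothStr (Γ : GluingData G X ρ σ) where
  charted : ChartedSpace (EucSpace n) Γ.Space
  isManifold : IsManifold (𝓡 n) ∞ Γ.Space
  isLocalDiffeomorph_proj : ∀ v, IsLocalDiffeomorph (𝓡 n) (𝓡 n) ∞ (Γ.proj v)

namespace SmoothStr

variable {Γ : GluingData G X ρ σ}

/-- The connected sum, endowed with the smooth structure `S`. -/
def Carrier (_S : Γ.SmoothStr) : Type _ := Γ.Space

instance (S : Γ.SmoothStr) : TopologicalSpace S.Carrier :=
  inferInstanceAs (TopologicalSpace Γ.Space)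

instance (S : Γ.SmoothStr) : ChartedSpace (EucSpace n) S.Carrier := S.charted

instance (S : Γ.SmoothStr) : IsManifold (𝓡 n) ∞ S.Carrier := S.isManifold

/-- The canonical map from a piece to the connected sum. -/
def proj (S : Γ.SmoothStr) (v : V) (y : Γ.piece v) : S.Carrier := Γ.proj v y

/-- The orientation `o` of the connected sum is induced by the orientations of the pieces: all
canonical maps from the pieces preserve orientation, where `T_y (piece v)` is oriented through the
inclusion of the piece in `X v`. -/
def IsInduced (S : Γ.SmoothStr) (h : ∀ v, IsOrientable n (X v))
    (o : ManifoldOrientation n S.Carrier) : Prop :=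
  ∀ (v : V) (y : Γ.piece v), ∃ a : Orientation ℝ (TangentSpace (𝓡 n) y) (Fin n),
    CarriesOrientation
      (mfderiv (𝓡 n) (𝓡 n) (Subtype.val : Γ.piece v → X v) y).toLinearMap
      a ((σ v (h v)).orient y.1) ∧
    CarriesOrientation (mfderiv (𝓡 n) (𝓡 n) (S.proj v) y).toLinearMap
      a (o.orient (S.proj v y))

end SmoothStr

end GluingData

/-- The smooth map `Φ` preserves the orientations `o`, `o'`. -/
def PreservesOrientation {n : ℕ} {M N : Type*} [TopologicalSpace M] [ChartedSpace (EucSpace n) M]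
    [TopologicalSpace N] [ChartedSpace (EucSpace n) N] (o : ManifoldOrientation n M)
    (o' : ManifoldOrientation n N) (Φ : M → N) : Prop :=
  ∀ x : M, CarriesOrientation (mfderiv (𝓡 n) (𝓡 n) Φ x).toLinearMap
    (o.orient x) (o'.orient (Φ x))

end

/-! The connected sum is understood through an explicit form of its equivalence relation. On the
shell of radii between 1/3 and 2/3 the gluing is `radialFlip`, t u ↦ (1 - t) u, an involution. Since
all embedded copies of ℝⁿ are disjoint, a point takes part in at most one identification, so classes
have at most two points (`Glued`, `mk_eq_mk_iff`). The quotient map is open because identified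
points have identified smooth parametrizations (`exists_common_param`). The relation is closed
because closed shells are compact and the graph is locally finite (`isClosed_setOf_mk_eq_mk`). Hence
the quotient is Hausdorff and second countable. It is connected because, for n ≥ 2, removing balls
does not disconnect a piece. The smooth charts are those that become local diffeomorphisms after
composition with the canonical maps. Orientations match because `radialFlip` reverses orientation
and so does exactly one of the two ends of each edge.

For independence of the embeddings it suffices to find, for each vertex separately, a diffeomorphism
of X_v that preserves every orientation and carries one family of unit balls to the other
(`exists_diffeo_discs`). The gluing only sees the unit balls, so these diffeomorphisms descend to
the sum. Applied to identity maps, the same descent gives uniqueness of the smooth structure.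

The disc theorem is proved with germs rather than isotopies. A germ of an orientation-preserving
diffeomorphism of ℝⁿ fixing 0 extends to a diffeomorphism supported in any small ball
(`exists_eucDiffeo_germ`): its linear part is a product of maps having roots close to the identity,
and the rest is a C¹-small perturbation. Together with small translations and connectedness of the
complement of a finite set, this moves any germ to any other up to a mirror image, keeping finitely
many other germs fixed. On an orientable manifold the sign decides between the two. On a
non-orientable one both occur, since otherwise the germs reachable from a given one would define an
orientation (`GermMove.of_not_isOrientable`). Finally, shrinking the unit balls replaces them by
germs at their centres.

Orientations are encoded throughout by signs of Jacobian determinants in preferred charts. Such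
signs jump when the preferred chart changes, so local constancy is always tested along
parametrizations by ℝⁿ. -/

section DetSign

/-! ### Local diffeomorphisms and the sign of the Jacobian -/

variable {n : ℕ} {M N P : Type*} [TopologicalSpace M] [ChartedSpace (EucSpace n) M]
  [TopologicalSpace N] [ChartedSpace (EucSpace n) N]
  [TopologicalSpace P] [ChartedSpace (EucSpace n) P]

/-- `f` is a smooth local diffeomorphism at `x`. -/
abbrev LocDiffAt (n : ℕ) {M N : Type*} [TopologicalSpace M] [ChartedSpace (EucSpace n) M]
    [TopologicalSpace N] [ChartedSpace (EucSpace n) N] (f : M → N) (x : M) : Prop :=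
  IsLocalDiffeomorphAt (𝓡 n) (𝓡 n) ∞ f x

theorem LocDiffAt.congr {f g : M → N} {x : M} (hf : LocDiffAt n f x) (h : g =ᶠ[𝓝 x] f) :
    LocDiffAt n g x := by
  obtain ⟨Φ, hx, hΦ⟩ := hf
  obtain ⟨U, hU, hUo, hxU⟩ := mem_nhds_iff.1 h
  let e := Φ.toOpenPartialHomeomorph.restrOpen U hUo
  refine ⟨⟨e.toPartialEquiv, e.open_source, e.open_target,
    Φ.contMDiffOn_toFun.mono inter_subset_left,
    Φ.contMDiffOn_invFun.mono ?_⟩, ⟨hx, hxU⟩, ?_⟩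
  · exact fun y hy => hy.1
  · rintro y ⟨hy, hyU⟩
    exact (hU hyU).trans (hΦ hy)

theorem LocDiffAt.eventually {f : M → N} {x : M} (hf : LocDiffAt n f x) :
    ∀ᶠ y in 𝓝 x, LocDiffAt n f y := by
  obtain ⟨Φ, hx, hΦ⟩ := hf
  filter_upwards [Φ.open_source.mem_nhds hx] with y hy
  exact ⟨Φ, hy, hΦ⟩

/-- A local diffeomorphism has a local inverse. -/
theorem LocDiffAt.exists_inverse {f : M → N} {x : M} (hf : LocDiffAt n f x) :
    ∃ g : N → M, LocDiffAt n g (f x) ∧ g (f x) = x ∧ (∀ᶠ y in 𝓝 x, g (f y) = y) ∧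
      ∀ᶠ z in 𝓝 (f x), f (g z) = z :=
  ⟨hf.localInverse, hf.localInverse_isLocalDiffeomorphAt,
    hf.localInverse_left_inv hf.localInverse_mem_target, hf.localInverse_eventuallyEq_left,
    hf.localInverse_eventuallyEq_right⟩

theorem LocDiffAt.comp' {g : N → P} {f : M → N} {x : M} (hg : LocDiffAt n g (f x))
    (hf : LocDiffAt n f x) : LocDiffAt n (fun y => g (f y)) x :=
  IsLocalDiffeomorphAt.comp (K := 𝓡 n) (P := P) hf hg

theorem LocDiffAt.continuousAt {f : M → N} {x : M} (hf : LocDiffAt n f x) : ContinuousAt f x :=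
  hf.contMDiffAt.continuousAt

/-- Near `f x`, `g` is the composite of `g ∘ f` with a local inverse of `f`, so no continuity of `g`
has to be assumed. This is how smoothness descends from the pieces to the sum. -/
theorem LocDiffAt.of_comp_left {g : N → P} {f : M → N} {x : M}
    (hgf : LocDiffAt n (fun y => g (f y)) x) (hf : LocDiffAt n f x) : LocDiffAt n g (f x) := by
  obtain ⟨k, hk, hkx, -, hr⟩ := hf.exists_inverse
  have h1 : LocDiffAt n (fun z => g (f (k z))) (f x) :=
    LocDiffAt.comp' (g := fun y => g (f y)) (f := k) (by rw [hkx]; exact hgf) hk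
  refine h1.congr ?_
  filter_upwards [hr] with z hz
  rw [hz]

/-- Continuity of `f` keeps its values in the neighbourhood where the local inverse of `g` is an
inverse. -/
theorem LocDiffAt.of_comp_right {g : N → P} {f : M → N} {x : M}
    (hgf : LocDiffAt n (fun y => g (f y)) x) (hg : LocDiffAt n g (f x)) (hf : ContinuousAt f x) :
    LocDiffAt n f x := by
  obtain ⟨k, hk, hkx, hl, -⟩ := hg.exists_inverse
  refine (LocDiffAt.comp' (f := fun y => g (f y)) hk hgf).congr ?_
  filter_upwards [hf.eventually hl] with z hz
  exact hz.symm

theorem LocDiffAt.map_nhds {f : M → N} {x : M} (hf : LocDiffAt n f x) :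
    Filter.map f (𝓝 x) = 𝓝 (f x) := by
  obtain ⟨Φ, hx, hΦ⟩ := hf
  have h1 := Φ.toOpenPartialHomeomorph.map_nhds_eq (x := x) hx
  rw [hΦ hx]
  refine (Filter.map_congr ?_).trans h1
  filter_upwards [Φ.open_source.mem_nhds hx] with y hy
  exact hΦ hy

theorem locDiffAt_id (x : M) : LocDiffAt n (fun y : M => y) x :=
  (Diffeomorph.refl (𝓡 n) M ∞).isLocalDiffeomorph x

/-- The determinant of the differential of `f` at `x`, all tangent spaces being identified with
`ℝⁿ` through the preferred charts. -/
noncomputable def mdet (n : ℕ) {M N : Type*} [TopologicalSpace M] [ChartedSpace (EucSpace n) M]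
    [TopologicalSpace N] [ChartedSpace (EucSpace n) N] (f : M → N) (x : M) : ℝ :=
  LinearMap.det (M := EucSpace n) (mfderiv (𝓡 n) (𝓡 n) f x).toLinearMap

/-- The sign of the determinant of the differential. -/
noncomputable def mdetSign (n : ℕ) {M N : Type*} [TopologicalSpace M] [ChartedSpace (EucSpace n) M]
    [TopologicalSpace N] [ChartedSpace (EucSpace n) N] (f : M → N) (x : M) : SignType :=
  SignType.sign (mdet n f x)

theorem mdetSign_congr {f g : M → N} {x : M} (h : f =ᶠ[𝓝 x] g) :
    mdetSign n f x = mdetSign n g x := by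
  have : mdet n f x = mdet n g x := by
    unfold mdet
    have h1 := h.mfderiv_eq (I := 𝓡 n) (I' := 𝓡 n)
    exact congrArg (fun A : EucSpace n →L[ℝ] EucSpace n => LinearMap.det A.toLinearMap) h1
  rw [mdetSign, mdetSign, this]

theorem mdetSign_comp {g : N → P} {f : M → N} {x : M} (hg : LocDiffAt n g (f x))
    (hf : LocDiffAt n f x) :
    mdetSign n (fun y => g (f y)) x = mdetSign n g (f x) * mdetSign n f x := by
  have h1 := mfderiv_comp x (hg.mdifferentiableAt (by simp)) (hf.mdifferentiableAt (by simp))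
  have : mdet n (fun y => g (f y)) x = mdet n g (f x) * mdet n f x := by
    unfold mdet
    refine (congrArg (fun A : EucSpace n →L[ℝ] EucSpace n => LinearMap.det A.toLinearMap)
      h1).trans ?_
    exact LinearMap.det_comp (M := EucSpace n) _ _
  rw [mdetSign, this, sign_mul]; rfl

theorem mdetSign_id (x : M) : mdetSign n (fun y : M => y) x = 1 := by
  have : mdet n (fun y : M => y) x = 1 := by
    unfold mdet
    refine (congrArg (fun A : EucSpace n →L[ℝ] EucSpace n => LinearMap.det A.toLinearMap)
      (mfderiv_id (I := 𝓡 n) (x := x))).trans ?_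
    exact LinearMap.det_id (M := EucSpace n)
  rw [mdetSign, this, sign_one]

theorem mdetSign_ne_zero {f : M → N} {x : M} (hf : LocDiffAt n f x) : mdetSign n f x ≠ 0 := by
  obtain ⟨g, hg, -, hl, -⟩ := hf.exists_inverse
  have h1 := mdetSign_comp hg hf
  have h2 : mdetSign n (fun y => g (f y)) x = 1 := by
    rw [mdetSign_congr (g := fun y => y) hl, mdetSign_id]
  intro h0
  rw [h0, mul_zero, h2] at h1
  exact one_ne_zero h1

theorem SignType.mul_self_of_ne_zero {s : SignType} (h : s ≠ 0) : s * s = 1 := by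
  revert s; decide

theorem SignType.eq_or_eq_neg_of_ne_zero {s t : SignType} (hs : s ≠ 0) (ht : t ≠ 0) :
    s = t ∨ s = -t := by
  revert s t; decide

theorem mdetSign_eq_fderiv (f : EucSpace n → EucSpace n) (x : EucSpace n) :
    mdetSign n f x = SignType.sign (LinearMap.det (fderiv ℝ f x).toLinearMap) := by
  unfold mdetSign mdet
  rw [mfderiv_eq_fderiv]; rfl

/-- The determinant is continuous and nonzero. Restricting to self-maps of ℝⁿ is essential: on a
general manifold the preferred chart at y varies discontinuously with y. -/
theorem eventually_mdetSign_eq {f : EucSpace n → EucSpace n} {x : EucSpace n}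
    (hf : LocDiffAt n f x) : ∀ᶠ y in 𝓝 x, mdetSign n f y = mdetSign n f x := by
  have h0 := mdetSign_ne_zero hf
  simp only [mdetSign_eq_fderiv] at h0 ⊢
  have h1 : ContDiffAt ℝ ∞ f x := hf.contMDiffAt.contDiffAt
  have h2 : ContinuousAt (fun y => (fderiv ℝ f y).det) x :=
    ContinuousLinearMap.continuous_det.continuousAt.comp
      (h1.continuousAt_fderiv (by simp))
  have h3 : ContinuousAt (fun y => SignType.sign (fderiv ℝ f y).det) x :=
    ContinuousAt.comp (g := fun d : ℝ => SignType.sign d)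
      (continuousAt_sign_of_ne_zero (by simpa using h0)) h2
  exact h3.eventually (IsOpen.mem_nhds (isOpen_discrete {SignType.sign (fderiv ℝ f x).det}) rfl)

end DetSign

/-! ### Orientations as sign functions -/

section Orient

variable {n : ℕ}

theorem orientation_eq_or_eq_neg (a b : Orientation ℝ (EucSpace n) (Fin n)) : a = b ∨ a = -b :=
  a.eq_or_eq_neg b (by simp)

theorem carriesOrientation_iff_det (A : EucSpace n →ₗ[ℝ] EucSpace n)
    (a b : Orientation ℝ (EucSpace n) (Fin n)) :
    CarriesOrientation A a b ↔
      (0 < LinearMap.det A ∧ b = a) ∨ (LinearMap.det A < 0 ∧ b = -a) := by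
  have hc : Fintype.card (Fin n) = Module.finrank ℝ (EucSpace n) := by simp
  constructor
  · rintro ⟨L, rfl, hL⟩
    rcases orientation_eq_or_eq_neg b a with h | h
    · left
      exact ⟨(a.map_eq_iff_det_pos L hc).1 (hL.trans h), h⟩
    · right
      exact ⟨(a.map_eq_neg_iff_det_neg L hc).1 (hL.trans h), h⟩
  · intro h
    have hd : LinearMap.det A ≠ 0 := by
      rcases h with h | h
      · exact h.1.ne'
      · exact h.1.ne
    refine ⟨LinearEquiv.ofIsUnitDet (f := A) (v := Module.finBasis ℝ _)
      (v' := Module.finBasis ℝ _) (by simpa using hd), rfl, ?_⟩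
    rcases h with h | h
    · rw [h.2]; exact (a.map_eq_iff_det_pos _ hc).2 h.1
    · rw [h.2]; exact (a.map_eq_neg_iff_det_neg _ hc).2 h.1

section

variable {M N : Type*} [TopologicalSpace M] [ChartedSpace (EucSpace n) M]
  [TopologicalSpace N] [ChartedSpace (EucSpace n) N]

/-- The orientation of `ℝⁿ` equal to `ρ` if the sign is `1`, and opposite to `ρ` otherwise. -/
def signOrientation (ρ : Orientation ℝ (EucSpace n) (Fin n)) (s : SignType) :
    Orientation ℝ (EucSpace n) (Fin n) :=
  if s = 1 then ρ else -ρ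

open Classical in
/-- The sign of an orientation of `ℝⁿ` relative to `ρ`. -/
noncomputable def orientationSign (ρ a : Orientation ℝ (EucSpace n) (Fin n)) : SignType :=
  if a = ρ then 1 else -1

theorem orientationSign_ne_zero (ρ a : Orientation ℝ (EucSpace n) (Fin n)) :
    orientationSign ρ a ≠ 0 := by
  unfold orientationSign; split <;> decide

theorem orientationSign_self (ρ : Orientation ℝ (EucSpace n) (Fin n)) :
    orientationSign ρ ρ = 1 := by simp [orientationSign]

theorem orientationSign_neg (ρ a : Orientation ℝ (EucSpace n) (Fin n)) :
    orientationSign ρ (-a) = -orientationSign ρ a := by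
  have h := Module.Ray.ne_neg_self ρ
  rcases orientation_eq_or_eq_neg a ρ with rfl | rfl
  · simp [orientationSign, h.symm]
  · have h2 : -(-ρ) = ρ := neg_neg (G := Module.Ray ℝ _) ρ
    rw [h2]
    simp [orientationSign, h.symm]

theorem orientationSign_injective (ρ : Orientation ℝ (EucSpace n) (Fin n)) :
    Function.Injective (orientationSign ρ) := by
  have h := Module.Ray.ne_neg_self ρ
  intro a b hab
  rcases orientation_eq_or_eq_neg a ρ with ha | ha <;>
    rcases orientation_eq_or_eq_neg b ρ with hb | hb <;>
    simp_all [orientationSign, h.symm]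

theorem orientationSign_signOrientation (ρ : Orientation ℝ (EucSpace n) (Fin n)) {s : SignType}
    (hs : s ≠ 0) : orientationSign ρ (signOrientation ρ s) = s := by
  have h := Module.Ray.ne_neg_self ρ
  unfold signOrientation orientationSign
  cases s <;> simp_all [h.symm]

theorem sign_mul_orientationSign_iff (ρ a b : Orientation ℝ (EucSpace n) (Fin n)) (d : ℝ) :
    ((0 < d ∧ b = a) ∨ (d < 0 ∧ b = -a)) ↔
      SignType.sign d * orientationSign ρ a = orientationSign ρ b := by
  have ha := orientationSign_ne_zero ρ a
  have hb := orientationSign_ne_zero ρ b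
  have e1 : b = a ↔ orientationSign ρ b = orientationSign ρ a :=
    (orientationSign_injective ρ).eq_iff.symm
  have e2 : b = -a ↔ orientationSign ρ b = -orientationSign ρ a := by
    rw [← orientationSign_neg]; exact (orientationSign_injective ρ).eq_iff.symm
  rw [e1, e2, ← sign_eq_one_iff, ← sign_eq_neg_one_iff]
  revert ha hb
  generalize SignType.sign d = s
  generalize orientationSign ρ a = sa
  generalize orientationSign ρ b = sb
  revert s sa sb; decide

/-- Tangent spaces are ℝⁿ by definition, so the linear statement applies verbatim. From here on,
orientation arguments become finite computations with signs. -/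
theorem carriesOrientation_iff_sign (ρ : Orientation ℝ (EucSpace n) (Fin n)) {f : M → N} {x : M}
    (a : Orientation ℝ (TangentSpace (𝓡 n) x) (Fin n))
    (b : Orientation ℝ (TangentSpace (𝓡 n) (f x)) (Fin n)) :
    CarriesOrientation (mfderiv (𝓡 n) (𝓡 n) f x).toLinearMap a b ↔
      mdetSign n f x * orientationSign ρ a = orientationSign ρ b :=
  (carriesOrientation_iff_det (n := n) _ a b).trans (sign_mul_orientationSign_iff ρ a b _)

/-- The sign function of an orientation, relative to the orientation `ρ` of `ℝⁿ` and to the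
preferred charts. -/
noncomputable def ManifoldOrientation.sign (ρ : Orientation ℝ (EucSpace n) (Fin n))
    (o : ManifoldOrientation n M) (x : M) : SignType :=
  orientationSign ρ (o.orient x)

theorem ManifoldOrientation.sign_ne_zero (ρ : Orientation ℝ (EucSpace n) (Fin n))
    (o : ManifoldOrientation n M) (x : M) : o.sign ρ x ≠ 0 :=
  orientationSign_ne_zero ρ _

theorem preservesOrientation_iff_sign (ρ : Orientation ℝ (EucSpace n) (Fin n))
    (o : ManifoldOrientation n M) (o' : ManifoldOrientation n N) (f : M → N) :
    PreservesOrientation o o' f ↔ ∀ x, mdetSign n f x * o.sign ρ x = o'.sign ρ (f x) :=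
  forall_congr' fun _ => carriesOrientation_iff_sign ρ _ _

theorem ManifoldOrientation.ext_sign (ρ : Orientation ℝ (EucSpace n) (Fin n))
    {o o' : ManifoldOrientation n M} (h : ∀ x, o.sign ρ x = o'.sign ρ x) : o = o' := by
  obtain ⟨a, _⟩ := o
  obtain ⟨b, _⟩ := o'
  congr 1
  funext x
  exact orientationSign_injective ρ (h x)

theorem locDiffAt_of_mem_maximalAtlas [IsManifold (𝓡 n) ∞ M]
    {φ : OpenPartialHomeomorph M (EucSpace n)} (hφ : φ ∈ IsManifold.maximalAtlas (𝓡 n) ∞ M)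
    {x : M} (hx : x ∈ φ.source) : LocDiffAt n φ x :=
  ⟨⟨φ.toPartialEquiv, φ.open_source, φ.open_target, contMDiffOn_of_mem_maximalAtlas hφ,
    contMDiffOn_symm_of_mem_maximalAtlas hφ⟩, hx, fun _ _ => rfl⟩

theorem locDiffAt_symm_of_mem_maximalAtlas [IsManifold (𝓡 n) ∞ M]
    {φ : OpenPartialHomeomorph M (EucSpace n)} (hφ : φ ∈ IsManifold.maximalAtlas (𝓡 n) ∞ M)
    {x : EucSpace n} (hx : x ∈ φ.target) : LocDiffAt n φ.symm x :=
  ⟨⟨φ.symm.toPartialEquiv, φ.open_target, φ.open_source,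
    contMDiffOn_symm_of_mem_maximalAtlas hφ, contMDiffOn_of_mem_maximalAtlas hφ⟩, hx,
    fun _ _ => rfl⟩

/-- The sign function of an orientation is locally constant in local parametrizations. -/
theorem ManifoldOrientation.eventually_sign_eq [IsManifold (𝓡 n) ∞ M]
    (ρ : Orientation ℝ (EucSpace n) (Fin n)) (o : ManifoldOrientation n M)
    {f : EucSpace n → M} {p : EucSpace n} (hf : LocDiffAt n f p) :
    ∀ᶠ q in 𝓝 p, mdetSign n f q * o.sign ρ (f q) = mdetSign n f p * o.sign ρ (f p) := by
  obtain ⟨φ, hφ, hp, τ, hτ⟩ := o.locally_const (f p)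
  have hφs : ∀ y ∈ φ.source, mdetSign n φ y * o.sign ρ y = orientationSign ρ τ := fun y hy =>
    (carriesOrientation_iff_sign ρ _ _).1 (hτ y hy)
  -- Only the composite with `φ` is a self-map of ℝⁿ, where signs are locally constant; `key`
  -- expresses the wanted sign through it.
  have hcomp := LocDiffAt.comp' (locDiffAt_of_mem_maximalAtlas hφ hp) hf
  have hev := eventually_mdetSign_eq hcomp
  have hsrc : ∀ᶠ q in 𝓝 p, f q ∈ φ.source :=
    hf.continuousAt.eventually (φ.open_source.mem_nhds hp)
  have key : ∀ q, LocDiffAt n f q → f q ∈ φ.source →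
      mdetSign n f q * o.sign ρ (f q) =
        mdetSign n (fun y => φ (f y)) q * orientationSign ρ τ := by
    intro q hq hqs
    have hφq := locDiffAt_of_mem_maximalAtlas hφ hqs
    rw [mdetSign_comp hφq hq, ← hφs _ hqs]
    have := mdetSign_ne_zero hφq
    revert this
    generalize mdetSign n φ (f q) = a
    generalize mdetSign n f q = b
    generalize o.sign ρ (f q) = c
    revert a b c; decide
  filter_upwards [hev, hsrc, hf.eventually] with q h1 h2 h3
  rw [key q h3 h2, key p hf hp, h1]

/-- A local diffeomorphism can be inverted to a chart of the maximal atlas. -/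
theorem LocDiffAt.exists_chart [IsManifold (𝓡 n) ∞ M] {f : EucSpace n → M} {p : EucSpace n}
    (hf : LocDiffAt n f p) {U : Set (EucSpace n)} (hU : U ∈ 𝓝 p) :
    ∃ φ ∈ IsManifold.maximalAtlas (𝓡 n) ∞ M, f p ∈ φ.source ∧ φ.target ⊆ U ∧
      ∀ q ∈ φ.target, f q ∈ φ.source ∧ φ (f q) = q ∧ φ.symm q = f q ∧ LocDiffAt n f q := by
  obtain ⟨Φ, hp, hΦ⟩ := hf
  obtain ⟨V, hVU, hVo, hpV⟩ := mem_nhds_iff.1 hU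
  let e := Φ.toOpenPartialHomeomorph.restrOpen V hVo
  have hes : e.source = Φ.source ∩ V := rfl
  refine ⟨e.symm, ?_, ?_, ?_, ?_⟩
  · refine OpenPartialHomeomorph.mem_maximalAtlas_of_contMDiffOn _ ?_ ?_
    · exact Φ.contMDiffOn_invFun.mono fun y hy => hy.1
    · exact Φ.contMDiffOn_toFun.mono inter_subset_left
  · rw [hΦ hp]
    exact e.map_source ⟨hp, hpV⟩
  · exact fun q hq => hVU hq.2
  · intro q hq
    have hq' : q ∈ e.source := hq
    have h1 : f q = e q := hΦ hq'.1
    rw [h1]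
    exact ⟨e.map_source hq', e.left_inv hq', rfl, ⟨Φ, hq'.1, hΦ⟩⟩

/-- An orientation given by a sign function that is locally constant in suitable local
parametrizations. -/
noncomputable def ManifoldOrientation.ofSign [IsManifold (𝓡 n) ∞ M]
    (ρ : Orientation ℝ (EucSpace n) (Fin n)) (s : M → SignType)
    (hs : ∀ x, ∃ (f : EucSpace n → M) (p : EucSpace n) (c : SignType), LocDiffAt n f p ∧ f p = x ∧
      c ≠ 0 ∧ ∀ᶠ q in 𝓝 p, mdetSign n f q * s (f q) = c) : ManifoldOrientation n M where
  orient x := signOrientation ρ (s x)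
  locally_const x := by
    obtain ⟨f, p, c, hf, rfl, hc, hfc⟩ := hs x
    obtain ⟨φ, hφ, h1, h2, h3⟩ := hf.exists_chart hfc
    refine ⟨φ, hφ, h1, signOrientation ρ c, fun y hy => ?_⟩
    have hy' := φ.map_source hy
    obtain ⟨h4, h5, h6, h7⟩ := h3 _ hy'
    rw [φ.left_inv hy] at h6
    refine (carriesOrientation_iff_sign ρ (f := φ) _ _).2 ?_
    have hsc : mdetSign n f (φ y) * s (f (φ y)) = c := h2 hy'
    have hs0 : s y ≠ 0 := by
      rw [h6]; intro h0; rw [h0, mul_zero] at hsc; exact hc hsc.symm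
    change mdetSign n φ y * orientationSign ρ (signOrientation ρ (s y)) =
      orientationSign ρ (signOrientation ρ c)
    rw [orientationSign_signOrientation ρ hs0, orientationSign_signOrientation ρ hc, ← hsc, ← h6]
    congr 1
    -- `φ` inverts `f`, so their signs are inverse to each other, hence equal.
    have h8 : LocDiffAt n φ (f (φ y)) := locDiffAt_of_mem_maximalAtlas hφ h4
    have h9 := mdetSign_comp h8 h7
    rw [mdetSign_congr (g := fun y => y), mdetSign_id, ← h6] at h9
    · revert h9
      generalize mdetSign n φ y = a
      generalize mdetSign n f (φ y) = b
      revert a b; decide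
    · filter_upwards [φ.open_target.mem_nhds hy'] with q hq
      exact (h3 q hq).2.1

theorem ManifoldOrientation.ofSign_sign [IsManifold (𝓡 n) ∞ M]
    (ρ : Orientation ℝ (EucSpace n) (Fin n)) (s : M → SignType)
    (hs : ∀ x, ∃ (f : EucSpace n → M) (p : EucSpace n) (c : SignType), LocDiffAt n f p ∧ f p = x ∧
      c ≠ 0 ∧ ∀ᶠ q in 𝓝 p, mdetSign n f q * s (f q) = c) (x : M) (hx : s x ≠ 0) :
    (ofSign ρ s hs).sign ρ x = s x :=
  orientationSign_signOrientation ρ hx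

/-- Smooth immersions between manifolds of the same dimension are local diffeomorphisms. -/
theorem locDiffAt_of_isImmersion {f : M → N} (hf : Manifold.IsImmersion (𝓡 n) (𝓡 n) ∞ f)
    [IsManifold (𝓡 n) ∞ M] [IsManifold (𝓡 n) ∞ N] (x : M) : LocDiffAt n f x := by
  obtain ⟨F, _, _, hF⟩ := hf
  have h := hF x
  -- Equal dimensions leave no room for the complement in the normal form of an immersion; the
  -- normal form is then a linear isomorphism.
  have hFs : Subsingleton F := by
    have : FiniteDimensional ℝ (EucSpace n × F) :=
      h.equiv.symm.toLinearEquiv.finiteDimensional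
    have hfd : FiniteDimensional ℝ F :=
      FiniteDimensional.of_injective (LinearMap.inr ℝ (EucSpace n) F) LinearMap.inr_injective
    have h1 := h.equiv.toLinearEquiv.finrank_eq
    rw [Module.finrank_prod] at h1
    exact Module.finrank_zero_iff.1 (Nat.add_left_cancel (h1.trans (add_zero _).symm))
  let j : EucSpace n ≃L[ℝ] EucSpace n × F :=
    { toFun := fun v => (v, 0)
      invFun := Prod.fst
      map_add' := by simp
      map_smul' := by simp
      left_inv := fun v => rfl
      right_inv := fun v => Prod.ext rfl (Subsingleton.elim _ _)
      continuous_toFun := by fun_prop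
      continuous_invFun := by fun_prop }
  let L : EucSpace n ≃L[ℝ] EucSpace n := j.trans h.equiv
  have hL : LocDiffAt n (L : EucSpace n → EucSpace n) (h.domChart x) :=
    L.toDiffeomorph.isLocalDiffeomorph _
  have h1 := LocDiffAt.comp' hL
    (locDiffAt_of_mem_maximalAtlas h.domChart_mem_maximalAtlas h.mem_domChart_source)
  have h2 := locDiffAt_of_mem_maximalAtlas h.codChart_mem_maximalAtlas h.mem_codChart_source
  refine LocDiffAt.of_comp_right (h1.congr ?_) h2 h.continuousAt
  filter_upwards [h.domChart.open_source.mem_nhds h.mem_domChart_source] with y hy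
  have h3 := h.writtenInCharts
  have h4 : h.domChart y ∈ (h.domChart.extend (𝓡 n)).target := by
    rw [OpenPartialHomeomorph.extend_target]
    exact ⟨h.domChart.map_source hy, mem_range_self _⟩
  have h5 := h3 h4
  change h.codChart (f (h.domChart.symm (h.domChart y))) = L (h.domChart y) at h5
  rwa [h.domChart.left_inv hy] at h5

end

end Orient

/-! ### Diffeomorphisms of ℝⁿ with small support and prescribed germ -/

section EuclideanDiffeomorphisms

variable {n : ℕ}

/-- Smooth diffeomorphisms of `ℝⁿ`. -/
abbrev EucDiffeo (n : ℕ) : Type := Diffeomorph (𝓡 n) (𝓡 n) (EucSpace n) (EucSpace n) ∞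

/-- A `C¹`-small smooth perturbation of the identity is a diffeomorphism. -/
theorem exists_eucDiffeo_id_add {u : EucSpace n → EucSpace n} (hu : ContDiff ℝ ∞ u) {c : ℝ}
    (hc : c < 1) (hc0 : 0 ≤ c) (hb : ∀ x, ‖fderiv ℝ u x‖ ≤ c) :
    ∃ h : EucDiffeo n, ∀ x, h x = x + u x := by
  have hd : Differentiable ℝ u := hu.differentiable (by simp)
  let c' : NNReal := ⟨c, hc0⟩
  -- By the mean value inequality `u` is Lipschitz with constant `c < 1`, so the perturbed identity
  -- is a homeomorphism of the whole space.
  have happ : ApproximatesLinearOn (fun x => x + u x)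
      ((ContinuousLinearEquiv.refl ℝ (EucSpace n) : EucSpace n ≃L[ℝ] EucSpace n) :
        EucSpace n →L[ℝ] EucSpace n) univ c' := by
    intro x _ y _
    have := (convex_univ (𝕜 := ℝ) (E := EucSpace n)).norm_image_sub_le_of_norm_fderiv_le
      (f := u) (C := c) (fun x _ => hd x) (fun x _ => hb x) (mem_univ y) (mem_univ x)
    have e : x + u x - (y + u y) - (x - y) = u x - u y := by abel
    rw [← e] at this
    exact this
  have hcn : Subsingleton (EucSpace n) ∨
      c' < ‖((ContinuousLinearEquiv.refl ℝ (EucSpace n)).symm :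
        EucSpace n →L[ℝ] EucSpace n)‖₊⁻¹ := by
    rcases subsingleton_or_nontrivial (EucSpace n) with h | h
    · exact Or.inl h
    · right
      have : ‖((ContinuousLinearEquiv.refl ℝ (EucSpace n)).symm :
        EucSpace n →L[ℝ] EucSpace n)‖₊ = 1 := by
        ext; exact ContinuousLinearMap.norm_id
      rw [this, inv_one]
      exact_mod_cast hc
  let H := happ.toHomeomorph _ hcn
  have hH : ∀ x, H x = x + u x := fun _ => rfl
  have hsm : ContDiff ℝ ∞ (H : EucSpace n → EucSpace n) := by
    have : (H : EucSpace n → EucSpace n) = fun x => x + u x := funext hH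
    rw [this]; exact contDiff_id.add hu
  have hlt : ∀ x, ‖-fderiv ℝ u x‖ < 1 := fun x => by rw [norm_neg]; exact (hb x).trans_lt hc
  -- The derivative `1 + fderiv ℝ u x` is invertible by the Neumann series, which makes the inverse
  -- smooth.
  let D : EucSpace n → (EucSpace n ≃L[ℝ] EucSpace n) := fun x =>
    ContinuousLinearEquiv.unitsEquiv ℝ (EucSpace n) (Units.oneSub (-fderiv ℝ u x) (hlt x))
  have hD : ∀ x, HasFDerivAt (H : EucSpace n → EucSpace n)
      (D x : EucSpace n →L[ℝ] EucSpace n) x := by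
    intro x
    have h1 : HasFDerivAt (fun x => x + u x)
      (ContinuousLinearMap.id ℝ (EucSpace n) + fderiv ℝ u x) x :=
      (hasFDerivAt_id x).add (hd x).hasFDerivAt
    have h2 : (D x : EucSpace n →L[ℝ] EucSpace n) =
        ContinuousLinearMap.id ℝ (EucSpace n) + fderiv ℝ u x := by
      ext1 v
      simp [D]
    rw [h2]
    exact h1
  exact ⟨{ toEquiv := H.toEquiv
           contMDiff_toFun := hsm.contMDiff
           contMDiff_invFun := (H.contDiff_symm hD hsm).contMDiff }, hH⟩

/-- Cutting off a `C¹`-small perturbation of the identity. -/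
theorem exists_eucDiffeo_cutoff (n : ℕ) : ∃ ε : ℝ, 0 < ε ∧ ∀ r : ℝ, 0 < r →
    ∀ w : EucSpace n → EucSpace n, ContDiffOn ℝ ∞ w (Metric.ball 0 r) →
    (∀ x ∈ Metric.ball (0 : EucSpace n) r, ‖fderiv ℝ w x‖ ≤ ε) →
    (∀ x ∈ Metric.ball (0 : EucSpace n) r, ‖w x‖ ≤ ε * r) →
    ∃ h : EucDiffeo n, (∀ x, ‖x‖ ≤ r / 2 → h x = x + w x) ∧ ∀ x, r ≤ ‖x‖ → h x = x := by
  let χ : ContDiffBump (0 : EucSpace n) := ⟨1 / 2, 3 / 4, by norm_num, by norm_num⟩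
  have hχ : ContDiff ℝ ∞ χ := χ.contDiff
  obtain ⟨C, hC⟩ := (χ.hasCompactSupport.fderiv (𝕜 := ℝ)).exists_bound_of_continuous
    (hχ.continuous_fderiv (by simp))
  have hC0 : 0 ≤ C := (norm_nonneg _).trans (hC 0)
  -- The product rule bounds the derivative of the cut-off perturbation by ε + (C / r)(ε r) = ε (1 +
  -- C). This choice makes it 1/2 for every radius r.
  have hε : 0 < 1 / (2 * (1 + C)) := by positivity
  refine ⟨1 / (2 * (1 + C)), hε, fun r hr w hw hdw hbw => ?_⟩
  set ε := 1 / (2 * (1 + C)) with hεdef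
  let u : EucSpace n → EucSpace n := fun x => χ (r⁻¹ • x) • w x
  have hzero : ∀ x : EucSpace n, 3 / 4 * r ≤ ‖x‖ → u x = 0 := by
    intro x hx
    have : χ (r⁻¹ • x) = 0 := by
      apply χ.zero_of_le_dist
      rw [dist_zero_right, norm_smul, norm_inv, Real.norm_of_nonneg hr.le,
        le_inv_mul_iff₀ hr]
      change r * (3 / 4) ≤ _
      linarith
    simp [u, this]
  have hfar : ∀ x : EucSpace n, r ≤ ‖x‖ → u =ᶠ[𝓝 x] fun _ => 0 := by
    intro x hx
    have : ∀ᶠ y in 𝓝 x, 3 / 4 * r < ‖y‖ :=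
      continuous_norm.continuousAt.eventually (lt_mem_nhds (by linarith))
    filter_upwards [this] with y hy using hzero y hy.le
  have hχr : ContDiff ℝ ∞ (fun x : EucSpace n => χ (r⁻¹ • x)) :=
    hχ.comp (contDiff_const_smul _)
  have hu : ContDiff ℝ ∞ u := by
    rw [contDiff_iff_contDiffAt]
    intro x
    rcases lt_or_ge ‖x‖ r with hx | hx
    · exact hχr.contDiffAt.smul
        (hw.contDiffAt (Metric.isOpen_ball.mem_nhds (by simpa using hx)))
    · exact contDiffAt_const.congr_of_eventuallyEq (hfar x hx)
  have hdu : ∀ x, ‖fderiv ℝ u x‖ ≤ 1 / 2 := by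
    intro x
    rcases lt_or_ge ‖x‖ r with hx | hx
    · have hxb : x ∈ Metric.ball (0 : EucSpace n) r := by simpa using hx
      have h1 : HasFDerivAt w (fderiv ℝ w x) x :=
        ((hw.contDiffAt (Metric.isOpen_ball.mem_nhds hxb)).differentiableAt
          (by simp)).hasFDerivAt
      have h2 : HasFDerivAt (fun x : EucSpace n => χ (r⁻¹ • x))
          ((fderiv ℝ χ (r⁻¹ • x)).comp (r⁻¹ • ContinuousLinearMap.id ℝ (EucSpace n))) x := by
        have h3 : HasFDerivAt χ (fderiv ℝ χ (r⁻¹ • x)) (r⁻¹ • x) :=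
          (hχ.differentiable (by simp) _).hasFDerivAt
        exact h3.comp x ((hasFDerivAt_id x).const_smul r⁻¹)
      have h4 : fderiv ℝ u x = _ := (h2.smul h1).fderiv
      rw [h4]
      refine (norm_add_le _ _).trans ?_
      have e1 : ‖χ (r⁻¹ • x) • fderiv ℝ w x‖ ≤ 1 * ε := by
        rw [norm_smul]
        gcongr
        · rw [Real.norm_of_nonneg χ.nonneg]; exact χ.le_one
        · exact hdw x hxb
      have e2 : ‖((fderiv ℝ χ (r⁻¹ • x)).comp
          (r⁻¹ • ContinuousLinearMap.id ℝ (EucSpace n))).smulRight (w x)‖ ≤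
          (C * r⁻¹) * (ε * r) := by
        rw [ContinuousLinearMap.norm_smulRight_apply]
        refine mul_le_mul ?_ (hbw x hxb) (norm_nonneg _) (by positivity)
        refine (ContinuousLinearMap.opNorm_comp_le _ _).trans ?_
        refine mul_le_mul (hC _) ?_ (norm_nonneg _) hC0
        rw [norm_smul, norm_inv, Real.norm_of_nonneg hr.le]
        exact mul_le_of_le_one_right (by positivity) ContinuousLinearMap.norm_id_le
      refine (add_le_add e1 e2).trans (le_of_eq ?_)
      rw [hεdef]
      field_simp
    · rw [(hfar x hx).fderiv_eq]
      simp
  obtain ⟨h, hh⟩ := exists_eucDiffeo_id_add hu (c := 1 / 2) (by norm_num) (by norm_num) hdu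
  refine ⟨h, fun x hx => ?_, fun x hx => ?_⟩
  · have : χ (r⁻¹ • x) = 1 := by
      apply χ.one_of_mem_closedBall
      rw [mem_closedBall_zero_iff, norm_smul, norm_inv, Real.norm_of_nonneg hr.le,
        inv_mul_le_iff₀ hr]
      change _ ≤ r * (1 / 2)
      linarith
    rw [hh]
    simp [u, this]
  · rw [hh, hzero x (by linarith), add_zero]

/-- Small translations extend to diffeomorphisms with support in a given ball. -/
theorem exists_eucDiffeo_translation {r : ℝ} (hr : 0 < r) : ∃ δ > 0, ∀ v : EucSpace n, ‖v‖ < δ →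
    ∃ h : EucDiffeo n, (∀ x, r ≤ ‖x‖ → h x = x) ∧ ∀ᶠ x in 𝓝 0, h x = x + v := by
  obtain ⟨ε, hε, H⟩ := exists_eucDiffeo_cutoff n
  refine ⟨ε * r, by positivity, fun v hv => ?_⟩
  obtain ⟨h, h1, h2⟩ := H r hr (fun _ => v) contDiffOn_const (by simp [hε.le])
    (fun _ _ => hv.le)
  refine ⟨h, h2, ?_⟩
  filter_upwards [Metric.ball_mem_nhds (0 : EucSpace n) (half_pos hr)] with x hx
  exact h1 x (by simpa using (mem_ball_zero_iff.1 hx).le)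

/-- Contractions of the unit ball extend to diffeomorphisms with support in a larger ball. -/
theorem exists_eucDiffeo_shrink {η : ℝ} (hη : 0 < η) : ∃ s : ℝ, 0 < s ∧ s < η ∧
    ∃ h : EucDiffeo n, (∀ x, ‖x‖ ≤ 1 → h x = s • x) ∧ ∀ x, 2 ≤ ‖x‖ → h x = x := by
  obtain ⟨ε, hε, H⟩ := exists_eucDiffeo_cutoff n
  -- The cut-off allows only contraction factors close to 1. The bound 1/2 keeps `a` positive, and
  -- iterating `h` reaches any small factor because the unit ball is mapped into itself.
  set ε' := min ε (1 / 2) with hε'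
  have hε'0 : 0 < ε' := lt_min hε (by norm_num)
  have hε'1 : ε' ≤ 1 / 2 := min_le_right _ _
  set a : ℝ := 1 - ε' with ha
  have hder : ∀ x : EucSpace n, fderiv ℝ (fun y : EucSpace n => -ε' • y) x =
      -ε' • ContinuousLinearMap.id ℝ (EucSpace n) := fun x =>
    ((hasFDerivAt_id x).const_smul (-ε')).fderiv
  obtain ⟨h, h1, h2⟩ := H 2 two_pos (fun x => -ε' • x) (contDiff_const_smul _).contDiffOn
    (fun x _ => by
      rw [hder, norm_smul, norm_neg, Real.norm_of_nonneg hε'0.le]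
      exact (mul_le_of_le_one_right hε'0.le ContinuousLinearMap.norm_id_le).trans
        (min_le_left _ _))
    (fun x hx => by
      rw [norm_smul, norm_neg, Real.norm_of_nonneg hε'0.le]
      exact mul_le_mul (min_le_left _ _) (mem_ball_zero_iff.1 hx).le (norm_nonneg _) hε.le)
  have h3 : ∀ x, ‖x‖ ≤ 1 → h x = a • x := fun x hx => by
    rw [h1 x (by linarith), ha, sub_smul, one_smul, neg_smul, sub_eq_add_neg]
  obtain ⟨N, hN⟩ := exists_pow_lt_of_lt_one hη (y := a) (by linarith)
  have key : ∀ N : ℕ, ∃ h : EucDiffeo n, (∀ x, ‖x‖ ≤ 1 → h x = a ^ N • x) ∧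
      ∀ x, 2 ≤ ‖x‖ → h x = x := by
    intro N
    induction N with
    | zero => exact ⟨Diffeomorph.refl _ _ _, fun x _ => by simp, fun x _ => rfl⟩
    | succ N ih =>
      obtain ⟨g, g1, g2⟩ := ih
      refine ⟨h.trans g, fun x hx => ?_, fun x hx => ?_⟩
      · rw [Diffeomorph.coe_trans, Function.comp, h3 x hx, g1, smul_smul, pow_succ]
        rw [norm_smul, Real.norm_of_nonneg (by linarith)]
        nlinarith [norm_nonneg x]
      · rw [Diffeomorph.coe_trans, Function.comp, h2 x hx, g2 x hx]
  exact ⟨a ^ N, pow_pos (by linarith) N, hN, key N⟩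

/-- With t = 1/k this exhibits a k-th root of `1 + S` that tends to 1 as k grows. -/
theorem one_add_smul_pow_of_mul_self_eq_zero {R : Type*} [Ring R] [Algebra ℝ R] {S : R}
    (hS : S * S = 0) (t : ℝ) (k : ℕ) : (1 + t • S) ^ k = 1 + ((k : ℝ) * t) • S := by
  induction k with
  | zero => simp
  | succ k ih =>
    rw [pow_succ, ih, mul_add, add_mul, add_mul, one_mul, mul_one, smul_mul_smul_comm, hS,
      smul_zero, add_zero, one_mul]
    push_cast
    rw [add_assoc, ← add_smul]
    ring_nf

/-- The element acts as `t` on the image of the projection `S` and as 1 on its kernel. Taking t to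
be a k-th root of c gives a root of the dilation by c. -/
theorem one_add_smul_pow_of_idempotent {R : Type*} [Ring R] [Algebra ℝ R] {S : R}
    (hS : S * S = S) (t : ℝ) (k : ℕ) : (1 + (t - 1) • S) ^ k = 1 + (t ^ k - 1) • S := by
  induction k with
  | zero => simp
  | succ k ih =>
    rw [pow_succ, ih, mul_add, add_mul, add_mul, one_mul, mul_one, smul_mul_smul_comm, hS,
      one_mul, add_assoc, ← add_smul, ← add_smul]
    ring_nf

theorem tendsto_one_add_inv_smul {R : Type*} [NormedRing R] [NormedAlgebra ℝ R] (S : R) :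
    Filter.Tendsto (fun N : ℕ => 1 + ((N : ℝ)⁻¹) • S) Filter.atTop (𝓝 1) := by
  have : Filter.Tendsto (fun N : ℕ => 1 + ((N : ℝ)⁻¹) • S) Filter.atTop
      (𝓝 (1 + (0 : ℝ) • S)) :=
    (tendsto_const_nhds).add ((tendsto_inv_atTop_nhds_zero_nat (𝕜 := ℝ)).smul_const S)
  simpa using this

theorem tendsto_one_add_rpow_smul {R : Type*} [NormedRing R] [NormedAlgebra ℝ R] (S : R) {c : ℝ}
    (hc : 0 < c) :
    Filter.Tendsto (fun N : ℕ => 1 + (c ^ ((N : ℝ)⁻¹) - 1) • S) Filter.atTop (𝓝 1) := by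
  have h1 : Filter.Tendsto (fun N : ℕ => c ^ ((N : ℝ)⁻¹)) Filter.atTop (𝓝 (c ^ (0 : ℝ))) :=
    (Real.continuousAt_const_rpow hc.ne').tendsto.comp
      (tendsto_inv_atTop_nhds_zero_nat (𝕜 := ℝ))
  rw [Real.rpow_zero] at h1
  have := (tendsto_const_nhds (x := (1 : R))).add ((h1.sub_const 1).smul_const S)
  simpa using this

/-- The germ at `0` of the linear map `A` extends to diffeomorphisms of `ℝⁿ` with support in
arbitrarily small balls. -/
def HasSmallExtension (A : EucSpace n →L[ℝ] EucSpace n) : Prop :=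
  ∀ r : ℝ, 0 < r → ∃ h : EucDiffeo n, (∀ x, r ≤ ‖x‖ → h x = x) ∧ ∀ᶠ x in 𝓝 0, h x = A x

namespace HasSmallExtension

theorem one : HasSmallExtension (1 : EucSpace n →L[ℝ] EucSpace n) := fun _ _ =>
  ⟨Diffeomorph.refl _ _ _, fun _ _ => rfl, Filter.Eventually.of_forall fun _ => rfl⟩

theorem mul {A B : EucSpace n →L[ℝ] EucSpace n} (hA : HasSmallExtension A)
    (hB : HasSmallExtension B) : HasSmallExtension (A * B) := by
  intro r hr
  obtain ⟨a, a1, a2⟩ := hA r hr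
  obtain ⟨b, b1, b2⟩ := hB r hr
  refine ⟨b.trans a, fun x hx => ?_, ?_⟩
  · rw [Diffeomorph.coe_trans, Function.comp, b1 x hx, a1 x hx]
  · have : Filter.Tendsto B (𝓝 0) (𝓝 0) := by
      have := B.continuous.tendsto 0
      rwa [map_zero] at this
    filter_upwards [b2, this.eventually a2] with x h1 h2
    rw [Diffeomorph.coe_trans, Function.comp, h1, h2]; rfl

theorem pow {A : EucSpace n →L[ℝ] EucSpace n} (hA : HasSmallExtension A) (N : ℕ) :
    HasSmallExtension (A ^ N) := by
  induction N with
  | zero => rw [pow_zero]; exact one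
  | succ N ih => rw [pow_succ]; exact ih.mul hA

theorem conj {A : EucSpace n →L[ℝ] EucSpace n} (hA : HasSmallExtension A)
    {L L' : EucSpace n →L[ℝ] EucSpace n} (h1 : L * L' = 1) (h2 : L' * L = 1) :
    HasSmallExtension (L * A * L') := by
  intro r hr
  -- If ‖x‖ ≥ r then ‖L' x‖ ≥ r / (‖L‖ + 1), so the conjugate is the identity there; the summand 1
  -- avoids division by zero.
  obtain ⟨a, a1, a2⟩ := hA (r / (‖L‖ + 1)) (by positivity)
  let e : EucSpace n ≃L[ℝ] EucSpace n := ContinuousLinearEquiv.equivOfInverse L L'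
    (fun x => congrArg (fun T : EucSpace n →L[ℝ] EucSpace n => T x) h2)
    (fun x => congrArg (fun T : EucSpace n →L[ℝ] EucSpace n => T x) h1)
  have hLL' : ∀ x, L (L' x) = x := e.apply_symm_apply
  refine ⟨e.symm.toDiffeomorph.trans (a.trans e.toDiffeomorph), fun x hx => ?_, ?_⟩
  · change L (a (L' x)) = x
    rw [a1, hLL']
    rw [div_le_iff₀ (by positivity)]
    have := L.le_opNorm (L' x)
    rw [hLL'] at this
    nlinarith [norm_nonneg (L' x)]
  · have : Filter.Tendsto L' (𝓝 0) (𝓝 0) := by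
      have := L'.continuous.tendsto 0
      rwa [map_zero] at this
    filter_upwards [this.eventually a2] with x hx
    change L (a (L' x)) = L (A (L' x))
    rw [hx]

/-- For a linear perturbation the cut-off conditions are invariant under scaling, so one ε serves
balls of every radius. -/
theorem exists_near_one (n : ℕ) : ∃ ε > 0, ∀ A : EucSpace n →L[ℝ] EucSpace n,
    ‖A - 1‖ ≤ ε → HasSmallExtension A := by
  obtain ⟨ε, hε, H⟩ := exists_eucDiffeo_cutoff n
  refine ⟨ε, hε, fun A hA r hr => ?_⟩
  obtain ⟨h, h1, h2⟩ := H r hr (A - 1 : EucSpace n →L[ℝ] EucSpace n)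
    (A - 1 : EucSpace n →L[ℝ] EucSpace n).contDiff.contDiffOn
    (fun x _ => by rw [ContinuousLinearMap.fderiv]; exact hA)
    (fun x hx => (ContinuousLinearMap.le_opNorm _ _).trans
      (mul_le_mul hA (mem_ball_zero_iff.1 hx).le (norm_nonneg _) hε.le))
  refine ⟨h, h2, ?_⟩
  filter_upwards [Metric.ball_mem_nhds (0 : EucSpace n) (half_pos hr)] with x hx
  rw [h1 x (mem_ball_zero_iff.1 hx).le]
  simp

/-- Maps close to 1 have small extensions and the property passes to powers, so it is enough to have
roots that tend to 1. -/
theorem of_roots {A : EucSpace n →L[ℝ] EucSpace n}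
    {B : ℕ → EucSpace n →L[ℝ] EucSpace n} (hB : Filter.Tendsto B Filter.atTop (𝓝 1))
    (hA : ∀ N, 0 < N → B N ^ N = A) : HasSmallExtension A := by
  obtain ⟨ε, hε, H⟩ := exists_near_one n
  obtain ⟨N, hN, hN0⟩ :=
    ((hB.eventually (Metric.ball_mem_nhds _ hε)).and (Filter.eventually_gt_atTop 0)).exists
  rw [← hA N hN0]
  exact (H _ (by rw [← dist_eq_norm]; exact (Metric.mem_ball.1 hN).le)).pow N

theorem one_add_of_mul_self_eq_zero {S : EucSpace n →L[ℝ] EucSpace n} (hS : S * S = 0) :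
    HasSmallExtension (1 + S) := by
  refine of_roots (B := fun N : ℕ => 1 + ((N : ℝ)⁻¹) • S)
    (tendsto_one_add_inv_smul S) fun N hN => ?_
  have : (N : ℝ) ≠ 0 := by positivity
  rw [one_add_smul_pow_of_mul_self_eq_zero hS, mul_inv_cancel₀ this]
  exact congrArg (1 + ·) (one_smul ℝ S)

theorem one_add_of_idempotent {S : EucSpace n →L[ℝ] EucSpace n} (hS : S * S = S) {c : ℝ}
    (hc : 0 < c) : HasSmallExtension (1 + (c - 1) • S) := by
  refine of_roots (B := fun N : ℕ => 1 + (c ^ ((N : ℝ)⁻¹) - 1) • S)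
    (tendsto_one_add_rpow_smul S hc) fun N hN => ?_
  rw [one_add_smul_pow_of_idempotent hS, Real.rpow_inv_natCast_pow hc.le hN.ne']

end HasSmallExtension

/-! ### Matrices of positive determinant via elementary matrices -/

section Matrices

open Matrix

/-- The germ at `0` of the linear map with matrix `M` extends to diffeomorphisms of `ℝⁿ` with
support in arbitrarily small balls. -/
def Matrix.HasSmallExtension (M : Matrix (Fin n) (Fin n) ℝ) : Prop :=
  _root_.HasSmallExtension (toEuclideanCLM (𝕜 := ℝ) (n := Fin n) M)

namespace Matrix.HasSmallExtension

theorem mul {A B : Matrix (Fin n) (Fin n) ℝ} (hA : A.HasSmallExtension)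
    (hB : B.HasSmallExtension) : (A * B).HasSmallExtension := by
  unfold Matrix.HasSmallExtension
  rw [map_mul]
  exact _root_.HasSmallExtension.mul hA hB

theorem one : (1 : Matrix (Fin n) (Fin n) ℝ).HasSmallExtension := by
  unfold Matrix.HasSmallExtension
  rw [map_one]
  exact _root_.HasSmallExtension.one

theorem conj {A L L' : Matrix (Fin n) (Fin n) ℝ} (hA : A.HasSmallExtension)
    (h1 : L * L' = 1) (h2 : L' * L = 1) : (L * A * L').HasSmallExtension := by
  unfold Matrix.HasSmallExtension
  rw [map_mul, map_mul]
  exact _root_.HasSmallExtension.conj hA (by rw [← map_mul, h1, map_one])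
    (by rw [← map_mul, h2, map_one])

theorem transvection {i j : Fin n} (hij : i ≠ j) (c : ℝ) :
    (Matrix.transvection i j c).HasSmallExtension := by
  unfold Matrix.HasSmallExtension Matrix.transvection
  rw [map_add, map_one]
  refine _root_.HasSmallExtension.one_add_of_mul_self_eq_zero ?_
  rw [← map_mul, single_mul_single_of_ne _ _ _ _ hij.symm, map_zero]

/-- The diagonal matrix with entry `c` at `i` and all other diagonal entries equal to `1`. -/
def dilation (i : Fin n) (c : ℝ) : Matrix (Fin n) (Fin n) ℝ :=
  diagonal (Function.update 1 i c)

theorem dilation_eq (i : Fin n) (c : ℝ) : dilation i c = 1 + (c - 1) • single i i 1 := by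
  ext k l
  rcases eq_or_ne k l with rfl | hkl
  · rcases eq_or_ne k i with rfl | hki
    · simp [dilation]
    · simp [dilation, hki, hki.symm]
  · have : ¬ (i = k ∧ i = l) := fun h => hkl (h.1.symm.trans h.2)
    simp [dilation, hkl, this]

theorem dilation_pos (i : Fin n) {c : ℝ} (hc : 0 < c) : (dilation i c).HasSmallExtension := by
  unfold Matrix.HasSmallExtension
  rw [dilation_eq, map_add, map_one, map_smul]
  refine _root_.HasSmallExtension.one_add_of_idempotent ?_ hc
  rw [← map_mul, single_mul_single_same, one_mul]

theorem dilation_mul_dilation (i : Fin n) (c d : ℝ) :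
    dilation i c * dilation i d = dilation i (c * d) := by
  rw [dilation, dilation, diagonal_mul_diagonal, dilation]
  congr 1
  ext k
  rcases eq_or_ne k i with rfl | hki
  · simp
  · simp [hki]

/-- The product is the half turn in the (i, j)-plane: the square of a quarter turn, which is itself
a product of three transvections. -/
theorem dilation_neg_one_mul {i j : Fin n} (hij : i ≠ j) :
    (dilation i (-1) * dilation j (-1)).HasSmallExtension := by
  have h := (((transvection hij (-1)).mul (transvection hij.symm 1)).mul (transvection hij (-1)))
  convert h.mul h using 1
  have e1 : single i j (1 : ℝ) * single i j 1 = 0 := single_mul_single_of_ne _ _ _ _ hij.symm _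
  have e2 : single j i (1 : ℝ) * single j i 1 = 0 := single_mul_single_of_ne _ _ _ _ hij _
  have e3 : single i i (1 : ℝ) * single j j 1 = 0 := single_mul_single_of_ne _ _ _ _ hij _
  rw [dilation_eq, dilation_eq, Matrix.transvection, Matrix.transvection]
  have e4 : single i j (-1 : ℝ) = - single i j 1 := by
    rw [← neg_one_smul ℝ (single i j (1 : ℝ)), smul_single]; simp
  have e5 : single i i (1 : ℝ) = single i j 1 * single j i 1 := by simp
  have e6 : single j j (1 : ℝ) = single j i 1 * single i j 1 := by simp
  have e7 : single i j (1 : ℝ) * single j i 1 * single i j 1 = single i j 1 := by simp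
  have e8 : single j i (1 : ℝ) * single i j 1 * single j i 1 = single j i 1 := by simp
  rw [e4, e5, e6]
  rw [e5, e6] at e3
  generalize single i j (1 : ℝ) = e at *
  generalize single j i (1 : ℝ) = f at *
  have e9 : (1 + -e) * (1 + f) * (1 + -e) = 1 - e * f - f * e + f - e := by
    calc (1 + -e) * (1 + f) * (1 + -e) = 1 - e - e + f - e * f - f * e + e * e + e * f * e := by
          noncomm_ring
      _ = _ := by rw [e1, e7]; abel
  rw [e9]
  have f1 : e * (e * f) = 0 := by rw [← mul_assoc, e1, zero_mul]
  have f2 : f * (f * e) = 0 := by rw [← mul_assoc, e2, zero_mul]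
  have f3 : e * (f * e) = e := by rw [← mul_assoc, e7]
  have f4 : f * (e * f) = f := by rw [← mul_assoc, e8]
  have c2 : ((-1 : ℝ) - 1) = -2 := by norm_num
  simp only [mul_add, add_mul, sub_mul, mul_sub, mul_one, one_mul, mul_assoc, e1, e2, f1, f2, f3,
    f4, mul_zero, c2, neg_smul, mul_neg, neg_mul, smul_mul_smul_comm, smul_zero]
  simp only [two_smul]
  abel

/-- A matrix has small extensions, up to a reflection if its determinant is negative. -/
def UpToReflection (i : Fin n) (M : Matrix (Fin n) (Fin n) ℝ) : Prop :=
  (0 < M.det → M.HasSmallExtension) ∧ (M.det < 0 → (M * dilation i (-1)).HasSmallExtension)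

theorem det_dilation (i : Fin n) (c : ℝ) : (dilation i c).det = c := by
  rw [dilation, det_diagonal, Finset.prod_update_of_mem (Finset.mem_univ _)]
  simp

theorem dilation_one (i : Fin n) : dilation i 1 = 1 := by simp [dilation_eq]

theorem dilation_neg_one_sq (i : Fin n) : dilation i (-1) * dilation i (-1) = 1 := by
  rw [dilation_mul_dilation]; norm_num [dilation_one]

/-- With R the reflection, insert R R = 1 between factors and use that conjugation by R preserves
small extensions: A B = (A R)(R B), and A B R = (A R)(R B R). -/
theorem UpToReflection.mul {i : Fin n} {A B : Matrix (Fin n) (Fin n) ℝ} (hA : UpToReflection i A)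
    (hB : UpToReflection i B) (hA0 : A.det ≠ 0) (hB0 : B.det ≠ 0) : UpToReflection i (A * B) := by
  have hR := dilation_neg_one_sq i
  have hBR : B.det < 0 → (dilation i (-1) * B).HasSmallExtension := fun h => by
    have := (hB.2 h).conj hR hR
    rwa [mul_assoc, mul_assoc, hR, mul_one] at this
  have hRA : 0 < A.det → (dilation i (-1) * A * dilation i (-1)).HasSmallExtension := fun h =>
    (hA.1 h).conj hR hR
  rw [UpToReflection, det_mul]
  rcases lt_or_gt_of_ne hA0 with ha | ha <;> rcases lt_or_gt_of_ne hB0 with hb | hb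
  · refine ⟨fun _ => ?_, fun h => absurd h (mul_pos_of_neg_of_neg ha hb).not_gt⟩
    have := (hA.2 ha).mul (hBR hb)
    rwa [mul_assoc, ← mul_assoc (dilation i (-1)), hR, one_mul] at this
  · refine ⟨fun h => absurd h (mul_neg_of_neg_of_pos ha hb).not_gt, fun _ => ?_⟩
    have := (hA.2 ha).mul ((hB.1 hb).conj hR hR)
    rwa [mul_assoc A, mul_assoc (dilation i (-1)) B, ← mul_assoc (dilation i (-1)), hR, one_mul,
      ← mul_assoc] at this
  · refine ⟨fun h => absurd h (mul_neg_of_pos_of_neg ha hb).not_gt, fun _ => ?_⟩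
    rw [mul_assoc]
    exact (hA.1 ha).mul (hB.2 hb)
  · exact ⟨fun _ => (hA.1 ha).mul (hB.1 hb), fun h => absurd h (mul_pos ha hb).not_gt⟩

/-- A negative dilation is a positive one times a reflection. Together with the correcting
reflection this gives the identity or a half turn. -/
theorem upToReflection_dilation (i j : Fin n) {c : ℝ} : UpToReflection i (dilation j c) := by
  rw [UpToReflection, det_dilation]
  refine ⟨dilation_pos j, fun hc => ?_⟩
  have h1 : dilation j c = dilation j (-c) * dilation j (-1) := by
    rw [dilation_mul_dilation]; norm_num
  rw [h1, mul_assoc]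
  refine (dilation_pos j (by linarith)).mul ?_
  rcases eq_or_ne j i with rfl | hij
  · rw [dilation_neg_one_sq]; exact one
  · exact dilation_neg_one_mul hij

/-- Gaussian elimination: an invertible matrix is a product of transvections, which have determinant
1, and a diagonal matrix, which is a product of dilations. -/
theorem upToReflection_of_det_ne_zero (i : Fin n) (M : Matrix (Fin n) (Fin n) ℝ)
    (hM : M.det ≠ 0) : UpToReflection i M := by
  refine diagonal_transvection_induction_of_det_ne_zero (UpToReflection i) M hM ?_ ?_ ?_
  · intro D hD
    rw [det_diagonal, Finset.prod_ne_zero_iff] at hD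
    have key : ∀ s : Finset (Fin n),
        (diagonal fun k => if k ∈ s then D k else 1).det ≠ 0 ∧
        UpToReflection i (diagonal fun k => if k ∈ s then D k else 1) := by
      intro s
      induction s using Finset.induction_on with
      | empty =>
        simp only [Finset.notMem_empty, if_false]
        refine ⟨by simp, ?_⟩
        have := upToReflection_dilation i i (c := 1)
        rw [dilation_one] at this
        exact this
      | insert a s has ih =>
        have e : (diagonal fun k => if k ∈ insert a s then D k else 1) =
            dilation a (D a) * diagonal fun k => if k ∈ s then D k else 1 := by
          rw [dilation, diagonal_mul_diagonal]
          congr 1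
          ext k
          rcases eq_or_ne k a with rfl | hka
          · simp [has]
          · simp [hka]
        have h0 : (dilation a (D a)).det ≠ 0 := by
          rw [det_dilation]; exact hD a (Finset.mem_univ a)
        rw [e]
        exact ⟨by rw [det_mul]; exact mul_ne_zero h0 ih.1,
          (upToReflection_dilation i a).mul ih.2 h0 ih.1⟩
    simpa using (key Finset.univ).2
  · intro t
    refine ⟨fun _ => ?_, fun h => ?_⟩
    · exact transvection t.hij t.c
    · rw [TransvectionStruct.det] at h
      exact absurd h (by norm_num)
  · exact fun A B hA hB h1 h2 => h1.mul h2 hA hB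

end Matrix.HasSmallExtension

end Matrices

theorem det_toEuclideanCLM (M : Matrix (Fin n) (Fin n) ℝ) :
    LinearMap.det (Matrix.toEuclideanCLM (𝕜 := ℝ) (n := Fin n) M).toLinearMap = M.det := by
  have : (Matrix.toEuclideanCLM (𝕜 := ℝ) (n := Fin n) M).toLinearMap = Matrix.toLin
      (EuclideanSpace.basisFun (Fin n) ℝ).toBasis (EuclideanSpace.basisFun (Fin n) ℝ).toBasis
      M := by
    rw [← Matrix.toEuclideanLin_eq_toLin_orthonormal]
    rfl
  rw [this, LinearMap.det_toLin]

/-- Linear automorphisms of positive determinant have small extensions. -/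
theorem HasSmallExtension.of_det_pos {A : EucSpace n →L[ℝ] EucSpace n}
    (hA : 0 < LinearMap.det A.toLinearMap) : HasSmallExtension A := by
  rcases isEmpty_or_nonempty (Fin n) with hn | ⟨⟨i⟩⟩
  · have : A = 1 := by
      ext1 v
      exact Subsingleton.elim _ _
    rw [this]; exact .one
  · let e := Matrix.toEuclideanCLM (𝕜 := ℝ) (n := Fin n)
    have hA' : e (e.symm A) = A := e.apply_symm_apply A
    have hdet : (e.symm A).det = LinearMap.det A.toLinearMap := by
      conv_rhs => rw [← hA']
      exact (det_toEuclideanCLM _).symm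
    have := (Matrix.HasSmallExtension.upToReflection_of_det_ne_zero i (e.symm A)
      (by rw [hdet]; exact hA.ne')).1 (by rw [hdet]; exact hA)
    unfold Matrix.HasSmallExtension at this
    rw [← hA']
    exact this

/-- Orientation-preserving germs of diffeomorphisms of `ℝⁿ` at the fixed point `0` extend to
diffeomorphisms with support in a given ball. -/
theorem exists_eucDiffeo_germ {k : EucSpace n → EucSpace n} (hk : LocDiffAt n k 0) (hk0 : k 0 = 0)
    (hs : mdetSign n k 0 = 1) {r : ℝ} (hr : 0 < r) :
    ∃ h : EucDiffeo n, (∀ x, r ≤ ‖x‖ → h x = x) ∧ ∀ᶠ x in 𝓝 0, h x = k x := by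
  have hdet : 0 < LinearMap.det (fderiv ℝ k 0).toLinearMap := by
    rw [mdetSign_eq_fderiv] at hs
    exact sign_eq_one_iff.1 hs
  obtain ⟨a, a1, a2⟩ := HasSmallExtension.of_det_pos hdet r hr
  let A : EucSpace n ≃L[ℝ] EucSpace n :=
    (LinearEquiv.ofIsUnitDet (f := (fderiv ℝ k 0).toLinearMap) (v := Module.finBasis ℝ _)
      (v' := Module.finBasis ℝ _) (by simpa using hdet.ne')).toContinuousLinearEquiv
  have hA : ∀ v, A v = fderiv ℝ k 0 v := fun _ => rfl
  -- Factor k = A ∘ (1 + w) with A the derivative at 0. Here `w` vanishes to first order, hence is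
  -- C¹-small on small balls; `b` extends the germ of 1 + w and `a` that of A.
  let w : EucSpace n → EucSpace n := fun x => A.symm (k x) - x
  obtain ⟨Φ, h0, hΦ⟩ := hk
  obtain ⟨δ, hδ, hball⟩ := Metric.isOpen_iff.1 Φ.open_source 0 h0
  have hksm : ContDiffOn ℝ ∞ k (Metric.ball 0 δ) :=
    (contMDiffOn_iff_contDiffOn.1 ((Φ.contMDiffOn_toFun).mono hball)).congr
      fun x hx => hΦ (hball hx)
  have hw : ContDiffOn ℝ ∞ w (Metric.ball 0 δ) :=
    (A.symm.contDiff.comp_contDiffOn hksm).sub contDiffOn_id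
  have hw0 : w 0 = 0 := by simp [w, hk0]
  have hball0 : Metric.ball (0 : EucSpace n) δ ∈ 𝓝 0 := Metric.ball_mem_nhds _ hδ
  have hdw0 : fderiv ℝ w 0 = 0 := by
    have h1 : HasFDerivAt k (fderiv ℝ k 0) 0 :=
      ((hksm.contDiffAt hball0).differentiableAt (by simp)).hasFDerivAt
    have h2 : HasFDerivAt w _ 0 :=
      ((A.symm : EucSpace n →L[ℝ] EucSpace n).hasFDerivAt.comp 0 h1).sub (hasFDerivAt_id 0)
    rw [h2.fderiv]
    ext1 v
    change A.symm (fderiv ℝ k 0 v) - v = 0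
    rw [← hA, A.symm_apply_apply, sub_self]
  obtain ⟨ε, hε, H⟩ := exists_eucDiffeo_cutoff n
  have hcont : ContinuousAt (fderiv ℝ w) 0 :=
    (hw.contDiffAt hball0).continuousAt_fderiv (by simp)
  have hsmall : ∀ᶠ x in 𝓝 0, ‖fderiv ℝ w x‖ < ε := by
    have := hcont.norm
    rw [ContinuousAt, hdw0, norm_zero] at this
    exact this.eventually (gt_mem_nhds hε)
  obtain ⟨η, hη, hηs⟩ := Metric.eventually_nhds_iff_ball.1 hsmall
  set t := min r (min δ η) with ht
  have ht0 : 0 < t := lt_min hr (lt_min hδ hη)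
  have hwt : ContDiffOn ℝ ∞ w (Metric.ball 0 t) :=
    hw.mono (Metric.ball_subset_ball ((min_le_right _ _).trans (min_le_left _ _)))
  have hdwt : ∀ x ∈ Metric.ball (0 : EucSpace n) t, ‖fderiv ℝ w x‖ ≤ ε := fun x hx =>
    (hηs x (Metric.ball_subset_ball ((min_le_right _ _).trans (min_le_right _ _)) hx)).le
  obtain ⟨b, b1, b2⟩ := H t ht0 w hwt hdwt fun x hx => by
    have := (convex_ball (0 : EucSpace n) t).norm_image_sub_le_of_norm_fderiv_le (f := w)
      (fun y hy => (hwt.contDiffAt (Metric.isOpen_ball.mem_nhds hy)).differentiableAt (by simp))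
      hdwt (Metric.mem_ball_self ht0) hx
    rw [hw0, sub_zero, sub_zero] at this
    exact this.trans (mul_le_mul_of_nonneg_left (mem_ball_zero_iff.1 hx).le hε.le)
  refine ⟨b.trans a, fun x hx => ?_, ?_⟩
  · rw [Diffeomorph.coe_trans, Function.comp, b2 x ((min_le_left _ _).trans hx), a1 x hx]
  · have hb0 : Filter.Tendsto b (𝓝 0) (𝓝 0) := by
      have := b.continuous.tendsto 0
      rwa [b1 0 (by simpa using (half_pos ht0).le), hw0, add_zero] at this
    filter_upwards [Metric.ball_mem_nhds (0 : EucSpace n) (half_pos ht0), hb0.eventually a2]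
      with x hx h2
    rw [Diffeomorph.coe_trans, Function.comp, h2, b1 x (mem_ball_zero_iff.1 hx).le]
    have : x + w x = A.symm (k x) := by simp [w]
    rw [this, ← hA, A.apply_symm_apply]

theorem eq_of_isPreconnected_of_eventually_eq {X α : Type*} [TopologicalSpace X] {s : Set X}
    (hs : IsPreconnected s) {f : X → α} (hf : ∀ x ∈ s, ∀ᶠ y in 𝓝 x, f y = f x) {x y : X}
    (hx : x ∈ s) (hy : y ∈ s) : f x = f y := by
  let _ : TopologicalSpace α := ⊥
  have _ : DiscreteTopology α := ⟨rfl⟩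
  refine hs.constant (f := f) (fun z hz => ?_) hx hy
  have : ContinuousAt f z := by
    rw [ContinuousAt, nhds_discrete α, Filter.tendsto_pure]
    exact hf z hz
  exact this.continuousWithinAt

/-- The sign is constant on ℝⁿ by connectedness and equals 1 far out, where `h` is the identity. -/
theorem EucDiffeo.mdetSign_eq_one (hn : 2 ≤ n) (h : EucDiffeo n) {r : ℝ}
    (hr : ∀ x, r ≤ ‖x‖ → h x = x) (x : EucSpace n) : mdetSign n h x = 1 := by
  have : Nonempty (Fin n) := ⟨⟨0, by omega⟩⟩
  obtain ⟨y, hy⟩ := NormedSpace.exists_lt_norm ℝ (EucSpace n) r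
  have h1 : mdetSign n h x = mdetSign n h y :=
    eq_of_isPreconnected_of_eventually_eq isPreconnected_univ
      (fun z _ => eventually_mdetSign_eq (h.isLocalDiffeomorph z)) (mem_univ x) (mem_univ y)
  rw [h1, mdetSign_congr (g := fun z => z), mdetSign_id]
  filter_upwards [continuous_norm.continuousAt.eventually (lt_mem_nhds hy)] with z hz
    using hr z hz.le

end EuclideanDiffeomorphisms

/-! ### Moving germs in a manifold by ambient diffeomorphisms -/

section GermMoves

variable {n : ℕ} {X : Type*} [TopologicalSpace X] [ChartedSpace (EucSpace n) X]

/-- Smooth self-diffeomorphisms of `X`. -/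
abbrev SelfDiffeo (n : ℕ) (X : Type*) [TopologicalSpace X] [ChartedSpace (EucSpace n) X] :
    Type _ := Diffeomorph (𝓡 n) (𝓡 n) X X ∞

/-- `Ψ` preserves every orientation of `X`. -/
def PreservesOrientations (ρ : Orientation ℝ (EucSpace n) (Fin n)) (Ψ : SelfDiffeo n X) : Prop :=
  ∀ (o : ManifoldOrientation n X) (x : X), mdetSign n Ψ x * o.sign ρ x = o.sign ρ (Ψ x)

variable {ρ : Orientation ℝ (EucSpace n) (Fin n)}

theorem PreservesOrientations.refl : PreservesOrientations ρ (Diffeomorph.refl (𝓡 n) X ∞) :=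
  fun o x => by
    have : mdetSign n (Diffeomorph.refl (𝓡 n) X ∞) x = 1 := mdetSign_id x
    rw [this, one_mul]; rfl

theorem PreservesOrientations.trans {Ψ Θ : SelfDiffeo n X} (h : PreservesOrientations ρ Ψ)
    (h' : PreservesOrientations ρ Θ) : PreservesOrientations ρ (Ψ.trans Θ) := fun o x => by
  have : mdetSign n (Ψ.trans Θ) x = mdetSign n Θ (Ψ x) * mdetSign n Ψ x :=
    mdetSign_comp (Θ.isLocalDiffeomorph _) (Ψ.isLocalDiffeomorph x)
  rw [this, mul_assoc, h o x, h' o (Ψ x)]; rfl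

theorem PreservesOrientations.symm {Ψ : SelfDiffeo n X} (h : PreservesOrientations ρ Ψ) :
    PreservesOrientations ρ Ψ.symm := fun o x => by
  have h1 : mdetSign n (fun y => Ψ (Ψ.symm y)) x = mdetSign n Ψ (Ψ.symm x) * mdetSign n Ψ.symm x :=
    mdetSign_comp (Ψ.isLocalDiffeomorph _) (Ψ.symm.isLocalDiffeomorph x)
  rw [mdetSign_congr (g := fun y => y) (Filter.Eventually.of_forall Ψ.apply_symm_apply),
    mdetSign_id] at h1
  have h2 := h o (Ψ.symm x)
  rw [Ψ.apply_symm_apply] at h2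
  rw [← h2]
  revert h1
  generalize mdetSign n Ψ (Ψ.symm x) = a
  generalize mdetSign n Ψ.symm x = b
  generalize o.sign ρ (Ψ.symm x) = c
  revert a b c; decide

/-- Some diffeomorphism of `X` that preserves all orientations and fixes a neighbourhood of `F`
carries the germ of `f` at `0` to the germ of `g` at `0`. -/
def GermMove (ρ : Orientation ℝ (EucSpace n) (Fin n)) (F : Set X) (f g : EucSpace n → X) : Prop :=
  ∃ Ψ : SelfDiffeo n X, PreservesOrientations ρ Ψ ∧ (∀ x ∈ F, ∀ᶠ y in 𝓝 x, Ψ y = y) ∧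
    ∀ᶠ p in 𝓝 0, Ψ (f p) = g p

namespace GermMove

variable {F : Set X} {f g k : EucSpace n → X}

theorem of_eventuallyEq (h : ∀ᶠ p in 𝓝 0, f p = g p) : GermMove ρ F f g :=
  ⟨Diffeomorph.refl _ _ _, .refl, fun _ _ => .of_forall fun _ => rfl, h⟩

theorem refl (f : EucSpace n → X) : GermMove ρ F f f := of_eventuallyEq (.of_forall fun _ => rfl)

theorem symm (h : GermMove ρ F f g) : GermMove ρ F g f := by
  obtain ⟨Ψ, h1, h2, h3⟩ := h
  refine ⟨Ψ.symm, h1.symm, fun x hx => ?_, ?_⟩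
  · filter_upwards [h2 x hx] with y hy
    exact Ψ.toEquiv.symm_apply_eq.2 hy.symm
  · filter_upwards [h3] with p hp
    rw [← hp, Ψ.symm_apply_apply]

theorem trans (h : GermMove ρ F f g) (h' : GermMove ρ F g k) : GermMove ρ F f k := by
  obtain ⟨Ψ, h1, h2, h3⟩ := h
  obtain ⟨Θ, k1, k2, k3⟩ := h'
  refine ⟨Ψ.trans Θ, h1.trans k1, fun x hx => ?_, ?_⟩
  · filter_upwards [h2 x hx, k2 x hx] with y hy hy'
    rw [Diffeomorph.coe_trans, Function.comp, hy, hy']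
  · filter_upwards [h3, k3] with p hp hp'
    rw [Diffeomorph.coe_trans, Function.comp, hp, hp']

theorem comp_right (h : GermMove ρ F f g) {R : EucSpace n → EucSpace n} (hR : ContinuousAt R 0)
    (hR0 : R 0 = 0) : GermMove ρ F (fun p => f (R p)) (fun p => g (R p)) := by
  obtain ⟨Ψ, h1, h2, h3⟩ := h
  refine ⟨Ψ, h1, h2, ?_⟩
  rw [ContinuousAt, hR0] at hR
  exact hR.eventually h3

end GermMove

theorem LocDiffAt.exists_ball [T2Space X] {g : EucSpace n → X} (hg : LocDiffAt n g 0) {F : Set X}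
    (hF : F.Finite) : ∃ r > 0, InjOn g (Metric.ball 0 r) ∧
      (∀ p ∈ Metric.ball (0 : EucSpace n) r, LocDiffAt n g p) ∧
      ∀ p ∈ Metric.ball (0 : EucSpace n) r, g p ∈ F → p = 0 := by
  obtain ⟨k, -, -, hl, -⟩ := hg.exists_inverse
  have h1 : ∀ᶠ p in 𝓝 0, g p ∉ F \ {g 0} :=
    hg.continuousAt.eventually ((hF.subset sdiff_subset).isClosed.isOpen_compl.mem_nhds (by simp))
  obtain ⟨r, hr, h⟩ := Metric.eventually_nhds_iff_ball.1 (hl.and (hg.eventually.and h1))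
  have hinj : InjOn g (Metric.ball 0 r) := fun p hp q hq hpq => by
    rw [← (h p hp).1, ← (h q hq).1, hpq]
  refine ⟨r, hr, hinj, fun p hp => (h p hp).2.1, fun p hp hpF => ?_⟩
  have := (h p hp).2.2
  by_contra hp0
  refine this ⟨hpF, fun hc => hp0 (hinj hp (Metric.mem_ball_self hr) hc)⟩

theorem EucDiffeo.mapsTo_ball (h : EucDiffeo n) {r' r : ℝ} (hh : ∀ x, r' ≤ ‖x‖ → h x = x)
    (hr : r' ≤ r) : MapsTo h (Metric.ball 0 r) (Metric.ball 0 r) := by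
  intro p hp
  rw [mem_ball_zero_iff] at hp ⊢
  by_contra hcon
  have h1 := h.injective (hh (h p) (hr.trans (not_lt.1 hcon)))
  exact hcon (h1.symm ▸ hp)

theorem EucDiffeo.symm_eq_self (h : EucDiffeo n) {r : ℝ} (hh : ∀ x, r ≤ ‖x‖ → h x = x)
    (x : EucSpace n) (hx : r ≤ ‖x‖) : h.symm x = x := by
  conv_lhs => rw [← hh x hx]
  exact h.symm_apply_apply x

variable [T2Space X] [IsManifold (𝓡 n) ∞ X]

/-- Transport of a diffeomorphism of `ℝⁿ` supported in a ball along an embedding of a larger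
ball. -/
theorem exists_transport (hn : 2 ≤ n) {g : EucSpace n → X} {r' r : ℝ} (hr : r' < r)
    (hinj : InjOn g (Metric.ball 0 r)) (hg : ∀ p ∈ Metric.ball (0 : EucSpace n) r, LocDiffAt n g p)
    (h : EucDiffeo n) (hh : ∀ x, r' ≤ ‖x‖ → h x = x) :
    ∃ Ψ : SelfDiffeo n X, PreservesOrientations ρ Ψ ∧
      (∀ p ∈ Metric.ball (0 : EucSpace n) r, Ψ (g p) = g (h p)) ∧
      ∀ x ∉ g '' Metric.closedBall 0 r', Ψ x = x := by
  classical
  -- Conjugate by `g` on the image of the larger ball and extend by the identity. The two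
  -- definitions agree outside the closed image of the smaller ball, which is what makes `T h`
  -- smooth.
  let T : EucDiffeo n → X → X := fun h x =>
    if x ∈ g '' Metric.ball 0 r then g (h (Function.invFunOn g (Metric.ball 0 r) x)) else x
  have hT1 : ∀ (h : EucDiffeo n), ∀ p ∈ Metric.ball (0 : EucSpace n) r, T h (g p) = g (h p) := by
    intro h p hp
    have h1 : g p ∈ g '' Metric.ball 0 r := mem_image_of_mem g hp
    simp only [T, h1, if_true, hinj.leftInvOn_invFunOn hp]
  have hT2 : ∀ (h : EucDiffeo n), (∀ x, r' ≤ ‖x‖ → h x = x) →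
      ∀ x ∉ g '' Metric.closedBall 0 r', T h x = x := by
    intro h hh x hx
    by_cases hxb : x ∈ g '' Metric.ball 0 r
    · obtain ⟨p, hp, rfl⟩ := hxb
      rw [hT1 h p hp, hh p]
      by_contra hc
      exact hx ⟨p, by simpa using (not_le.1 hc).le, rfl⟩
    · simp only [T, hxb, if_false]
  have hinv : ∀ h h' : EucDiffeo n, (∀ x, r' ≤ ‖x‖ → h x = x) → (∀ x, h' (h x) = x) →
      ∀ x, T h' (T h x) = x := by
    intro h h' hh hhh x
    by_cases hxb : x ∈ g '' Metric.ball 0 r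
    · obtain ⟨p, hp, rfl⟩ := hxb
      rw [hT1 h p hp, hT1 h' _ (h.mapsTo_ball hh hr.le hp), hhh]
    · simp only [T, hxb, if_false]
  have hsub : Metric.closedBall (0 : EucSpace n) r' ⊆ Metric.ball 0 r :=
    Metric.closedBall_subset_ball hr
  have hclosed : IsClosed (g '' Metric.closedBall 0 r') :=
    ((isCompact_closedBall _ _).image_of_continuousOn fun p hp =>
      (hg p (hsub hp)).continuousAt.continuousWithinAt).isClosed
  have hnear1 : ∀ (h : EucDiffeo n), ∀ p ∈ Metric.ball (0 : EucSpace n) r,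
      (fun q => T h (g q)) =ᶠ[𝓝 p] fun q => g (h q) := fun h p hp => by
    filter_upwards [Metric.isOpen_ball.mem_nhds hp] with q hq using hT1 h q hq
  have hnear2 : ∀ (h : EucDiffeo n), (∀ x, r' ≤ ‖x‖ → h x = x) →
      ∀ x ∉ g '' Metric.closedBall 0 r', T h =ᶠ[𝓝 x] fun y => y := fun h hh x hx => by
    filter_upwards [hclosed.isOpen_compl.mem_nhds hx] with y hy using hT2 h hh y hy
  have hLD : ∀ (h : EucDiffeo n), (∀ x, r' ≤ ‖x‖ → h x = x) → ∀ x, LocDiffAt n (T h) x := by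
    intro h hh x
    by_cases hx : x ∈ g '' Metric.closedBall 0 r'
    · obtain ⟨p, hp, rfl⟩ := hx
      refine LocDiffAt.of_comp_left (f := g) ?_ (hg p (hsub hp))
      refine LocDiffAt.congr ?_ (hnear1 h p (hsub hp))
      exact LocDiffAt.comp' (hg _ (h.mapsTo_ball hh hr.le (hsub hp))) (h.isLocalDiffeomorph p)
    · exact (locDiffAt_id x).congr (hnear2 h hh x hx)
  let Ψ : SelfDiffeo n X :=
    { toFun := T h
      invFun := T h.symm
      left_inv := hinv h h.symm hh h.symm_apply_apply
      right_inv := hinv h.symm h (h.symm_eq_self hh) h.apply_symm_apply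
      contMDiff_toFun := fun x => (hLD h hh x).contMDiffAt
      contMDiff_invFun := fun x => (hLD h.symm (h.symm_eq_self hh) x).contMDiffAt }
  have hΨ : ∀ x, Ψ x = T h x := fun _ => rfl
  refine ⟨Ψ, ?_, hT1 h, hT2 h hh⟩
  intro o x
  by_cases hx : x ∈ g '' Metric.closedBall 0 r'
  · obtain ⟨p, hp, rfl⟩ := hx
    have hp' := hsub hp
    have hhp := h.mapsTo_ball hh hr.le hp'
    have h1 : mdetSign n (fun q => T h (g q)) p = mdetSign n (T h) (g p) * mdetSign n g p :=
      mdetSign_comp (hLD h hh (g p)) (hg p hp')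
    have h2 : mdetSign n (fun q => g (h q)) p = mdetSign n g (h p) * mdetSign n h p :=
      mdetSign_comp (hg _ hhp) (h.isLocalDiffeomorph p)
    rw [mdetSign_congr (hnear1 h p hp'), h2, EucDiffeo.mdetSign_eq_one hn h hh, mul_one] at h1
    -- The sign of `g` relative to `o` is constant on the connected ball, and `h` has sign 1, so the
    -- conjugate preserves `o`.
    have h3 : mdetSign n g p * o.sign ρ (g p) = mdetSign n g (h p) * o.sign ρ (g (h p)) :=
      eq_of_isPreconnected_of_eventually_eq (convex_ball (0 : EucSpace n) r).isPreconnected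
        (f := fun q => mdetSign n g q * o.sign ρ (g q))
        (fun q hq => o.eventually_sign_eq ρ (hg q hq)) hp' hhp
    have h4 := mdetSign_ne_zero (hg p hp')
    have h5 := mdetSign_ne_zero (hg _ hhp)
    change mdetSign n (T h) (g p) * _ = o.sign ρ (T h (g p))
    rw [hT1 h p hp']
    revert h1 h3 h4 h5
    generalize mdetSign n (T h) (g p) = a
    generalize mdetSign n g p = b
    generalize mdetSign n g (h p) = c
    generalize o.sign ρ (g (h p)) = d
    generalize o.sign ρ (g p) = e
    revert a b c d e; decide
  · change mdetSign n (T h) x * _ = o.sign ρ (T h x)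
    rw [mdetSign_congr (hnear2 h hh x hx), mdetSign_id, one_mul, hT2 h hh x hx]

/-- Diffeomorphisms of `ℝⁿ` of sufficiently small support give moves of germs. -/
theorem exists_radius_germMove (hn : 2 ≤ n) (ρ : Orientation ℝ (EucSpace n) (Fin n))
    {g : EucSpace n → X} (hg : LocDiffAt n g 0) {F : Set X}
    (hF : F.Finite) (hgF : g 0 ∉ F) : ∃ r > 0, ∀ h : EucDiffeo n, (∀ x, r ≤ ‖x‖ → h x = x) →
      GermMove ρ F g (fun p => g (h p)) := by
  obtain ⟨r, hr, h1, h2, h3⟩ := hg.exists_ball hF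
  refine ⟨r / 2, half_pos hr, fun h hh => ?_⟩
  obtain ⟨Ψ, k1, k2, k3⟩ := exists_transport (ρ := ρ) hn (half_lt_self hr) h1 h2 h hh
  have hsub : Metric.closedBall (0 : EucSpace n) (r / 2) ⊆ Metric.ball 0 r :=
    Metric.closedBall_subset_ball (half_lt_self hr)
  refine ⟨Ψ, k1, fun x hx => ?_, ?_⟩
  · have hclosed : IsClosed (g '' Metric.closedBall 0 (r / 2)) :=
      ((isCompact_closedBall _ _).image_of_continuousOn fun p hp =>
        (h2 p (hsub hp)).continuousAt.continuousWithinAt).isClosed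
    have hx' : x ∉ g '' Metric.closedBall 0 (r / 2) := by
      rintro ⟨p, hp, rfl⟩
      exact hgF (h3 p (hsub hp) hx ▸ hx)
    filter_upwards [hclosed.isOpen_compl.mem_nhds hx'] with y hy using k3 y hy
  · filter_upwards [Metric.ball_mem_nhds (0 : EucSpace n) hr] with p hp using k2 p hp

/-- Germs at the same point that induce the same orientation differ by a move. -/
theorem germMove_of_mdetSign_eq (hn : 2 ≤ n) {g g' : EucSpace n → X} (hg : LocDiffAt n g 0)
    (hg' : LocDiffAt n g' 0) (h0 : g 0 = g' 0) {F : Set X} (hF : F.Finite) (hgF : g 0 ∉ F)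
    (hs : mdetSign n g 0 = mdetSign n g' 0) : GermMove ρ F g g' := by
  obtain ⟨i, hi, hi0, -, hir⟩ := hg.exists_inverse
  have hi' : LocDiffAt n i (g' 0) := h0 ▸ hi
  -- Near 0, `g'` is `g` precomposed with this transition germ. It fixes 0 and has sign 1, so it
  -- extends to a diffeomorphism of small support that `g` transports to X.
  have hk : LocDiffAt n (fun p => i (g' p)) 0 := LocDiffAt.comp' hi' hg'
  have hk0 : i (g' 0) = 0 := by rw [← h0, hi0]
  have hgk : ∀ᶠ p in 𝓝 0, g' p = g (i (g' p)) := by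
    rw [h0] at hir
    filter_upwards [hg'.continuousAt.eventually hir] with p hp using hp.symm
  have hks : mdetSign n (fun p => i (g' p)) 0 = 1 := by
    have h1 := mdetSign_comp (g := g) (f := fun p => i (g' p)) (x := 0) (by rwa [hk0]) hk
    rw [← mdetSign_congr hgk, hk0, ← hs] at h1
    have h2 := mdetSign_ne_zero hg
    revert h1 h2
    generalize mdetSign n g 0 = a
    generalize mdetSign n (fun p => i (g' p)) 0 = b
    revert a b; decide
  obtain ⟨r, hr, H⟩ := exists_radius_germMove hn ρ hg hF hgF
  obtain ⟨h, h1, h2⟩ := exists_eucDiffeo_germ hk hk0 hks hr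
  refine (H h h1).trans (.of_eventuallyEq ?_)
  filter_upwards [h2, hgk] with p hp hp'
  rw [hp, ← hp']

theorem eventually_germMove_translate (hn : 2 ≤ n) (ρ : Orientation ℝ (EucSpace n) (Fin n))
    {g : EucSpace n → X}
    (hg : LocDiffAt n g 0) {F : Set X} (hF : F.Finite) (hgF : g 0 ∉ F) :
    ∀ᶠ v in 𝓝 0, GermMove ρ F g (fun p => g (p + v)) := by
  obtain ⟨r, hr, H⟩ := exists_radius_germMove hn ρ hg hF hgF
  obtain ⟨δ, hδ, hv⟩ := exists_eucDiffeo_translation (n := n) hr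
  filter_upwards [Metric.ball_mem_nhds (0 : EucSpace n) hδ] with v hvδ
  obtain ⟨h, h1, h2⟩ := hv v (mem_ball_zero_iff.1 hvδ)
  refine (H h h1).trans (.of_eventuallyEq ?_)
  filter_upwards [h2] with p hp
  rw [hp]

end GermMoves

/-! ### Connectedness of complements and of shells -/

section Connectedness

/-- The complement of a closed set `C` in a connected space is connected if every point of `C` has
a neighbourhood that `C` does not separate. -/
theorem isPreconnected_compl_of_local {X : Type*} [TopologicalSpace X] [PreconnectedSpace X]
    {C : Set X} (hC : IsClosed C) (U : X → Set X) (hU : ∀ x ∈ C, IsOpen (U x) ∧ x ∈ U x ∧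
      IsPreconnected (U x \ C) ∧ (U x \ C).Nonempty ∧ ∀ y ∈ C, y ∈ U x → U y = U x) :
    IsPreconnected Cᶜ := by
  classical
  refine isPreconnected_of_forall_constant fun f hf x hx y hy => ?_
  have hloc : ∀ z ∉ C, ∀ᶠ w in 𝓝 z, f w = f z := by
    intro z hz
    have h1 := (hf.continuousAt (hC.isOpen_compl.mem_nhds hz))
    exact h1.eventually (IsOpen.mem_nhds (isOpen_discrete {f z}) rfl)
  choose! hUo hxU hpre hne hUeq using hU
  choose! w hw using hne
  -- A locally constant function on the complement extends over `C`, because it is constant on each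
  -- connected set `U z \ C`. Connectedness of the whole space then applies.
  let f' : X → Bool := fun z => if z ∈ C then f (w z) else f z
  have hconst : ∀ z ∈ C, ∀ a ∈ U z \ C, f a = f (w z) := fun z hz a ha =>
    eq_of_isPreconnected_of_eventually_eq (hpre z hz) (fun b hb => hloc b hb.2) ha (hw z hz)
  have hf' : ∀ z, ∀ᶠ a in 𝓝 z, f' a = f' z := by
    intro z
    by_cases hz : z ∈ C
    · filter_upwards [(hUo z hz).mem_nhds (hxU z hz)] with a ha
      by_cases haC : a ∈ C
      · simp only [f', haC, hz, if_true]
        have h1 := hw a haC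
        rw [hUeq z hz a haC ha] at h1
        exact hconst z hz _ h1
      · simp only [f', haC, hz, if_true, if_false]
        exact hconst z hz a ⟨ha, haC⟩
    · filter_upwards [hloc z hz, hC.isOpen_compl.mem_nhds hz] with a ha haC
      have haC' : a ∉ C := haC
      simp only [f', haC', hz, if_false, ha]
  have := eq_of_isPreconnected_of_eventually_eq isPreconnected_univ (fun z _ => hf' z)
    (mem_univ x) (mem_univ y)
  have hx' : x ∉ C := hx
  have hy' : y ∉ C := hy
  simpa only [f', hx', hy', if_false] using this

variable {n : ℕ}

/-- Rotationally symmetric sets in `ℝⁿ ∖ 0`. -/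
theorem isPreconnected_setOf_norm_mem (hn : 2 ≤ n) {J : Set ℝ} (hJ : IsPreconnected J)
    (hpos : ∀ t ∈ J, 0 < t) : IsPreconnected {p : EucSpace n | ‖p‖ ∈ J} := by
  have hrank : 1 < Module.rank ℝ (EucSpace n) := by
    rw [← Module.finrank_eq_rank, finrank_euclideanSpace_fin]
    exact_mod_cast hn
  -- Polar coordinates; the sphere is connected because n ≥ 2.
  have h1 := (hJ.prod (isPreconnected_sphere hrank (0 : EucSpace n) 1)).image
    (fun q : ℝ × EucSpace n => q.1 • q.2) (by fun_prop)
  convert h1 using 1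
  ext p
  constructor
  · intro hp
    have h0 := hpos _ hp
    refine ⟨(‖p‖, ‖p‖⁻¹ • p), ⟨hp, ?_⟩, ?_⟩
    · rw [mem_sphere_zero_iff_norm, norm_smul, norm_inv, norm_norm, inv_mul_cancel₀ h0.ne']
    · simp [smul_smul, mul_inv_cancel₀ h0.ne']
  · rintro ⟨⟨t, u⟩, ⟨ht, hu⟩, rfl⟩
    have h0 := hpos _ ht
    rw [mem_sphere_zero_iff_norm] at hu
    simpa [norm_smul, hu, abs_of_pos h0] using ht

theorem isPreconnected_ball_diff_zero (hn : 2 ≤ n) (r : ℝ) :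
    IsPreconnected (Metric.ball (0 : EucSpace n) r \ {0}) := by
  convert isPreconnected_setOf_norm_mem hn (isPreconnected_Ioo (a := 0) (b := r))
    (fun t ht => ht.1) using 1
  ext p
  simp [and_comm]

theorem exists_mem_ball_diff_zero (hn : 2 ≤ n) {r : ℝ} (hr : 0 < r) :
    (Metric.ball (0 : EucSpace n) r \ {0}).Nonempty := by
  have : Nonempty (Fin n) := ⟨⟨0, by omega⟩⟩
  obtain ⟨p, hp⟩ := exists_norm_eq (EucSpace n) (half_pos hr).le
  refine ⟨p, ?_, ?_⟩
  · rw [mem_ball_zero_iff, hp]; linarith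
  · rw [mem_singleton_iff, ← norm_eq_zero, hp]
    linarith

end Connectedness

/-! ### Mirror images and translates of germs -/

section Flip

variable {n : ℕ}

/-- The reflection of `ℝⁿ` in a coordinate hyperplane. -/
noncomputable def mirror (i : Fin n) : EucSpace n →L[ℝ] EucSpace n :=
  Matrix.toEuclideanCLM (𝕜 := ℝ) (n := Fin n) (Matrix.HasSmallExtension.dilation i (-1))

theorem mirror_mirror (i : Fin n) (p : EucSpace n) : mirror i (mirror i p) = p := by
  have : mirror i * mirror i = 1 := by
    rw [mirror, ← map_mul, Matrix.HasSmallExtension.dilation_neg_one_sq, map_one]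
  exact congrArg (fun A : EucSpace n →L[ℝ] EucSpace n => A p) this

theorem mirror_zero (i : Fin n) : mirror i 0 = 0 := map_zero _

theorem locDiffAt_mirror (i : Fin n) (p : EucSpace n) : LocDiffAt n (mirror i) p :=
  (ContinuousLinearEquiv.equivOfInverse (mirror i) (mirror i) (mirror_mirror i)
    (mirror_mirror i)).toDiffeomorph.isLocalDiffeomorph p

theorem mdetSign_mirror (i : Fin n) (p : EucSpace n) : mdetSign n (mirror i) p = -1 := by
  rw [mdetSign_eq_fderiv, ContinuousLinearMap.fderiv, mirror, det_toEuclideanCLM,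
    Matrix.HasSmallExtension.det_dilation]
  exact sign_eq_neg_one_iff.2 (by norm_num)

theorem locDiffAt_add_right (v p : EucSpace n) : LocDiffAt n (fun q : EucSpace n => q + v) p :=
  let D : EucDiffeo n :=
    { toEquiv := Equiv.addRight v
      contMDiff_toFun := (contDiff_id.add contDiff_const).contMDiff
      contMDiff_invFun := (contDiff_id.add contDiff_const).contMDiff }
  D.isLocalDiffeomorph p

theorem mdetSign_add_right (v p : EucSpace n) :
    mdetSign n (fun q : EucSpace n => q + v) p = 1 := by
  rw [mdetSign_eq_fderiv, fderiv_add_const, fderiv_fun_id]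
  exact sign_eq_one_iff.2 (by simp)

variable {X : Type*} [TopologicalSpace X] [ChartedSpace (EucSpace n) X]

theorem LocDiffAt.translate {g : EucSpace n → X} {v : EucSpace n} (hg : LocDiffAt n g v) :
    LocDiffAt n (fun p => g (p + v)) 0 :=
  LocDiffAt.comp' (f := fun p => p + v) (by rwa [zero_add]) (locDiffAt_add_right v 0)

theorem mdetSign_translate {g : EucSpace n → X} {v : EucSpace n} (hg : LocDiffAt n g v) :
    mdetSign n (fun p => g (p + v)) 0 = mdetSign n g v := by
  have h := mdetSign_comp (g := g) (f := fun p => p + v) (x := 0) (by rwa [zero_add])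
    (locDiffAt_add_right v 0)
  rwa [mdetSign_add_right, mul_one, zero_add] at h

theorem LocDiffAt.comp_mirror {g : EucSpace n → X} (hg : LocDiffAt n g 0) (i : Fin n) :
    LocDiffAt n (fun p => g (mirror i p)) 0 :=
  LocDiffAt.comp' (by rwa [mirror_zero]) (locDiffAt_mirror i 0)

theorem mdetSign_comp_mirror {g : EucSpace n → X} (hg : LocDiffAt n g 0) (i : Fin n) :
    mdetSign n (fun p => g (mirror i p)) 0 = -mdetSign n g 0 := by
  rw [mdetSign_comp (by rwa [mirror_zero]) (locDiffAt_mirror i 0), mdetSign_mirror, mirror_zero]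
  generalize mdetSign n g 0 = a
  revert a; decide

theorem exists_locDiffAt_zero [IsManifold (𝓡 n) ∞ X] (x : X) :
    ∃ g : EucSpace n → X, LocDiffAt n g 0 ∧ g 0 = x := by
  let φ := chartAt (EucSpace n) x
  have h1 : LocDiffAt n φ.symm (φ x) := locDiffAt_symm_of_mem_maximalAtlas
    (IsManifold.chart_mem_maximalAtlas x) (mem_chart_target _ x)
  refine ⟨fun p => φ.symm (p + φ x), h1.translate, ?_⟩
  simp only [zero_add]
  exact φ.left_inv (mem_chart_source _ x)

theorem eventually_eventually_add {Q : EucSpace n → Prop} (h : ∀ᶠ p in 𝓝 0, Q p) :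
    ∀ᶠ v in 𝓝 (0 : EucSpace n), ∀ᶠ p in 𝓝 (0 : EucSpace n), Q (p + v) := by
  filter_upwards [eventually_eventually_nhds.2 h] with v hv
  have : Filter.Tendsto (fun p : EucSpace n => p + v) (𝓝 0) (𝓝 v) := by
    have h1 : Continuous fun p : EucSpace n => p + v := by fun_prop
    simpa using h1.tendsto 0
  exact this.eventually hv

end Flip

/-! ### Classification of germs up to moves -/

section Classification

variable {n : ℕ} {X : Type*} [TopologicalSpace X] [ChartedSpace (EucSpace n) X]

/-- Punctured balls are connected for n ≥ 2, so a finite set does not separate even locally. -/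
theorem isPreconnected_compl_finite [T2Space X] [IsManifold (𝓡 n) ∞ X] [PreconnectedSpace X]
    (hn : 2 ≤ n) {F : Set X} (hF : F.Finite) : IsPreconnected Fᶜ := by
  have key : ∀ x : X, ∃ U : Set X, IsOpen U ∧ x ∈ U ∧ IsPreconnected (U \ {x}) ∧
      (U \ {x}).Nonempty ∧ ∀ y ∈ F, y ∈ U → y = x := by
    intro x
    obtain ⟨g, hg, rfl⟩ := exists_locDiffAt_zero (n := n) x
    obtain ⟨r, hr, h1, h2, h3⟩ := hg.exists_ball hF
    have h0 := Metric.mem_ball_self (x := (0 : EucSpace n)) hr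
    have e : g '' Metric.ball 0 r \ {g 0} = g '' (Metric.ball 0 r \ {0}) := by
      rw [h1.image_sdiff_subset (singleton_subset_iff.2 h0), image_singleton]
    refine ⟨g '' Metric.ball 0 r, ?_, ⟨0, h0, rfl⟩, ?_, ?_, ?_⟩
    · rw [isOpen_iff_mem_nhds]
      rintro _ ⟨p, hp, rfl⟩
      rw [← (h2 p hp).map_nhds]
      exact Filter.image_mem_map (Metric.isOpen_ball.mem_nhds hp)
    · rw [e]
      exact (isPreconnected_ball_diff_zero hn r).image g
        fun p hp => (h2 p hp.1).continuousAt.continuousWithinAt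
    · rw [e]
      exact (exists_mem_ball_diff_zero hn hr).image g
    · rintro _ hyF ⟨p, hp, rfl⟩
      rw [h3 p hp hyF]
  choose U h1 h2 h3 h4 h5 using key
  have hUF : ∀ x ∈ F, U x \ F = U x \ {x} := fun x hx => by
    ext y
    exact and_congr_right fun hy => not_congr ⟨fun hyF => h5 x y hyF hy, fun h => h.symm ▸ hx⟩
  refine isPreconnected_compl_of_local hF.isClosed U fun x hx =>
    ⟨h1 x, h2 x, ?_, ?_, fun y hy hyU => by rw [h5 x y hy hyU]⟩
  · rw [hUF x hx]; exact h3 x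
  · rw [hUF x hx]; exact h4 x

variable {ρ : Orientation ℝ (EucSpace n) (Fin n)}

namespace GermMove

variable {F : Set X} {f g g' : EucSpace n → X}

theorem comp_mirror (h : GermMove ρ F f g) (i : Fin n) :
    GermMove ρ F (fun p => f (mirror i p)) (fun p => g (mirror i p)) :=
  h.comp_right (mirror i).continuous.continuousAt (mirror_zero i)

theorem comp_mirror_iff {i : Fin n} :
    GermMove ρ F (fun p => f (mirror i p)) g ↔ GermMove ρ F f (fun p => g (mirror i p)) := by
  constructor
  · intro h; simpa only [mirror_mirror] using h.comp_mirror i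
  · intro h; simpa only [mirror_mirror] using h.comp_mirror i

/-- The germ `g` has the orientation that is transported from `f` in the complement of `F`. -/
def IsGood (ρ : Orientation ℝ (EucSpace n) (Fin n)) (F : Set X) (f g : EucSpace n → X) : Prop :=
  LocDiffAt n g 0 ∧ ∀ᶠ p in 𝓝 0, g p ∉ F → GermMove ρ F f (fun q => g (q + p))

theorem IsGood.eventually_translate (hg : IsGood ρ F f g) :
    ∀ᶠ v in 𝓝 0, IsGood ρ F f (fun p => g (p + v)) := by
  filter_upwards [hg.1.eventually, eventually_eventually_add hg.2] with v h1 h2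
  refine ⟨h1.translate, ?_⟩
  filter_upwards [h2] with p hp hpF
  have := hp hpF
  simpa only [add_assoc] using this

variable [T2Space X] [IsManifold (𝓡 n) ∞ X]

theorem or_comp_mirror (hn : 2 ≤ n) (hF : F.Finite) (hg : LocDiffAt n g 0) (hg' : LocDiffAt n g' 0)
    (h0 : g 0 = g' 0) (hgF : g 0 ∉ F) (i : Fin n) :
    GermMove ρ F g g' ∨ GermMove ρ F (fun p => g (mirror i p)) g' := by
  rcases SignType.eq_or_eq_neg_of_ne_zero (mdetSign_ne_zero hg') (mdetSign_ne_zero hg) with h | h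
  · exact Or.inl (germMove_of_mdetSign_eq hn hg hg' h0 hF hgF h.symm)
  · refine Or.inr (germMove_of_mdetSign_eq hn (hg.comp_mirror i) hg' (by rwa [mirror_zero]) hF
      (by rwa [mirror_zero]) ?_)
    rw [mdetSign_comp_mirror hg, h]

/-- In the complement of a finite set, a germ can be moved to any other germ or to its mirror
image. -/
theorem exists_or_comp_mirror [PreconnectedSpace X] (hn : 2 ≤ n) (hF : F.Finite)
    (hf : LocDiffAt n f 0) (hfF : f 0 ∉ F) (hg : LocDiffAt n g 0) (hgF : g 0 ∉ F) (i : Fin n) :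
    GermMove ρ F f g ∨ GermMove ρ F (fun p => f (mirror i p)) g := by
  let Q : (EucSpace n → X) → Prop := fun g =>
    GermMove ρ F f g ∨ GermMove ρ F (fun p => f (mirror i p)) g
  have hQ : ∀ g g', GermMove ρ F g g' → Q g → Q g' := fun g g' h hg =>
    hg.imp (fun k => k.trans h) (fun k => k.trans h)
  have hQmirror : ∀ g, Q g → Q (fun p => g (mirror i p)) := fun g hg => by
    rcases hg with h | h
    · exact Or.inr (h.comp_mirror i)
    · exact Or.inl (comp_mirror_iff.1 h)
  have hQpt : ∀ g g' : EucSpace n → X, LocDiffAt n g 0 → LocDiffAt n g' 0 → g 0 = g' 0 →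
      g 0 ∉ F → Q g → Q g' := by
    intro g g' h1 h2 h3 h4 h5
    rcases or_comp_mirror (ρ := ρ) hn hF h1 h2 h3 h4 i with h | h
    · exact hQ _ _ h h5
    · exact hQ _ _ h (hQmirror g h5)
  -- Once every germ is allowed up to mirror image, reachability depends only on its base point.
  -- Small translations show that it is locally constant off `F`, whose complement is connected.
  let P : X → Prop := fun x => ∀ g : EucSpace n → X, LocDiffAt n g 0 → g 0 = x → Q g
  have hP : ∀ g : EucSpace n → X, LocDiffAt n g 0 → g 0 ∉ F → (P (g 0) ↔ Q g) :=
    fun g h1 h2 => ⟨fun h => h g h1 rfl, fun h g' h3 h4 => hQpt g g' h1 h3 h4.symm h2 h⟩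
  have hPloc : ∀ x ∈ Fᶜ, ∀ᶠ y in 𝓝 x, P y = P x := by
    intro x hx
    obtain ⟨k, hk, rfl⟩ := exists_locDiffAt_zero (n := n) x
    rw [← hk.map_nhds, Filter.eventually_map]
    filter_upwards [eventually_germMove_translate hn ρ hk hF hx, hk.eventually,
      hk.continuousAt.eventually (hF.isClosed.isOpen_compl.mem_nhds hx)] with v h1 h2 h3
    have h4 := hP (fun p => k (p + v)) h2.translate (by simpa using h3)
    simp only [zero_add] at h4
    rw [eq_iff_iff, h4, hP k hk hx]
    exact ⟨hQ _ _ h1.symm, hQ _ _ h1⟩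
  have := eq_of_isPreconnected_of_eventually_eq (isPreconnected_compl_finite hn hF) hPloc hfF hgF
  exact (hP g hg hgF).1 (this ▸ (hP f hf hfF).2 (Or.inl (.refl f)))

/-- Germs that agree with respect to an orientation differ by a move. -/
theorem of_sign_eq [PreconnectedSpace X] (hn : 2 ≤ n) (hF : F.Finite)
    (hf : LocDiffAt n f 0) (hfF : f 0 ∉ F) (hg : LocDiffAt n g 0) (hgF : g 0 ∉ F)
    (o : ManifoldOrientation n X)
    (h : mdetSign n f 0 * o.sign ρ (f 0) = mdetSign n g 0 * o.sign ρ (g 0)) :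
    GermMove ρ F f g := by
  let i : Fin n := ⟨0, by omega⟩
  rcases exists_or_comp_mirror (ρ := ρ) hn hF hf hfF hg hgF i with h1 | ⟨Ψ, h1, -, h2⟩
  · exact h1
  · exfalso
    -- A move of the mirror image to `g` would preserve `o`, whereas the mirror has changed the
    -- sign.
    have h3 := mdetSign_comp (g := Ψ) (f := fun p => f (mirror i p)) (x := 0)
      (Ψ.isLocalDiffeomorph _) (hf.comp_mirror i)
    have h4 : Ψ (f (mirror i 0)) = g 0 := h2.self_of_nhds
    have h5 := h1 o (f 0)
    rw [mirror_zero] at h4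
    rw [mdetSign_congr h2, mdetSign_comp_mirror hf, mirror_zero] at h3
    rw [h4] at h5
    have h6 := mdetSign_ne_zero hf
    have h7 := mdetSign_ne_zero hg
    have h8 := o.sign_ne_zero ρ (f 0)
    have h9 := o.sign_ne_zero ρ (g 0)
    revert h h3 h5 h6 h7 h8 h9
    generalize mdetSign n Ψ (f 0) = a
    generalize mdetSign n f 0 = b
    generalize mdetSign n g 0 = c
    generalize o.sign ρ (f 0) = d
    generalize o.sign ρ (g 0) = e
    revert a b c d e; decide

/-- Since x may lie in `F`, a germ at x is judged by its translates to nearby points outside `F`.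
These points form a ball or punctured ball, which is connected, so reachability from `f` is uniform
there. If it fails, it holds for the mirrored germ. -/
theorem exists_isGood [PreconnectedSpace X] (hn : 2 ≤ n) (hF : F.Finite)
    (hf : LocDiffAt n f 0) (hfF : f 0 ∉ F) (x : X) :
    ∃ g : EucSpace n → X, IsGood ρ F f g ∧ g 0 = x := by
  let i : Fin n := ⟨0, by omega⟩
  have hmirror : Filter.Tendsto (mirror i) (𝓝 0) (𝓝 0) := by
    simpa [mirror_zero] using (mirror i).continuous.tendsto 0
  obtain ⟨g, hg, rfl⟩ := exists_locDiffAt_zero (n := n) x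
  obtain ⟨r, hr, h1, h2, h3⟩ := hg.exists_ball hF
  let S : Set (EucSpace n) := {p | p ∈ Metric.ball 0 r ∧ g p ∉ F}
  have hS : IsPreconnected S := by
    by_cases h0 : g 0 ∈ F
    · convert isPreconnected_ball_diff_zero hn r using 1
      ext p
      exact and_congr_right fun hp => not_congr ⟨h3 p hp, fun h => by rwa [h]⟩
    · convert (convex_ball (0 : EucSpace n) r).isPreconnected using 1
      ext p
      exact ⟨fun h => h.1, fun h => ⟨h, fun hc => h0 (h3 p h hc ▸ hc)⟩⟩
  have hgermS : ∀ p ∈ S, LocDiffAt n (fun q => g (q + p)) 0 ∧ g (0 + p) ∉ F := fun p hp =>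
    ⟨(h2 p hp.1).translate, by rw [zero_add]; exact hp.2⟩
  have hconst : ∀ p ∈ S, ∀ᶠ v in 𝓝 p, GermMove ρ F f (fun q => g (q + v)) =
      GermMove ρ F f (fun q => g (q + p)) := by
    intro p hp
    have h4 := eventually_germMove_translate hn ρ (hgermS p hp).1 hF (hgermS p hp).2
    have h5 : Filter.Tendsto (fun v => v - p) (𝓝 p) (𝓝 0) := by
      have : Continuous fun v : EucSpace n => v - p := by fun_prop
      simpa using this.tendsto p
    filter_upwards [h5.eventually h4] with v hv
    have e : (fun q => g (q + (v - p) + p)) = fun q => g (q + v) := by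
      funext q; congr 1; abel
    rw [e] at hv
    exact propext ⟨fun h => h.trans hv.symm, fun h => h.trans hv⟩
  have hball := Metric.ball_mem_nhds (0 : EucSpace n) hr
  by_cases hall : ∀ p ∈ S, GermMove ρ F f (fun q => g (q + p))
  · refine ⟨g, ⟨hg, ?_⟩, rfl⟩
    filter_upwards [hball] with p hp hpF using hall p ⟨hp, hpF⟩
  · push Not at hall
    obtain ⟨p₀, hp₀, hnot⟩ := hall
    refine ⟨fun p => g (mirror i p), ⟨hg.comp_mirror i, ?_⟩, congrArg g (mirror_zero i)⟩
    filter_upwards [hmirror.eventually hball] with p hp hpF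
    have hpS : mirror i p ∈ S := ⟨hp, hpF⟩
    have h6 : ¬ GermMove ρ F f (fun q => g (q + mirror i p)) := by
      rwa [eq_of_isPreconnected_of_eventually_eq hS hconst hpS hp₀]
    have h7 := (exists_or_comp_mirror (ρ := ρ) hn hF hf hfF (hgermS _ hpS).1 (hgermS _ hpS).2
      i).resolve_left h6
    simpa only [map_add] using comp_mirror_iff.1 h7

/-- If the signs differed, then at a common nearby point outside `F` two germs reachable from `f`
would be mirror images up to a move. Then `f` could be moved to its own mirror image, contrary to
`hff`. -/
theorem IsGood.mdetSign_eq [PreconnectedSpace X] (hn : 2 ≤ n) (hF : F.Finite)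
    (i : Fin n) (hff : ¬ GermMove ρ F f (fun p => f (mirror i p)))
    (hg : IsGood ρ F f g) (hg' : IsGood ρ F f g') (h0 : g 0 = g' 0) :
    mdetSign n g 0 = mdetSign n g' 0 := by
  by_contra hne
  obtain ⟨j, hj, hj0, -, hjr⟩ := hg.1.exists_inverse
  have hj' : LocDiffAt n j (g' 0) := h0 ▸ hj
  let k : EucSpace n → EucSpace n := fun p => j (g' p)
  have hk : LocDiffAt n k 0 := LocDiffAt.comp' hj' hg'.1
  have hk0 : k 0 = 0 := by simp only [k]; rw [← h0, hj0]
  have hkt : Filter.Tendsto k (𝓝 0) (𝓝 0) := by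
    have := hk.continuousAt.tendsto
    rwa [hk0] at this
  have hgk : ∀ᶠ p in 𝓝 0, g (k p) = g' p := by
    rw [h0] at hjr
    exact hg'.1.continuousAt.eventually hjr
  have hks : mdetSign n k 0 = -1 := by
    have h1 := mdetSign_comp (g := g) (f := k) (x := 0) (by rw [hk0]; exact hg.1) hk
    rw [mdetSign_congr hgk, hk0] at h1
    have h2 := mdetSign_ne_zero hg.1
    have h3 := mdetSign_ne_zero hk
    revert h1 h2 h3 hne
    generalize mdetSign n g 0 = a
    generalize mdetSign n k 0 = b
    generalize mdetSign n g' 0 = c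
    revert a b c; decide
  have hks' := eventually_mdetSign_eq hk
  obtain ⟨r, hr, -, -, hr3⟩ := hg'.1.exists_ball hF
  have hne' : (𝓝[≠] (0 : EucSpace n)).NeBot := by
    have : Nonempty (Fin n) := ⟨i⟩
    infer_instance
  -- A point p ≠ 0 is needed because `g' 0` itself may belong to `F`.
  obtain ⟨p, ⟨hp1, hp2, hp3, hp4, hp5, hp6, hp7, hp8⟩, hp0⟩ :=
    ((((Filter.Eventually.and (Metric.ball_mem_nhds (0 : EucSpace n) hr)) <|
      hg'.2.and <| (hkt.eventually hg.2).and <|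
      (eventually_eventually_nhds.2 hgk).and <| hks'.and <| hk.eventually.and <|
      hg'.1.eventually.and (hkt.eventually hg.1.eventually)).filter_mono
      nhdsWithin_le_nhds).and (self_mem_nhdsWithin (s := {(0 : EucSpace n)}ᶜ))).exists
  have hpF : g' p ∉ F := fun h => hp0 (hr3 p hp1 h)
  have hgkp : g (k p) = g' p := hp4.self_of_nhds
  have m1 := hp2 hpF
  have m2 := hp3 (by rwa [hgkp])
  have hsign : mdetSign n g' p = -mdetSign n g (k p) := by
    have h1 := mdetSign_comp (g := g) (f := k) (x := p) hp8 hp6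
    rw [mdetSign_congr hp4, hp5, hks] at h1
    rw [h1]
    generalize mdetSign n g (k p) = a
    revert a; decide
  have m3 : GermMove ρ F (fun q => g' (q + p)) (fun q => g (mirror i q + k p)) := by
    refine germMove_of_mdetSign_eq hn hp7.translate (hp8.translate.comp_mirror i) ?_ hF ?_ ?_
    · simp only [mirror_zero, zero_add, hgkp]
    · simpa only [zero_add] using hpF
    · rw [mdetSign_translate hp7, mdetSign_comp_mirror hp8.translate, mdetSign_translate hp8, hsign]
  exact hff ((m1.trans m3).trans (m2.comp_mirror i).symm)

/-- In a connected non-orientable manifold, all germs differ by moves. -/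
theorem of_not_isOrientable [PreconnectedSpace X] (hn : 2 ≤ n) (hF : F.Finite)
    (hX : ¬ IsOrientable n X) (hf : LocDiffAt n f 0) (hfF : f 0 ∉ F) (hg : LocDiffAt n g 0)
    (hgF : g 0 ∉ F) : GermMove ρ F f g := by
  let i : Fin n := ⟨0, by omega⟩
  by_cases hff : GermMove ρ F f (fun p => f (mirror i p))
  · rcases exists_or_comp_mirror (ρ := ρ) hn hF hf hfF hg hgF i with h | h
    · exact h
    · exact hff.trans h
  · exfalso
    choose k hk hk0 using exists_isGood (ρ := ρ) hn hF hf hfF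
    -- The signs of good germs define an orientation. Along `k x` the product of signs is constantly
    -- 1, since translates of a good germ are good and any two good germs at the same point have
    -- equal sign.
    refine hX ⟨ManifoldOrientation.ofSign ρ (fun x => mdetSign n (k x) 0) fun x =>
      ⟨k x, 0, 1, (hk x).1, hk0 x, one_ne_zero, ?_⟩⟩
    filter_upwards [(hk x).eventually_translate, (hk x).1.eventually] with v h1 h2
    rw [IsGood.mdetSign_eq hn hF i hff (hk (k x v)) h1 (by rw [hk0, zero_add]),
      mdetSign_translate h2]
    exact SignType.mul_self_of_ne_zero (mdetSign_ne_zero h2)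

end GermMove

end Classification

/-! ### The disc theorem for finite families -/

section Discs

variable {n : ℕ} {X : Type*} [TopologicalSpace X] [ChartedSpace (EucSpace n) X]
  [T2Space X] [IsManifold (𝓡 n) ∞ X] {ρ : Orientation ℝ (EucSpace n) (Fin n)}

/-- Finitely many germs at distinct points can be moved simultaneously. -/
theorem exists_diffeo_germs [PreconnectedSpace X] (hn : 2 ≤ n) {ι : Type*}
    {f g : ι → EucSpace n → X} (hf : ∀ i, LocDiffAt n (f i) 0) (hg : ∀ i, LocDiffAt n (g i) 0)
    (hf0 : Function.Injective fun i => f i 0) (hg0 : Function.Injective fun i => g i 0)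
    (hor : IsOrientable n X → ∃ o : ManifoldOrientation n X, ∀ i,
      mdetSign n (f i) 0 * o.sign ρ (f i 0) = mdetSign n (g i) 0 * o.sign ρ (g i 0))
    (s : Finset ι) : ∃ Ψ : SelfDiffeo n X, PreservesOrientations ρ Ψ ∧
      ∀ i ∈ s, ∀ᶠ p in 𝓝 0, Ψ (f i p) = g i p := by
  classical
  induction s using Finset.induction_on with
  | empty => exact ⟨Diffeomorph.refl _ _ _, .refl, by simp⟩
  | insert j s hj ih =>
    obtain ⟨Ψ, h1, h2⟩ := ih
    -- The centres already in place; the next move fixes neighbourhoods of them and so keeps the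
    -- germs already matched.
    let F : Set X := (fun i => g i 0) '' (s : Set ι)
    have hF : F.Finite := s.finite_toSet.image _
    have hΨf : LocDiffAt n (fun p => Ψ (f j p)) 0 :=
      LocDiffAt.comp' (Ψ.isLocalDiffeomorph _) (hf j)
    have hΨfF : Ψ (f j 0) ∉ F := by
      rintro ⟨i, hi, hij⟩
      have h3 : Ψ (f i 0) = g i 0 := (h2 i hi).self_of_nhds
      have h4 : f i 0 = f j 0 := Ψ.injective (h3.trans hij)
      exact hj (hf0 h4 ▸ hi)
    have hgF : g j 0 ∉ F := by
      rintro ⟨i, hi, hij⟩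
      exact hj (hg0 hij ▸ hi)
    have hmove : GermMove ρ F (fun p => Ψ (f j p)) (g j) := by
      by_cases hX : IsOrientable n X
      · obtain ⟨o, ho⟩ := hor hX
        refine GermMove.of_sign_eq hn hF hΨf hΨfF (hg j) hgF o ?_
        rw [mdetSign_comp (Ψ.isLocalDiffeomorph _) (hf j), ← ho j, ← h1 o (f j 0)]
        have := mdetSign_ne_zero (Ψ.isLocalDiffeomorph (f j 0))
        revert this
        generalize mdetSign n Ψ (f j 0) = a
        generalize mdetSign n (f j) 0 = b
        generalize o.sign ρ (f j 0) = c
        revert a b c; decide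
      · exact GermMove.of_not_isOrientable hn hF hX hΨf hΨfF (hg j) hgF
    obtain ⟨Θ, k1, k2, k3⟩ := hmove
    refine ⟨Ψ.trans Θ, h1.trans k1, fun i hi => ?_⟩
    rcases Finset.mem_insert.1 hi with rfl | hi
    · exact k3
    · filter_upwards [h2 i hi,
        (hg i).continuousAt.eventually (k2 (g i 0) ⟨i, hi, rfl⟩)] with p hp hk
      rw [Diffeomorph.coe_trans, Function.comp, hp, hk]

/-- Finitely many disjoint embedded discs can be shrunk simultaneously. -/
theorem exists_diffeo_shrink (hn : 2 ≤ n) {ι : Type*} {f : ι → EucSpace n → X}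
    (hf : ∀ i p, LocDiffAt n (f i) p)
    (hinj : ∀ i, Function.Injective (f i)) (hdisj : ∀ i j, i ≠ j → ∀ p q, f i p ≠ f j q)
    (h : EucDiffeo n) (hh : ∀ x, 2 ≤ ‖x‖ → h x = x) (s : Finset ι) :
    ∃ Ψ : SelfDiffeo n X, PreservesOrientations ρ Ψ ∧
      (∀ i ∈ s, ∀ p, ‖p‖ ≤ 1 → Ψ (f i p) = f i (h p)) ∧ ∀ i ∉ s, ∀ p, Ψ (f i p) = f i p := by
  classical
  induction s using Finset.induction_on with
  | empty => exact ⟨Diffeomorph.refl _ _ _, .refl, by simp, fun _ _ _ => rfl⟩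
  | insert j s hj ih =>
    obtain ⟨Ψ, h1, h2, h3⟩ := ih
    obtain ⟨Θ, k1, k2, k3⟩ := exists_transport (ρ := ρ) hn (g := f j) (r' := 2) (r := 3)
      (by norm_num) (hinj j).injOn (fun p _ => hf j p) h hh
    have k4 : ∀ i, i ≠ j → ∀ p, Θ (f i p) = f i p := fun i hij p => by
      refine k3 _ ?_
      rintro ⟨q, -, hq⟩
      exact hdisj j i hij.symm q p hq
    refine ⟨Ψ.trans Θ, h1.trans k1, fun i hi p hp => ?_, fun i hi p => ?_⟩
    · rw [Diffeomorph.coe_trans, Function.comp]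
      rcases Finset.mem_insert.1 hi with rfl | hi
      · rw [h3 i hj]
        exact k2 p (by rw [mem_ball_zero_iff]; linarith)
      · rw [h2 i hi p hp, k4 i (fun hij => hj (hij ▸ hi))]
    · rw [Finset.mem_insert, not_or] at hi
      rw [Diffeomorph.coe_trans, Function.comp, h3 i hi.2, k4 i hi.1]

/-- The disc theorem: two finite families of disjoint embedded discs in a connected manifold with
compatible orientations differ by a diffeomorphism. -/
theorem exists_diffeo_discs [PreconnectedSpace X] (hn : 2 ≤ n) {ι : Type*} [Finite ι]
    {f g : ι → EucSpace n → X}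
    (hf : ∀ i p, LocDiffAt n (f i) p) (hg : ∀ i p, LocDiffAt n (g i) p)
    (hfi : ∀ i, Function.Injective (f i)) (hgi : ∀ i, Function.Injective (g i))
    (hfd : ∀ i j, i ≠ j → ∀ p q, f i p ≠ f j q) (hgd : ∀ i j, i ≠ j → ∀ p q, g i p ≠ g j q)
    (hor : IsOrientable n X → ∃ o : ManifoldOrientation n X, ∀ i,
      mdetSign n (f i) 0 * o.sign ρ (f i 0) = mdetSign n (g i) 0 * o.sign ρ (g i 0)) :
    ∃ Ψ : SelfDiffeo n X, PreservesOrientations ρ Ψ ∧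
      ∀ i p, ‖p‖ ≤ 1 → Ψ (f i p) = g i p := by
  classical
  have := Fintype.ofFinite ι
  obtain ⟨Ψ, h1, h2⟩ := exists_diffeo_germs hn (fun i => hf i 0) (fun i => hg i 0)
    (fun i j hij => by_contra fun hne => hfd i j hne 0 0 hij)
    (fun i j hij => by_contra fun hne => hgd i j hne 0 0 hij) hor Finset.univ
  have h3 : ∀ᶠ p in 𝓝 0, ∀ i, Ψ (f i p) = g i p :=
    Filter.eventually_all.2 fun i => h2 i (Finset.mem_univ i)
  obtain ⟨η, hη, h4⟩ := Metric.eventually_nhds_iff_ball.1 h3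
  obtain ⟨t, ht0, htη, h, hh1, hh2⟩ := exists_eucDiffeo_shrink (n := n) hη
  obtain ⟨A, a1, a2, -⟩ := exists_diffeo_shrink (ρ := ρ) hn hf hfi hfd h hh2 Finset.univ
  obtain ⟨B, b1, b2, -⟩ := exists_diffeo_shrink (ρ := ρ) hn hg hgi hgd h hh2 Finset.univ
  -- Shrink the first discs into the region where `Ψ` matches the two families, apply `Ψ`, and undo
  -- the same shrinking on the second discs.
  refine ⟨(A.trans Ψ).trans B.symm, (a1.trans h1).trans b1.symm, fun i p hp => ?_⟩
  have hb := b2 i (Finset.mem_univ i) p hp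
  have hball : h p ∈ Metric.ball (0 : EucSpace n) η := by
    rw [hh1 p hp, mem_ball_zero_iff, norm_smul, Real.norm_of_nonneg ht0.le]
    nlinarith [norm_nonneg p]
  rw [Diffeomorph.coe_trans, Diffeomorph.coe_trans, Function.comp, Function.comp,
    a2 i (Finset.mem_univ i) p hp, h4 _ hball i, ← hb, B.symm_apply_apply]

end Discs

/-! ### The radial inversion used for gluing -/

section RadialFlip

variable {n : ℕ}

/-- The involution `t u ↦ (1 - t) u` of the punctured open unit ball. -/
noncomputable def radialFlip (p : EucSpace n) : EucSpace n := (‖p‖⁻¹ - 1) • p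

theorem radialFlip_smul {t : ℝ} (ht : 0 < t) {u : EucSpace n} (hu : ‖u‖ = 1) :
    radialFlip (t • u) = (1 - t) • u := by
  rw [radialFlip, norm_smul, hu, mul_one, Real.norm_of_nonneg ht.le, smul_smul]
  congr 1
  field_simp

theorem norm_radialFlip {p : EucSpace n} (h0 : 0 < ‖p‖) (h1 : ‖p‖ < 1) :
    ‖radialFlip p‖ = 1 - ‖p‖ := by
  have h2 : 1 < ‖p‖⁻¹ := (one_lt_inv₀ h0).2 h1
  rw [radialFlip, norm_smul, Real.norm_of_nonneg (by linarith)]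
  field_simp

theorem radialFlip_radialFlip {p : EucSpace n} (h0 : 0 < ‖p‖) (h1 : ‖p‖ < 1) :
    radialFlip (radialFlip p) = p := by
  have h2 : (1 - ‖p‖) ≠ 0 := by linarith
  rw [radialFlip, norm_radialFlip h0 h1, radialFlip, smul_smul]
  have : ((1 - ‖p‖)⁻¹ - 1) * (‖p‖⁻¹ - 1) = 1 := by
    field_simp
    ring
  rw [this, one_smul]

theorem contDiffAt_radialFlip {p : EucSpace n} (hp : p ≠ 0) : ContDiffAt ℝ ∞ radialFlip p :=
  (((contDiffAt_norm ℝ hp).inv (norm_ne_zero_iff.2 hp)).sub contDiffAt_const).smul contDiffAt_id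

theorem locDiffAt_radialFlip {p : EucSpace n} (h0 : 0 < ‖p‖) (h1 : ‖p‖ < 1) :
    LocDiffAt n (radialFlip : EucSpace n → EucSpace n) p := by
  let U : Set (EucSpace n) := {q | 0 < ‖q‖ ∧ ‖q‖ < 1}
  have hU : IsOpen U :=
    (isOpen_lt continuous_const continuous_norm).inter (isOpen_lt continuous_norm continuous_const)
  have hmaps : ∀ q ∈ U, radialFlip q ∈ U := fun q hq => by
    change 0 < ‖radialFlip q‖ ∧ ‖radialFlip q‖ < 1
    rw [norm_radialFlip hq.1 hq.2]
    exact ⟨by linarith [hq.2], by linarith [hq.1]⟩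
  have hsm : ContMDiffOn (𝓡 n) (𝓡 n) ∞ (radialFlip : EucSpace n → EucSpace n) U :=
    contMDiffOn_iff_contDiffOn.2 fun q hq =>
      (contDiffAt_radialFlip (norm_pos_iff.1 hq.1)).contDiffWithinAt
  exact ⟨⟨⟨radialFlip, radialFlip, U, U, hmaps, hmaps, fun q hq => radialFlip_radialFlip hq.1 hq.2,
    fun q hq => radialFlip_radialFlip hq.1 hq.2⟩, hU, hU, hsm, hsm⟩, ⟨h0, h1⟩, fun _ _ => rfl⟩

/-- The flip reverses the radial direction and scales the spherical ones by c = ‖p‖⁻¹ - 1 > 0. In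
formulas the derivative is c plus a rank-one map, of determinant cⁿ (1 - ‖p‖⁻¹ / c) < 0. -/
theorem mdetSign_radialFlip {p : EucSpace n} (h0 : 0 < ‖p‖) (h1 : ‖p‖ < 1) :
    mdetSign n (radialFlip : EucSpace n → EucSpace n) p = -1 := by
  have hp : p ≠ 0 := norm_pos_iff.1 h0
  have hdn : DifferentiableAt ℝ (fun q : EucSpace n => ‖q‖) p :=
    (contDiffAt_norm ℝ hp (n := 1)).differentiableAt (by simp)
  set c : ℝ := ‖p‖⁻¹ - 1 with hc
  have hc0 : 0 < c := by
    have : 1 < ‖p‖⁻¹ := (one_lt_inv₀ h0).2 h1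
    linarith
  let ψ : EucSpace n →L[ℝ] ℝ := -(‖p‖ ^ 2)⁻¹ • fderiv ℝ (fun q : EucSpace n => ‖q‖) p
  have hψ : HasFDerivAt (fun q : EucSpace n => ‖q‖⁻¹ - 1) ψ p :=
    ((hasDerivAt_inv h0.ne').comp_hasFDerivAt p hdn.hasFDerivAt).sub_const 1
  have hψp : ψ p = -‖p‖⁻¹ := by
    have h2 : fderiv ℝ (fun q : EucSpace n => ‖q‖) p p = ‖p‖ := hdn.fderiv_norm_self
    change -(‖p‖ ^ 2)⁻¹ * fderiv ℝ (fun q : EucSpace n => ‖q‖) p p = _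
    rw [h2]
    field_simp
  have hD : HasFDerivAt (radialFlip : EucSpace n → EucSpace n)
      (c • ContinuousLinearMap.id ℝ (EucSpace n) + ψ.smulRight p) p :=
    hψ.smul (hasFDerivAt_id p)
  rw [mdetSign_eq_fderiv, hD.fderiv]
  have hlin : (c • ContinuousLinearMap.id ℝ (EucSpace n) + ψ.smulRight p).toLinearMap =
      c • LinearMap.transvection (c⁻¹ • ψ.toLinearMap) p := by
    ext1 v
    change c • v + ψ v • p = c • (v + (c⁻¹ * ψ v) • p)
    rw [smul_add, smul_smul, mul_inv_cancel_left₀ hc0.ne']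
  rw [hlin, LinearMap.det_smul, LinearMap.transvection.det]
  refine sign_eq_neg_one_iff.2 (mul_neg_of_pos_of_neg (pow_pos hc0 _) ?_)
  change 1 + c⁻¹ * ψ p < 0
  rw [hψp]
  have : c⁻¹ * -‖p‖⁻¹ = -(‖p‖⁻¹ / c) := by ring
  rw [this]
  have : 1 < ‖p‖⁻¹ / c := by
    rw [one_lt_div hc0]
    linarith
  linarith

end RadialFlip

/-! ### Lifting local diffeomorphisms to open submanifolds -/

section LiftToOpens

variable {n : ℕ} {M : Type*} [TopologicalSpace M] [ChartedSpace (EucSpace n) M]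
  [IsManifold (𝓡 n) ∞ M]

theorem locDiffAt_subtype_val (U : Opens M) (y : U) :
    LocDiffAt n (Subtype.val : U → M) y := by
  have h : Manifold.IsSmoothEmbedding (𝓡 n) (𝓡 n) ∞ (Subtype.val : U → M) := .of_opens U
  exact locDiffAt_of_isImmersion h.isImmersion y

/-- Local diffeomorphisms into `M` lift to open submanifolds. -/
theorem LocDiffAt.exists_lift {N : Type*} [TopologicalSpace N] [ChartedSpace (EucSpace n) N]
    {U : Opens M} {f : N → M} {p : N} (hf : LocDiffAt n f p) {y : U} (hy : f p = y.1) :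
    ∃ a : N → U, LocDiffAt n a p ∧ a p = y ∧ ∀ᶠ q in 𝓝 p, (a q).1 = f q := by
  obtain ⟨i, hi, hi0, -, hir⟩ := (locDiffAt_subtype_val (n := n) U y).exists_inverse
  rw [← hy] at hi hir
  refine ⟨fun q => i (f q), LocDiffAt.comp' hi hf, ?_, hf.continuousAt.eventually hir⟩
  simp only [hy, hi0]

end LiftToOpens

/-! ### Half-edges and the explicit gluing relation -/

namespace LocFinGraph

variable {V E : Type*} (G : LocFinGraph V E)

/-- The half-edges at the vertex `v`. -/
abbrev Half (v : V) : Type _ := {h : E × Bool // G.vert h.1 h.2 = v}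

instance (v : V) : Finite (G.Half v) := (G.locally_finite v).to_subtype

/-- The half-edge `(e, b)`. -/
abbrev half (e : E) (b : Bool) : G.Half (G.vert e b) := ⟨(e, b), rfl⟩

end LocFinGraph

namespace GluingData

variable {n : ℕ} {V E : Type*} {G : LocFinGraph V E} {X : V → Type*}
  [∀ v, TopologicalSpace (X v)] [∀ v, ChartedSpace (EucSpace n) (X v)]
  {ρ : Orientation ℝ (EucSpace n) (Fin n)}
  {σ : ∀ v, IsOrientable n (X v) → ManifoldOrientation n (X v)}

section Embeddings

/-- The embedding into `X v` that belongs to a half-edge at `v`. -/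
def embAt (Γ : GluingData G X ρ σ) (v : V) (h : G.Half v) (p : EucSpace n) : X v :=
  h.2 ▸ Γ.emb h.1.1 h.1.2 p

variable (Γ : GluingData G X ρ σ)

theorem mk_embAt {v : V} (h : G.Half v) (p : EucSpace n) :
    (⟨v, Γ.embAt v h p⟩ : Σ v, X v) = Γ.point h.1.1 h.1.2 p := by
  obtain ⟨⟨e, b⟩, rfl⟩ := h
  rfl

/-- Passes between equations in the disjoint union and equations in a fixed `X v`, confining the
transport along equalities of vertices to `embAt`. -/
theorem point_eq_mk_iff {e : E} {b : Bool} {p : EucSpace n} {v : V} {x : X v} :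
    Γ.point e b p = ⟨v, x⟩ ↔ ∃ h : G.Half v, h.1 = (e, b) ∧ Γ.embAt v h p = x := by
  constructor
  · intro h
    have hv : G.vert e b = v := congrArg Sigma.fst h
    subst hv
    exact ⟨G.half e b, rfl, eq_of_heq (Sigma.mk.inj h).2⟩
  · rintro ⟨⟨_, hv⟩, rfl, rfl⟩
    exact (Γ.mk_embAt ⟨(e, b), hv⟩ p).symm

theorem point_ne {h h' : E × Bool} (hne : h ≠ h') (p q : EucSpace n) :
    Γ.point h.1 h.2 p ≠ Γ.point h'.1 h'.2 q := Γ.disjoint_range h h' hne p q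

theorem point_injective (e : E) (b : Bool) : Function.Injective (Γ.point e b) :=
  fun _ _ h => (Γ.smooth_emb e b).isEmbedding.injective (eq_of_heq (Sigma.mk.inj h).2)

theorem point_inj {e e' : E} {b b' : Bool} {p q : EucSpace n}
    (h : Γ.point e b p = Γ.point e' b' q) : e = e' ∧ b = b' ∧ p = q := by
  by_cases hne : (e, b) = (e', b')
  · obtain ⟨rfl, rfl⟩ := Prod.mk.inj hne
    exact ⟨rfl, rfl, Γ.point_injective e b h⟩
  · exact absurd h (Γ.point_ne hne p q)

theorem continuous_point (e : E) (b : Bool) : Continuous (Γ.point e b) :=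
  continuous_sigmaMk.comp (Γ.smooth_emb e b).isEmbedding.continuous

theorem embAt_injective {v : V} (h : G.Half v) : Function.Injective (Γ.embAt v h) := by
  obtain ⟨⟨e, b⟩, rfl⟩ := h
  exact (Γ.smooth_emb e b).isEmbedding.injective

theorem embAt_ne {v : V} {h h' : G.Half v} (hne : h ≠ h') (p q : EucSpace n) :
    Γ.embAt v h p ≠ Γ.embAt v h' q := fun heq => by
  have := congrArg (Sigma.mk v) heq
  rw [mk_embAt, mk_embAt] at this
  exact Γ.point_ne (fun hc => hne (Subtype.ext hc)) p q this

theorem locDiffAt_embAt [∀ v, IsManifold (𝓡 n) ∞ (X v)] {v : V} (h : G.Half v) (p : EucSpace n) :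
    LocDiffAt n (Γ.embAt v h) p := by
  obtain ⟨⟨e, b⟩, rfl⟩ := h
  exact locDiffAt_of_isImmersion (Γ.smooth_emb e b).isImmersion p

theorem isOpen_range_embAt [∀ v, IsManifold (𝓡 n) ∞ (X v)] {v : V} (h : G.Half v) :
    IsOpen (range (Γ.embAt v h)) :=
  isOpen_iff_mem_nhds.2 <| by
    rintro _ ⟨p, rfl⟩
    rw [← (Γ.locDiffAt_embAt h p).map_nhds]
    exact Filter.range_mem_map

/-- The sign by which the embeddings at first and second ends behave with respect to the chosen
orientations. -/
def endSign : Bool → SignType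
  | false => 1
  | true => -1

theorem sign_embAt {v : V} (h : G.Half v) (hv : IsOrientable n (X v)) (p : EucSpace n) :
    mdetSign n (Γ.embAt v h) p = endSign h.1.2 * (σ v hv).sign ρ (Γ.embAt v h p) := by
  obtain ⟨⟨e, b⟩, rfl⟩ := h
  cases b with
  | false =>
    have h1 := (carriesOrientation_iff_sign ρ _ _).1 (Γ.preserves e hv p)
    change _ * orientationSign ρ ρ = _ at h1
    rw [orientationSign_self, mul_one] at h1
    exact h1.trans (one_mul _).symm
  | true =>
    have h1 := (carriesOrientation_iff_sign ρ _ _).1 (Γ.reverses e hv p)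
    change _ * orientationSign ρ ρ = _ at h1
    rw [orientationSign_self, mul_one] at h1
    have h2 : orientationSign ρ (-((σ _ hv).orient (Γ.emb e true p))) =
      -orientationSign ρ ((σ _ hv).orient (Γ.emb e true p)) := orientationSign_neg ρ _
    refine (h1.trans h2).trans ?_
    change - (σ _ hv).sign ρ (Γ.emb e true p) = -1 * (σ _ hv).sign ρ (Γ.emb e true p)
    generalize (σ _ hv).sign ρ (Γ.emb e true p) = a
    revert a; decide

theorem mem_removed_iff {v : V} {x : X v} :
    x ∈ Γ.removed v ↔ ∃ (h : G.Half v) (p : EucSpace n), ‖p‖ ≤ 1 / 3 ∧ Γ.embAt v h p = x := by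
  constructor
  · rintro ⟨e, b, p, hp, h⟩
    obtain ⟨h, -, hx⟩ := Γ.point_eq_mk_iff.1 h
    exact ⟨h, p, mem_closedBall_zero_iff.1 hp, hx⟩
  · rintro ⟨h, p, hp, rfl⟩
    exact ⟨h.1.1, h.1.2, p, mem_closedBall_zero_iff.2 hp, (Γ.mk_embAt h p).symm⟩

variable [∀ v, T2Space (X v)]

theorem mem_piece_iff {v : V} {x : X v} :
    x ∈ Γ.piece v ↔ ∀ (h : G.Half v) (p : EucSpace n), Γ.embAt v h p = x → 1 / 3 < ‖p‖ := by
  change ¬ x ∈ Γ.removed v ↔ _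
  rw [mem_removed_iff]
  push Not
  exact forall₂_congr fun h p => ⟨fun H hx => not_le.1 fun hp => H hp hx,
    fun H hp hx => absurd (H hx) (not_lt.2 hp)⟩

theorem embAt_mem_piece {v : V} (h : G.Half v) {p : EucSpace n} (hp : 1 / 3 < ‖p‖) :
    Γ.embAt v h p ∈ Γ.piece v := by
  rw [mem_piece_iff]
  intro h' q hq
  by_cases hne : h' = h
  · subst hne
    rwa [Γ.embAt_injective _ hq]
  · exact absurd hq (Γ.embAt_ne hne q p)

theorem nonempty_piece [∀ v, ConnectedSpace (X v)] (hn : 2 ≤ n) (v : V) :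
    Nonempty (Γ.piece v) := by
  have : Nonempty (Fin n) := ⟨⟨0, by omega⟩⟩
  by_cases hh : Nonempty (G.Half v)
  · obtain ⟨h⟩ := hh
    obtain ⟨q, hq⟩ := exists_norm_eq (EucSpace n) zero_le_one
    exact ⟨⟨_, Γ.embAt_mem_piece h (p := q) (by rw [hq]; norm_num)⟩⟩
  · obtain ⟨x⟩ : Nonempty (X v) := inferInstance
    exact ⟨⟨x, Γ.mem_piece_iff.2 fun h => (hh ⟨h⟩).elim⟩⟩

/-- The point of the disjoint union of the `X v` that underlies a point of the disjoint union of
the pieces. -/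
def under (y : Σ v, Γ.piece v) : Σ v, X v := ⟨y.1, y.2.1⟩

theorem under_injective : Function.Injective Γ.under := by
  rintro ⟨v, y⟩ ⟨w, z⟩ h
  obtain rfl : v = w := congrArg Sigma.fst h
  have : y.1 = z.1 := eq_of_heq (Sigma.mk.inj h).2
  rw [Subtype.ext this]

theorem continuous_under : Continuous Γ.under :=
  continuous_sigma fun _ => continuous_sigmaMk.comp continuous_subtype_val

theorem lt_norm_of_under_eq {y : Σ v, Γ.piece v} {e : E} {b : Bool} {p : EucSpace n}
    (h : Γ.under y = Γ.point e b p) : 1 / 3 < ‖p‖ := by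
  obtain ⟨v, y⟩ := y
  obtain ⟨h, -, hx⟩ := Γ.point_eq_mk_iff.1 h.symm
  exact Γ.mem_piece_iff.1 y.2 h p hx

/-- The explicit form of the equivalence relation generated by the gluing. -/
def Glued (y z : Σ v, Γ.piece v) : Prop :=
  y = z ∨ ∃ (e : E) (b : Bool) (p : EucSpace n), 1 / 3 < ‖p‖ ∧ ‖p‖ < 2 / 3 ∧
    Γ.under y = Γ.point e b p ∧ Γ.under z = Γ.point e (!b) (radialFlip p)

variable {Γ}

theorem Glue.glued {y z : Σ v, Γ.piece v} (h : Γ.Glue y z) : Γ.Glued y z := by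
  obtain ⟨e, t, u, h1, h2, hu, hy, hz⟩ := h
  have h0 : 0 < t := by linarith
  have hn : ‖t • u‖ = t := by rw [norm_smul, hu, mul_one, Real.norm_of_nonneg h0.le]
  refine Or.inr ⟨e, false, t • u, by rwa [hn], by rwa [hn], hy, ?_⟩
  rw [radialFlip_smul h0 hu]
  exact hz

theorem Glued.symm {y z : Σ v, Γ.piece v} (h : Γ.Glued y z) : Γ.Glued z y := by
  rcases h with rfl | ⟨e, b, p, h1, h2, hy, hz⟩
  · exact Or.inl rfl
  · have h0 : 0 < ‖p‖ := by linarith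
    have hp1 : ‖p‖ < 1 := by linarith
    refine Or.inr ⟨e, !b, radialFlip p, ?_, ?_, hz, ?_⟩
    · rw [norm_radialFlip h0 hp1]; linarith
    · rw [norm_radialFlip h0 hp1]; linarith
    · rw [radialFlip_radialFlip h0 hp1, Bool.not_not]; exact hy

/-- Disjointness and injectivity of the embeddings determine the half-edge and the parameter of a
point. Two successive gluings are therefore inverse to each other and return to the start. -/
theorem Glued.trans {y z w : Σ v, Γ.piece v} (h : Γ.Glued y z) (h' : Γ.Glued z w) :
    Γ.Glued y w := by
  rcases h with rfl | ⟨e, b, p, h1, h2, hy, hz⟩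
  · exact h'
  · rcases h' with rfl | ⟨e', b', p', h1', h2', hz', hw⟩
    · exact Or.inr ⟨e, b, p, h1, h2, hy, hz⟩
    · obtain ⟨rfl, rfl, rfl⟩ := Γ.point_inj (hz.symm.trans hz')
      rw [Bool.not_not, radialFlip_radialFlip (by linarith) (by linarith)] at hw
      exact Or.inl (Γ.under_injective (hy.trans hw.symm))

theorem Glued.of_eqvGen {y z : Σ v, Γ.piece v} (h : Relation.EqvGen Γ.Glue y z) :
    Γ.Glued y z := by
  induction h with
  | rel _ _ h => exact h.glued
  | refl _ => exact Or.inl rfl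
  | symm _ _ _ ih => exact ih.symm
  | trans _ _ _ _ _ ih ih' => exact ih.trans ih'

theorem mk_eq_mk_iff {y z : Σ v, Γ.piece v} :
    (Quot.mk Γ.Glue y : Γ.Space) = Quot.mk Γ.Glue z ↔ Γ.Glued y z := by
  constructor
  · intro h
    exact Glued.of_eqvGen (Quot.eqvGen_exact h)
  · have key : ∀ (y z : Σ v, Γ.piece v) (e : E) (p : EucSpace n), 1 / 3 < ‖p‖ → ‖p‖ < 2 / 3 →
        Γ.under y = Γ.point e false p → Γ.under z = Γ.point e true (radialFlip p) →
        Γ.Glue y z := by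
      intro y z e p h1 h2 hy hz
      have h0 : ‖p‖ ≠ 0 := by linarith
      have hp : p = ‖p‖ • (‖p‖⁻¹ • p) := by rw [smul_smul, mul_inv_cancel₀ h0, one_smul]
      have hu : ‖‖p‖⁻¹ • p‖ = 1 := by rw [norm_smul, norm_inv, norm_norm, inv_mul_cancel₀ h0]
      refine ⟨e, ‖p‖, ‖p‖⁻¹ • p, h1, h2, hu, ?_, ?_⟩
      · rw [← hp]; exact hy
      · rw [← radialFlip_smul (by linarith) hu, ← hp]; exact hz
    rintro (rfl | ⟨e, b, p, h1, h2, hy, hz⟩)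
    · rfl
    · cases b with
      | false => exact Quot.sound (key y z e p h1 h2 hy hz)
      | true =>
        refine (Quot.sound (key z y e (radialFlip p) ?_ ?_ hz ?_)).symm
        · rw [norm_radialFlip (by linarith) (by linarith)]; linarith
        · rw [norm_radialFlip (by linarith) (by linarith)]; linarith
        · rw [radialFlip_radialFlip (by linarith) (by linarith)]; exact hy

theorem proj_eq_proj_iff {v w : V} {y : Γ.piece v} {z : Γ.piece w} :
    Γ.proj v y = Γ.proj w z ↔ Γ.Glued ⟨v, y⟩ ⟨w, z⟩ := mk_eq_mk_iff

theorem exists_proj_eq (q : Γ.Space) : ∃ v y, Γ.proj v y = q := by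
  induction q using Quot.ind with
  | mk y => exact ⟨y.1, y.2, rfl⟩

theorem continuous_proj (v : V) : Continuous (Γ.proj v) :=
  continuous_quot_mk.comp continuous_sigmaMk

end Embeddings

end GluingData

namespace GluingData

variable {n : ℕ} {V E : Type*} {G : LocFinGraph V E} {X : V → Type*}
  [∀ v, TopologicalSpace (X v)] [∀ v, ChartedSpace (EucSpace n) (X v)]
  [∀ v, T2Space (X v)]
  {ρ : Orientation ℝ (EucSpace n) (Fin n)}
  {σ : ∀ v, IsOrientable n (X v) → ManifoldOrientation n (X v)}

/-! ### Local structure of the quotient map -/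

section LocalStructure

variable [∀ v, IsManifold (𝓡 n) ∞ (X v)] (Γ : GluingData G X ρ σ)

/-- Points of two pieces that are identified have parametrizations that are identified. -/
theorem exists_common_param {v w : V} {y : Γ.piece v} {z : Γ.piece w}
    (hyz : Γ.proj v y = Γ.proj w z) :
    ∃ (a : EucSpace n → Γ.piece v) (b : EucSpace n → Γ.piece w) (p : EucSpace n),
      LocDiffAt n a p ∧ a p = y ∧ LocDiffAt n b p ∧ b p = z ∧
      (∀ᶠ q in 𝓝 p, Γ.proj v (a q) = Γ.proj w (b q)) ∧
      ∀ H : ∀ v, IsOrientable n (X v),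
        mdetSign n (fun q => (a q).1) p * (σ v (H v)).sign ρ y.1 =
          mdetSign n (fun q => (b q).1) p * (σ w (H w)).sign ρ z.1 := by
  rcases proj_eq_proj_iff.1 hyz with h | ⟨e, b, p, h1, h2, hy, hz⟩
  · obtain ⟨rfl, h⟩ := Sigma.mk.inj h
    obtain rfl := eq_of_heq h
    obtain ⟨f, hf, hf0⟩ := exists_locDiffAt_zero (n := n) y
    exact ⟨f, f, 0, hf, hf0, hf, hf0, .of_forall fun _ => rfl, fun _ => rfl⟩
  · have h0 : 0 < ‖p‖ := by linarith
    have hp1 : ‖p‖ < 1 := by linarith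
    obtain ⟨j, hj, hjy⟩ := Γ.point_eq_mk_iff.1 hy.symm
    obtain ⟨k, hk, hkz⟩ := Γ.point_eq_mk_iff.1 hz.symm
    have hflip := LocDiffAt.comp' (Γ.locDiffAt_embAt k _) (locDiffAt_radialFlip h0 hp1)
    obtain ⟨α, hα, hαp, hα'⟩ := (Γ.locDiffAt_embAt j p).exists_lift hjy
    obtain ⟨β, hβ, hβp, hβ'⟩ := hflip.exists_lift hkz
    have ho : {q : EucSpace n | 1 / 3 < ‖q‖ ∧ ‖q‖ < 2 / 3} ∈ 𝓝 p :=
      ((isOpen_lt continuous_const continuous_norm).inter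
        (isOpen_lt continuous_norm continuous_const)).mem_nhds ⟨h1, h2⟩
    refine ⟨α, β, p, hα, hαp, hβ, hβp, ?_, fun H => ?_⟩
    · filter_upwards [ho, hα', hβ'] with q hq hqα hqβ
      refine proj_eq_proj_iff.2 (Or.inr ⟨e, b, q, hq.1, hq.2, ?_, ?_⟩)
      · change (⟨v, (α q).1⟩ : Σ v, X v) = _
        rw [hqα, mk_embAt, hj]
      · change (⟨w, (β q).1⟩ : Σ v, X v) = _
        rw [hqβ, mk_embAt, hk]
    -- The opposite signs of the two ends cancel against the sign -1 of the flip.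
    · rw [mdetSign_congr hα', mdetSign_congr hβ',
        mdetSign_comp (Γ.locDiffAt_embAt k _) (locDiffAt_radialFlip h0 hp1),
        mdetSign_radialFlip h0 hp1, Γ.sign_embAt j (H v), Γ.sign_embAt k (H w), hjy, hkz, hj, hk]
      have hs := (σ v (H v)).sign_ne_zero ρ y.1
      have ht := (σ w (H w)).sign_ne_zero ρ z.1
      revert hs ht
      generalize (σ v (H v)).sign ρ y.1 = s
      generalize (σ w (H w)).sign ρ z.1 = t
      cases b <;> (change s ≠ 0 → t ≠ 0 → _ * s * s = _ * t * -1 * t) <;>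
        simp only [endSign, Bool.not_false, Bool.not_true] <;> (revert s t; decide)

/-- Common parametrizations carry a neighbourhood of y to a neighbourhood of any point identified
with y, so saturations of open sets are open. -/
theorem isOpenMap_proj (v : V) : IsOpenMap (Γ.proj v) := by
  intro U hU
  refine isQuotientMap_quot_mk.isOpen_preimage.1 (isOpen_sigma_iff.2 fun w => ?_)
  refine isOpen_iff_mem_nhds.2 ?_
  rintro z ⟨y, hy, hyz⟩
  obtain ⟨a, b, p, ha, rfl, hb, rfl, hab, -⟩ := Γ.exists_common_param (w := w) hyz
  rw [← hb.map_nhds, Filter.mem_map]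
  filter_upwards [hab, ha.continuousAt.preimage_mem_nhds (hU.mem_nhds hy)] with q hq hqU
  exact ⟨a q, hqU, hq⟩

theorem isOpenQuotientMap_mk :
    IsOpenQuotientMap (fun y => Quot.mk _ y : (Σ v, Γ.piece v) → Γ.Space) :=
  ⟨Quot.mk_surjective, continuous_quot_mk, isOpenMap_sigma.2 Γ.isOpenMap_proj⟩

/-- Distinct points of one piece are identified only through a loop, one lying in each of its two
embedded discs. The range of at most one embedding contains `y`; `W` avoids the closed 2/3-balls of
all the others. -/
theorem exists_injOn_proj {v : V} (y : Γ.piece v) :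
    ∃ W : Set (Γ.piece v), IsOpen W ∧ y ∈ W ∧ InjOn (Γ.proj v) W := by
  let K : G.Half v → Set (X v) := fun h => Γ.embAt v h '' Metric.closedBall 0 (2 / 3)
  have hK : ∀ h, IsClosed (K h) := fun h =>
    ((isCompact_closedBall _ _).image (continuous_iff_continuousAt.2 fun p =>
      (Γ.locDiffAt_embAt h p).continuousAt)).isClosed
  let W : Set (Γ.piece v) :=
    Subtype.val ⁻¹' (⋃ h ∈ {h : G.Half v | y.1 ∉ range (Γ.embAt v h)}, K h)ᶜ
  refine ⟨W, ?_, ?_, fun y₁ h₁ y₂ h₂ heq => ?_⟩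
  · exact ((toFinite _).isClosed_biUnion fun h _ => hK h).isOpen_compl.preimage
      continuous_subtype_val
  · simp only [W, mem_preimage, mem_compl_iff, mem_iUnion, not_exists]
    exact fun h hh hy => hh (image_subset_range _ _ hy)
  · rcases proj_eq_proj_iff.1 heq with h | ⟨e, b, p, hp1, hp2, hy, hz⟩
    · exact eq_of_heq (Sigma.mk.inj h).2
    · have key : ∀ (b : Bool) (p : EucSpace n) (x : Γ.piece v), x ∈ W → ‖p‖ < 2 / 3 →
          Γ.under ⟨v, x⟩ = Γ.point e b p → ∃ q, Γ.point e b q = ⟨v, y.1⟩ := by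
        intro b p x hx hp hxp
        obtain ⟨j, hj, hjx⟩ := Γ.point_eq_mk_iff.1 hxp.symm
        have : y.1 ∈ range (Γ.embAt v j) := by
          by_contra hc
          exact hx (mem_biUnion (x := j) hc ⟨p, mem_closedBall_zero_iff.2 hp.le, hjx⟩)
        obtain ⟨q, hq⟩ := this
        exact ⟨q, Γ.point_eq_mk_iff.2 ⟨j, hj, hq⟩⟩
      obtain ⟨q, hq⟩ := key b p y₁ h₁ hp2 hy
      obtain ⟨q', hq'⟩ := key (!b) _ y₂ h₂
        (by rw [norm_radialFlip (by linarith) (by linarith)]; linarith) hz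
      exact absurd (Γ.point_inj (hq.trans hq'.symm)).2.1 (by cases b <;> decide)

end LocalStructure

/-! ### Hausdorff, second countable, connected -/

section Topology

variable (Γ : GluingData G X ρ σ)

/-- Closed shells have compact image, and local finiteness makes the union over half-edges closed.
Closing the shells adds nothing: radius 1/3 is removed from the pieces, and radius 2/3 flips to 1/3.
-/
theorem isClosed_setOf_mk_eq_mk : IsClosed {q : (Σ v, Γ.piece v) × (Σ v, Γ.piece v) |
    (Quot.mk _ q.1 : Γ.Space) = Quot.mk _ q.2} := by
  let A : Set (EucSpace n) := {p | 1 / 3 ≤ ‖p‖} ∩ Metric.closedBall 0 (2 / 3)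
  have hA : IsCompact A :=
    (isCompact_closedBall _ _).inter_left (isClosed_le continuous_const continuous_norm)
  let u : (Σ v, Γ.piece v) × (Σ v, Γ.piece v) → (Σ v, X v) × (Σ v, X v) :=
    Prod.map Γ.under Γ.under
  have hu : Continuous u := Γ.continuous_under.prodMap Γ.continuous_under
  let K : E × Bool → Set ((Σ v, X v) × (Σ v, X v)) := fun h =>
    (fun p => (Γ.point h.1 h.2 p, Γ.point h.1 (!h.2) (radialFlip p))) '' A
  have hK : ∀ h, IsClosed (K h) := fun h => by
    refine (hA.image_of_continuousOn ?_).isClosed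
    refine (Γ.continuous_point _ _).continuousOn.prodMk
      ((Γ.continuous_point _ _).comp_continuousOn fun p hp => ?_)
    have h0 : 0 < ‖p‖ := lt_of_lt_of_le (by norm_num) hp.1
    exact (contDiffAt_radialFlip (norm_pos_iff.1 h0)).continuousAt.continuousWithinAt
  have hfin : LocallyFinite fun h => u ⁻¹' K h := by
    intro q
    refine ⟨{r | r.1.1 = q.1.1}, ?_, (G.locally_finite q.1.1).subset ?_⟩
    · have : {r : (Σ v, Γ.piece v) × (Σ v, Γ.piece v) | r.1.1 = q.1.1} =
          Prod.fst ⁻¹' range (Sigma.mk q.1.1) := by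
        ext ⟨⟨v, y⟩, r⟩
        constructor
        · rintro rfl
          exact ⟨y, rfl⟩
        · rintro ⟨z, hz⟩
          exact (congrArg Sigma.fst hz).symm
      rw [this]
      exact (isOpen_range_sigmaMk.preimage continuous_fst).mem_nhds ⟨q.1.2, rfl⟩
    · rintro h ⟨r, ⟨p, -, hp⟩, hr⟩
      have h1 : G.vert h.1 h.2 = r.1.1 := congrArg (fun t => t.1.1) hp
      exact h1.trans hr
  have hset : {q : (Σ v, Γ.piece v) × (Σ v, Γ.piece v) |
      (Quot.mk _ q.1 : Γ.Space) = Quot.mk _ q.2} = {q | q.1 = q.2} ∪ ⋃ h, u ⁻¹' K h := by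
    ext ⟨y, z⟩
    refine mk_eq_mk_iff.trans (or_congr Iff.rfl ?_)
    simp only [mem_iUnion]
    constructor
    · rintro ⟨e, b, p, h1, h2, hy, hz⟩
      exact ⟨(e, b), p, ⟨h1.le, mem_closedBall_zero_iff.2 h2.le⟩, (Prod.ext hy hz).symm⟩
    · rintro ⟨⟨e, b⟩, p, ⟨h1, h2⟩, hp⟩
      have h1 : 1 / 3 ≤ ‖p‖ := h1
      have h2 := mem_closedBall_zero_iff.1 h2
      have hy : Γ.under y = Γ.point e b p := (congrArg Prod.fst hp).symm
      have hz : Γ.under z = Γ.point e (!b) (radialFlip p) := (congrArg Prod.snd hp).symm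
      have h3 := Γ.lt_norm_of_under_eq hz
      rw [norm_radialFlip (by linarith) (by linarith)] at h3
      exact ⟨e, b, p, Γ.lt_norm_of_under_eq hy, by linarith, hy, hz⟩
  rw [hset]
  exact isClosed_diagonal.union (hfin.isClosed_iUnion fun h => (hK h).preimage hu)

variable [∀ v, IsManifold (𝓡 n) ∞ (X v)]

theorem t2Space_space : T2Space Γ.Space :=
  (t2Space_iff_of_isOpenQuotientMap Γ.isOpenQuotientMap_mk).2 Γ.isClosed_setOf_mk_eq_mk

theorem secondCountableTopology_space [Countable V] [∀ v, SecondCountableTopology (X v)] :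
    SecondCountableTopology Γ.Space :=
  Γ.isOpenQuotientMap_mk.isQuotientMap.secondCountableTopology Γ.isOpenQuotientMap_mk.isOpenMap

/-- Around a removed point take the whole embedded ℝⁿ containing it. What remains of it is the
exterior of a ball, connected since n ≥ 2. -/
theorem isPreconnected_piece [∀ v, ConnectedSpace (X v)] (hn : 2 ≤ n) (v : V) :
    IsPreconnected (Γ.piece v : Set (X v)) := by
  have : Nonempty (Fin n) := ⟨⟨0, by omega⟩⟩
  refine isPreconnected_compl_of_local (Γ.isClosed_removed v)
    (fun x => ⋃ h ∈ {h : G.Half v | x ∈ range (Γ.embAt v h)}, range (Γ.embAt v h)) ?_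
  have hU : ∀ (h : G.Half v) (p : EucSpace n),
      ⋃ h' ∈ {h' : G.Half v | Γ.embAt v h p ∈ range (Γ.embAt v h')}, range (Γ.embAt v h') =
        range (Γ.embAt v h) := by
    intro h p
    have : {h' : G.Half v | Γ.embAt v h p ∈ range (Γ.embAt v h')} = {h} := by
      ext h'
      constructor
      · rintro ⟨q, hq⟩
        by_contra hne
        exact Γ.embAt_ne hne q p hq
      · rintro rfl
        exact ⟨p, rfl⟩
    rw [this, biUnion_singleton]
  intro x hx
  obtain ⟨h, p, -, rfl⟩ := Γ.mem_removed_iff.1 hx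
  simp only [hU]
  have hdiff : range (Γ.embAt v h) \ Γ.removed v = Γ.embAt v h '' {p | ‖p‖ ∈ Ioi (1 / 3 : ℝ)} := by
    ext z
    constructor
    · rintro ⟨⟨q, rfl⟩, hq⟩
      exact ⟨q, Γ.mem_piece_iff.1 hq h q rfl, rfl⟩
    · rintro ⟨q, hq, rfl⟩
      exact ⟨⟨q, rfl⟩, Γ.embAt_mem_piece h hq⟩
  rw [hdiff]
  refine ⟨Γ.isOpen_range_embAt h, ⟨p, rfl⟩, ?_, ?_, ?_⟩
  · exact (isPreconnected_setOf_norm_mem hn isPreconnected_Ioi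
      fun t (ht : 1 / 3 < t) => by linarith).image _
      (continuous_iff_continuousAt.2 fun p => (Γ.locDiffAt_embAt h p).continuousAt).continuousOn
  · obtain ⟨q, hq⟩ := exists_norm_eq (EucSpace n) zero_le_one
    exact ⟨_, q, by change 1 / 3 < ‖q‖; rw [hq]; norm_num, rfl⟩
  · rintro _ - ⟨q, rfl⟩
    exact hU h q

theorem connectedSpace_space [∀ v, ConnectedSpace (X v)] (hn : 2 ≤ n) (hG : G.IsConnected) :
    ConnectedSpace Γ.Space := by
  have : Nonempty (Fin n) := ⟨⟨0, by omega⟩⟩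
  have hmeet : ∀ e,
      (range (Γ.proj (G.vert e false)) ∩ range (Γ.proj (G.vert e true))).Nonempty := by
    intro e
    -- Radius 1/2 lies in the gluing shell, so the two end pieces of each edge meet in the sum.
    obtain ⟨q, hq⟩ := exists_norm_eq (EucSpace n) (c := 1 / 2) (by norm_num)
    have h0 : 0 < ‖q‖ := by rw [hq]; norm_num
    have h1 : ‖q‖ < 1 := by rw [hq]; norm_num
    have hq1 : 1 / 3 < ‖q‖ := by rw [hq]; norm_num
    have hq2 : 1 / 3 < ‖radialFlip q‖ := by rw [norm_radialFlip h0 h1, hq]; norm_num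
    refine ⟨Γ.proj _ ⟨_, Γ.embAt_mem_piece (G.half e false) hq1⟩, ⟨_, rfl⟩,
      ⟨_, Γ.embAt_mem_piece (G.half e true) hq2⟩, ?_⟩
    refine (proj_eq_proj_iff.2 (Or.inr ⟨e, false, q, hq1, by rw [hq]; norm_num, rfl, rfl⟩)).symm
  have hpre : ∀ v, IsPreconnected (range (Γ.proj v)) := fun v => by
    have : PreconnectedSpace (Γ.piece v) :=
      Subtype.preconnectedSpace (Γ.isPreconnected_piece hn v)
    exact isPreconnected_range (continuous_proj v)
  have huniv : (⋃ v, range (Γ.proj v)) = univ := eq_univ_of_forall fun q => by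
    obtain ⟨v, y, rfl⟩ := exists_proj_eq q
    exact mem_iUnion.2 ⟨v, y, rfl⟩
  have : PreconnectedSpace Γ.Space := by
    refine ⟨huniv ▸ IsPreconnected.iUnion_of_reflTransGen hpre fun v w => ?_⟩
    refine Relation.ReflTransGen.mono ?_ _ _
      ((SimpleGraph.reachable_iff_reflTransGen v w).1 (hG.preconnected v w))
    rintro a b ⟨-, ⟨e, rfl, rfl⟩ | ⟨e, rfl, rfl⟩⟩
    · exact hmeet e
    · rw [inter_comm]
      exact hmeet e
  obtain ⟨v⟩ := hG.nonempty
  obtain ⟨y⟩ := Γ.nonempty_piece hn v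
  exact { toNonempty := ⟨Γ.proj v y⟩ }

end Topology

end GluingData

namespace GluingData

variable {n : ℕ} {V E : Type*} {G : LocFinGraph V E} {X : V → Type*}
  [∀ v, TopologicalSpace (X v)] [∀ v, ChartedSpace (EucSpace n) (X v)]
  {ρ : Orientation ℝ (EucSpace n) (Fin n)}
  {σ : ∀ v, IsOrientable n (X v) → ManifoldOrientation n (X v)}

/-! ### Families of diffeomorphisms matching the unit balls -/

section Carries

/-- The diffeomorphisms `Ψ v` carry the embedded unit balls of one family of gluing data to those of
another. -/
def Carries (Γ Γ' : GluingData G X ρ σ) (Ψ : ∀ v, SelfDiffeo n (X v)) : Prop :=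
  ∀ v h p, ‖p‖ ≤ 1 → Ψ v (Γ.embAt v h p) = Γ'.embAt v h p

variable {Γ Γ' : GluingData G X ρ σ} {Ψ : ∀ v, SelfDiffeo n (X v)}

theorem Carries.symm (hΨ : Carries Γ Γ' Ψ) : Carries Γ' Γ fun v => (Ψ v).symm :=
  fun v h p hp => by rw [← hΨ v h p hp, (Ψ v).symm_apply_apply]

theorem carries_refl (Γ : GluingData G X ρ σ) :
    Carries Γ Γ fun v => Diffeomorph.refl (𝓡 n) (X v) ∞ := fun _ _ _ _ => rfl

end Carries

variable [∀ v, T2Space (X v)]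

/-! ### The smooth structure on the sum -/

section SmoothStructure

variable (Γ : GluingData G X ρ σ)

/-- The homeomorphisms between open sets of the connected sum and of `ℝⁿ` that the canonical maps
turn into local diffeomorphisms. -/
def smoothCharts : Set (OpenPartialHomeomorph Γ.Space (EucSpace n)) :=
  {e | ∀ (v : V) (y : Γ.piece v), Γ.proj v y ∈ e.source → LocDiffAt n (fun z => e (Γ.proj v z)) y}

variable [∀ v, IsManifold (𝓡 n) ∞ (X v)]

/-- Follow a local inverse of a canonical map by a chart of the piece. Compatibility with other
pieces is read off in common parametrizations. -/
theorem exists_mem_smoothCharts (q : Γ.Space) : ∃ e ∈ Γ.smoothCharts, q ∈ e.source := by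
  obtain ⟨v, y, rfl⟩ := exists_proj_eq q
  obtain ⟨W, hW, hyW, hinj⟩ := Γ.exists_injOn_proj y
  have : Nonempty (Γ.piece v) := ⟨y⟩
  let P : OpenPartialHomeomorph (Γ.piece v) Γ.Space := OpenPartialHomeomorph.ofContinuousOpen
    (hinj.toPartialEquiv (Γ.proj v) W) (continuous_proj v).continuousOn (Γ.isOpenMap_proj v) hW
  let c := chartAt (EucSpace n) y
  have hP : ∀ z, P z = Γ.proj v z := fun _ => rfl
  refine ⟨P.symm.trans c, ?_, ?_⟩
  · intro w z hz
    rw [OpenPartialHomeomorph.trans_source] at hz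
    have hz1 : Γ.proj w z ∈ P.target := hz.1
    have hz2 : P.symm (Γ.proj w z) ∈ c.source := hz.2
    have hxW : P.symm (Γ.proj w z) ∈ P.source := P.map_target hz1
    have hxz : Γ.proj v (P.symm (Γ.proj w z)) = Γ.proj w z := P.right_inv hz1
    obtain ⟨a, b, p, ha, hap, hb, hbp, hab, -⟩ := Γ.exists_common_param hxz
    have hc : LocDiffAt n c (a p) := by
      rw [hap]
      exact locDiffAt_of_mem_maximalAtlas (IsManifold.chart_mem_maximalAtlas y) hz2
    rw [← hbp]
    refine LocDiffAt.of_comp_left (f := b) ((LocDiffAt.comp' hc ha).congr ?_) hb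
    have hnear : ∀ᶠ q in 𝓝 p, a q ∈ P.source :=
      ha.continuousAt.eventually (P.open_source.mem_nhds (hap ▸ hxW))
    filter_upwards [hab, hnear] with q hq hqW
    change c (P.symm (Γ.proj w (b q))) = c (a q)
    rw [← hq, ← hP, P.left_inv hqW]
  · have hy : P.symm (Γ.proj v y) = y := P.left_inv hyW
    rw [OpenPartialHomeomorph.trans_source]
    refine ⟨P.map_source hyW, ?_⟩
    change P.symm (Γ.proj v y) ∈ c.source
    rw [hy]
    exact mem_chart_source _ y

/-- The connected sum as a manifold. -/
noncomputable abbrev chartedSpaceSpace : ChartedSpace (EucSpace n) Γ.Space where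
  atlas := Γ.smoothCharts
  chartAt q := (Γ.exists_mem_smoothCharts q).choose
  mem_chart_source q := (Γ.exists_mem_smoothCharts q).choose_spec.2
  chart_mem_atlas q := (Γ.exists_mem_smoothCharts q).choose_spec.1

/-- A transition map `e' ∘ e.symm` precomposed with the local diffeomorphism `e ∘ proj` is `e' ∘
proj`, again a local diffeomorphism; now cancel. -/
theorem isManifold_chartedSpaceSpace :
    @IsManifold ℝ _ (EucSpace n) _ _ (EucSpace n) _ (𝓡 n) ∞ Γ.Space _ Γ.chartedSpaceSpace := by
  let _ := Γ.chartedSpaceSpace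
  refine isManifold_of_contDiffOn (𝓡 n) ∞ Γ.Space fun e e' he he' x hx => ?_
  have hx1 : x ∈ e.target := hx.1.1
  have hx2 : e.symm x ∈ e'.source := hx.1.2
  obtain ⟨v, y, hy⟩ := exists_proj_eq (e.symm x)
  have hys : Γ.proj v y ∈ e.source := hy ▸ e.map_target hx1
  have hyx : e (Γ.proj v y) = x := by rw [hy, e.right_inv hx1]
  have key : LocDiffAt n (fun z => e' (e.symm z)) (e (Γ.proj v y)) := by
    refine LocDiffAt.of_comp_left (f := fun z => e (Γ.proj v z)) ((he' v y (hy ▸ hx2)).congr ?_)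
      (he v y hys)
    filter_upwards [(continuous_proj v).continuousAt.eventually (e.open_source.mem_nhds hys)]
      with z hz
    rw [e.left_inv hz]
  rw [hyx] at key
  exact key.contMDiffAt.contDiffAt.contDiffWithinAt

theorem nonempty_smoothStr : Nonempty Γ.SmoothStr := by
  let _ := Γ.chartedSpaceSpace
  let _ := Γ.isManifold_chartedSpaceSpace
  refine ⟨⟨Γ.chartedSpaceSpace, Γ.isManifold_chartedSpaceSpace, fun v y => ?_⟩⟩
  have hc := locDiffAt_of_mem_maximalAtlas (n := n)
    (IsManifold.chart_mem_maximalAtlas (Γ.proj v y)) (mem_chart_source _ _)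
  exact LocDiffAt.of_comp_right (chart_mem_atlas (EucSpace n) (Γ.proj v y) v y
    (mem_chart_source _ _)) hc (continuous_proj v).continuousAt

end SmoothStructure

namespace SmoothStr

variable {Γ : GluingData G X ρ σ}

theorem locDiffAt_proj (S : Γ.SmoothStr) (v : V) (y : Γ.piece v) : LocDiffAt n (S.proj v) y :=
  S.isLocalDiffeomorph_proj v y

theorem exists_proj_eq (S : Γ.SmoothStr) (q : S.Carrier) : ∃ v y, S.proj v y = q :=
  GluingData.exists_proj_eq q

end SmoothStr

/-! ### Maps induced between connected sums -/

section Maps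

variable {Γ Γ' : GluingData G X ρ σ}

variable {Ψ : ∀ v, SelfDiffeo n (X v)}

/-- A removed point of the target is the image of the removed point with the same parameter, and `Ψ
v` is injective. -/
theorem Carries.mem_piece (hΨ : Carries Γ Γ' Ψ) {v : V} {x : X v} (hx : x ∈ Γ.piece v) :
    Ψ v x ∈ Γ'.piece v := by
  refine Γ'.mem_piece_iff.2 fun h p hp => ?_
  by_contra hc
  have h1 := hΨ v h p (by linarith)
  exact hc (Γ.mem_piece_iff.1 hx h p ((Ψ v).injective (h1.trans hp)))

/-- The induced map between the pieces. -/
noncomputable def Carries.pieceMap (hΨ : Carries Γ Γ' Ψ) (v : V) (y : Γ.piece v) : Γ'.piece v :=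
  ⟨Ψ v y.1, hΨ.mem_piece y.2⟩

theorem Carries.under_pieceMap (hΨ : Carries Γ Γ' Ψ) {y : Σ v, Γ.piece v} {e : E} {b : Bool}
    {p : EucSpace n} (hp : ‖p‖ ≤ 1) (h : Γ.under y = Γ.point e b p) :
    Γ'.under ⟨y.1, hΨ.pieceMap y.1 y.2⟩ = Γ'.point e b p := by
  obtain ⟨v, y⟩ := y
  obtain ⟨j, hj, hjy⟩ := Γ.point_eq_mk_iff.1 h.symm
  refine (Γ'.point_eq_mk_iff.2 ⟨j, hj, ?_⟩).symm
  rw [← hΨ v j p hp, hjy]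
  rfl

theorem Carries.glued (hΨ : Carries Γ Γ' Ψ) {y z : Σ v, Γ.piece v} (h : Γ.Glued y z) :
    Γ'.Glued ⟨y.1, hΨ.pieceMap y.1 y.2⟩ ⟨z.1, hΨ.pieceMap z.1 z.2⟩ := by
  rcases h with rfl | ⟨e, b, p, h1, h2, hy, hz⟩
  · exact Or.inl rfl
  · refine Or.inr ⟨e, b, p, h1, h2, hΨ.under_pieceMap (by linarith) hy,
      hΨ.under_pieceMap ?_ hz⟩
    rw [norm_radialFlip (by linarith) (by linarith)]
    linarith

/-- The induced map between the connected sums. -/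
noncomputable def Carries.spaceMap (hΨ : Carries Γ Γ' Ψ) : Γ.Space → Γ'.Space :=
  Quot.lift (fun y => Γ'.proj y.1 (hΨ.pieceMap y.1 y.2))
    fun _ _ h => proj_eq_proj_iff.2 (hΨ.glued h.glued)

theorem Carries.spaceMap_symm_spaceMap (hΨ : Carries Γ Γ' Ψ) (q : Γ.Space) :
    hΨ.symm.spaceMap (hΨ.spaceMap q) = q := by
  obtain ⟨v, y, rfl⟩ := exists_proj_eq q
  exact congrArg (Γ.proj v) (Subtype.ext ((Ψ v).symm_apply_apply y.1))

theorem Carries.spaceMap_spaceMap_symm (hΨ : Carries Γ Γ' Ψ) (q : Γ'.Space) :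
    hΨ.spaceMap (hΨ.symm.spaceMap q) = q := by
  obtain ⟨v, y, rfl⟩ := exists_proj_eq q
  exact congrArg (Γ'.proj v) (Subtype.ext ((Ψ v).apply_symm_apply y.1))

variable [∀ v, IsManifold (𝓡 n) ∞ (X v)]

theorem Carries.locDiffAt_pieceMap (hΨ : Carries Γ Γ' Ψ) (v : V) (y : Γ.piece v) :
    LocDiffAt n (hΨ.pieceMap v) y := by
  have hc : Continuous (hΨ.pieceMap v) :=
    ((Ψ v).continuous.comp continuous_subtype_val).subtype_mk _
  exact LocDiffAt.of_comp_right (g := Subtype.val) (f := hΨ.pieceMap v)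
    (LocDiffAt.comp' (g := Ψ v) ((Ψ v).isLocalDiffeomorph _) (locDiffAt_subtype_val _ y))
    (locDiffAt_subtype_val _ _) hc.continuousAt

/-- The canonical maps are local diffeomorphisms for whichever smooth structures `S` and `S'` are
given, so the question reduces to the pieces. With identity maps this yields uniqueness of the
smooth structure. -/
theorem Carries.locDiffAt_spaceMap (hΨ : Carries Γ Γ' Ψ) (S : Γ.SmoothStr) (S' : Γ'.SmoothStr)
    (q : S.Carrier) : LocDiffAt n (M := S.Carrier) (N := S'.Carrier) hΨ.spaceMap q := by
  obtain ⟨v, y, rfl⟩ := S.exists_proj_eq q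
  exact LocDiffAt.of_comp_left (f := S.proj v) (P := S'.Carrier)
    (LocDiffAt.comp' (g := S'.proj v) (S'.locDiffAt_proj v _) (hΨ.locDiffAt_pieceMap v y))
    (S.locDiffAt_proj v y)

/-- The induced diffeomorphism between the connected sums. -/
noncomputable def Carries.diffeomorph (hΨ : Carries Γ Γ' Ψ) (S : Γ.SmoothStr) (S' : Γ'.SmoothStr) :
    Diffeomorph (𝓡 n) (𝓡 n) S.Carrier S'.Carrier ∞ where
  toFun := hΨ.spaceMap
  invFun := hΨ.symm.spaceMap
  left_inv := hΨ.spaceMap_symm_spaceMap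
  right_inv := hΨ.spaceMap_spaceMap_symm
  contMDiff_toFun q := (hΨ.locDiffAt_spaceMap S S' q).contMDiffAt
  contMDiff_invFun q := (hΨ.symm.locDiffAt_spaceMap S' S q).contMDiffAt

theorem Carries.diffeomorph_proj (hΨ : Carries Γ Γ' Ψ) (S : Γ.SmoothStr) (S' : Γ'.SmoothStr)
    (v : V) (y : Γ.piece v) :
    hΨ.diffeomorph S S' (S.proj v y) = S'.proj v (hΨ.pieceMap v y) := rfl

/-- The disc theorem applies at each vertex: relative to `σ v`, both embeddings of a half-edge have
the sign prescribed by its end. -/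
theorem exists_carries [∀ v, ConnectedSpace (X v)] (hn : 2 ≤ n) (Γ Γ' : GluingData G X ρ σ) :
    ∃ Ψ : ∀ v, SelfDiffeo n (X v), Carries Γ Γ' Ψ ∧ ∀ v, PreservesOrientations ρ (Ψ v) := by
  have hv : ∀ v, ∃ Ψ : SelfDiffeo n (X v), PreservesOrientations ρ Ψ ∧
      ∀ h p, ‖p‖ ≤ 1 → Ψ (Γ.embAt v h p) = Γ'.embAt v h p := fun v => by
    refine exists_diffeo_discs hn Γ.locDiffAt_embAt Γ'.locDiffAt_embAt Γ.embAt_injective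
      Γ'.embAt_injective (fun _ _ => Γ.embAt_ne) (fun _ _ => Γ'.embAt_ne)
      fun H => ⟨σ v H, fun h => ?_⟩
    rw [Γ.sign_embAt h H, Γ'.sign_embAt h H, mul_assoc, mul_assoc,
      SignType.mul_self_of_ne_zero ((σ v H).sign_ne_zero ρ _),
      SignType.mul_self_of_ne_zero ((σ v H).sign_ne_zero ρ _)]
  choose Ψ h1 h2 using hv
  exact ⟨Ψ, h2, h1⟩

end Maps

/-! ### The induced orientation -/

namespace SmoothStr

variable {Γ : GluingData G X ρ σ} (H : ∀ v, IsOrientable n (X v))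

/-- The sign with respect to `ρ` of the orientation that a canonical map transports from a piece to
the connected sum. -/
noncomputable def pushSign (S : Γ.SmoothStr) (v : V) (y : Γ.piece v) : SignType :=
  mdetSign n (S.proj v) y * mdetSign n (Subtype.val : Γ.piece v → X v) y * (σ v (H v)).sign ρ y.1

variable [∀ v, IsManifold (𝓡 n) ∞ (X v)]

theorem pushSign_ne_zero (S : Γ.SmoothStr) (v : V) (y : Γ.piece v) : S.pushSign H v y ≠ 0 :=
  mul_ne_zero (mul_ne_zero (mdetSign_ne_zero (S.locDiffAt_proj v y))
    (mdetSign_ne_zero (locDiffAt_subtype_val _ y))) ((σ v (H v)).sign_ne_zero ρ y.1)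

theorem isInduced_iff_sign (S : Γ.SmoothStr) (o : ManifoldOrientation n S.Carrier) :
    S.IsInduced H o ↔ ∀ v y, S.pushSign H v y = o.sign ρ (S.proj v y) := by
  refine forall₂_congr fun v y => ?_
  have hi := mdetSign_ne_zero (locDiffAt_subtype_val (n := n) (Γ.piece v) y)
  have hs := (σ v (H v)).sign_ne_zero ρ y.1
  have hii := SignType.mul_self_of_ne_zero hi
  constructor
  · rintro ⟨a, h1, h2⟩
    rw [carriesOrientation_iff_sign ρ] at h1 h2
    change _ = (σ v (H v)).sign ρ y.1 at h1
    change _ = o.sign ρ (S.proj v y) at h2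
    rw [← h2, pushSign, ← h1, mul_assoc, ← mul_assoc (mdetSign n Subtype.val y), hii, one_mul]
  · intro h
    let s : SignType := mdetSign n (Subtype.val : Γ.piece v → X v) y * (σ v (H v)).sign ρ y.1
    have hs0 : s ≠ 0 := mul_ne_zero hi hs
    refine ⟨signOrientation ρ s, (carriesOrientation_iff_sign ρ _ _).2 ?_,
      (carriesOrientation_iff_sign ρ _ _).2 ?_⟩
    · refine (congrArg _ (orientationSign_signOrientation ρ hs0)).trans ?_
      change _ = (σ v (H v)).sign ρ y.1
      rw [← mul_assoc, hii, one_mul]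
    · refine (congrArg _ (orientationSign_signOrientation ρ hs0)).trans ?_
      change _ = o.sign ρ (S.proj v y)
      rw [← h, pushSign, mul_assoc]

/-- Compare along common parametrizations: they have equal composites in the sum and equal signs
relative to the chosen orientations of the `X v`. -/
theorem pushSign_eq_of_proj_eq (S : Γ.SmoothStr) {v w : V} {y : Γ.piece v} {z : Γ.piece w}
    (h : S.proj v y = S.proj w z) : S.pushSign H v y = S.pushSign H w z := by
  obtain ⟨a, b, p, ha, rfl, hb, rfl, hab, hsign⟩ := Γ.exists_common_param h
  have h1 : mdetSign n (fun q => S.proj v (a q)) p = mdetSign n (fun q => S.proj w (b q)) p :=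
    mdetSign_congr hab
  rw [mdetSign_comp (S.locDiffAt_proj v _) ha, mdetSign_comp (S.locDiffAt_proj w _) hb] at h1
  have h2 := hsign H
  rw [mdetSign_comp (locDiffAt_subtype_val _ _) ha, mdetSign_comp (locDiffAt_subtype_val _ _) hb]
    at h2
  have haa := SignType.mul_self_of_ne_zero (mdetSign_ne_zero ha)
  have hbb := SignType.mul_self_of_ne_zero (mdetSign_ne_zero hb)
  calc S.pushSign H v (a p)
      = S.pushSign H v (a p) * (mdetSign n a p * mdetSign n a p) := by rw [haa, mul_one]
    _ = (mdetSign n (S.proj v) (a p) * mdetSign n a p) *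
          (mdetSign n Subtype.val (a p) * mdetSign n a p * (σ v (H v)).sign ρ (a p).1) := by
        rw [pushSign]; ac_rfl
    _ = S.pushSign H w (b p) * (mdetSign n b p * mdetSign n b p) := by
        rw [h1, h2, pushSign]; ac_rfl
    _ = S.pushSign H w (b p) := by rw [hbb, mul_one]

theorem exists_isInduced (S : Γ.SmoothStr) : ∃ o, S.IsInduced H o := by
  choose v y hvy using S.exists_proj_eq
  let s : S.Carrier → SignType := fun q => S.pushSign H (v q) (y q)
  have hs : ∀ w z, s (S.proj w z) = S.pushSign H w z := fun w z =>
    S.pushSign_eq_of_proj_eq H (hvy (S.proj w z))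
  refine ⟨ManifoldOrientation.ofSign ρ s fun x => ?_, (S.isInduced_iff_sign H _).2 fun w z => ?_⟩
  · obtain ⟨w, z, rfl⟩ := S.exists_proj_eq x
    obtain ⟨a, ha, rfl⟩ := exists_locDiffAt_zero (n := n) z
    have hva := LocDiffAt.comp' (locDiffAt_subtype_val (n := n) _ (a 0)) ha
    -- In the product of signs the factor of the canonical map occurs twice and cancels, leaving the
    -- locally constant sign of the orientation of `X w`.
    refine ⟨fun q => S.proj w (a q), 0, mdetSign n (fun q => (a q).1) 0 *
      (σ w (H w)).sign ρ (a 0).1, LocDiffAt.comp' (S.locDiffAt_proj w _) ha, rfl,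
      mul_ne_zero (mdetSign_ne_zero hva) ((σ w (H w)).sign_ne_zero ρ _), ?_⟩
    filter_upwards [ha.eventually, (σ w (H w)).eventually_sign_eq ρ hva] with q hq hqs
    rw [← hqs, hs, mdetSign_comp (S.locDiffAt_proj w _) hq,
      mdetSign_comp (locDiffAt_subtype_val _ _) hq, pushSign]
    have hpp := SignType.mul_self_of_ne_zero (mdetSign_ne_zero (S.locDiffAt_proj w (a q)))
    calc _ = (mdetSign n (S.proj w) (a q) * mdetSign n (S.proj w) (a q)) *
          (mdetSign n Subtype.val (a q) * mdetSign n a q * (σ w (H w)).sign ρ (a q).1) := by ac_rfl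
      _ = _ := by rw [hpp, one_mul]
  · rw [ManifoldOrientation.ofSign_sign ρ s _ _ (by rw [hs]; exact S.pushSign_ne_zero H w z), hs]

theorem existsUnique_isInduced (S : Γ.SmoothStr) : ∃! o, S.IsInduced H o := by
  obtain ⟨o, ho⟩ := S.exists_isInduced H
  refine ⟨o, ho, fun o' ho' => ManifoldOrientation.ext_sign ρ fun x => ?_⟩
  obtain ⟨v, y, rfl⟩ := S.exists_proj_eq x
  rw [← (S.isInduced_iff_sign H o).1 ho v y, ← (S.isInduced_iff_sign H o').1 ho' v y]

end SmoothStr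

/-- On each piece the map of sums is covered by `Ψ v`, which preserves the chosen orientation; the
rest is multiplicativity of signs. -/
theorem Carries.preservesOrientation_diffeomorph [∀ v, IsManifold (𝓡 n) ∞ (X v)]
    {Γ Γ' : GluingData G X ρ σ} {Ψ : ∀ v, SelfDiffeo n (X v)} (hΨ : Carries Γ Γ' Ψ)
    (hor : ∀ v, PreservesOrientations ρ (Ψ v)) (S : Γ.SmoothStr) (S' : Γ'.SmoothStr)
    (H : ∀ v, IsOrientable n (X v)) {o : ManifoldOrientation n S.Carrier}
    {o' : ManifoldOrientation n S'.Carrier} (ho : S.IsInduced H o) (ho' : S'.IsInduced H o') :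
    PreservesOrientation o o' (hΨ.diffeomorph S S') := by
  refine (preservesOrientation_iff_sign ρ _ _ _).2 fun x => ?_
  obtain ⟨v, y, rfl⟩ := S.exists_proj_eq x
  have hm := hΨ.locDiffAt_pieceMap v y
  have h1 : mdetSign n (fun z => hΨ.diffeomorph S S' (S.proj v z)) y =
      mdetSign n (fun z => S'.proj v (hΨ.pieceMap v z)) y := rfl
  rw [mdetSign_comp ((hΨ.diffeomorph S S').isLocalDiffeomorph _) (S.locDiffAt_proj v y),
    mdetSign_comp (S'.locDiffAt_proj v _) hm] at h1
  have h2 : mdetSign n (fun z => (hΨ.pieceMap v z).1) y = mdetSign n (fun z => Ψ v z.1) y := rfl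
  rw [mdetSign_comp (locDiffAt_subtype_val _ _) hm,
    mdetSign_comp ((Ψ v).isLocalDiffeomorph _) (locDiffAt_subtype_val _ y)] at h2
  have h3 : (σ v (H v)).sign ρ (hΨ.pieceMap v y).1 =
      mdetSign n (Ψ v) y.1 * (σ v (H v)).sign ρ y.1 := (hor v (σ v (H v)) y.1).symm
  have hmm := SignType.mul_self_of_ne_zero (mdetSign_ne_zero hm)
  have hψψ := SignType.mul_self_of_ne_zero (mdetSign_ne_zero ((Ψ v).isLocalDiffeomorph y.1))
  rw [hΨ.diffeomorph_proj, ← (S.isInduced_iff_sign H o).1 ho v y,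
    ← (S'.isInduced_iff_sign H o').1 ho' v _, SmoothStr.pushSign, SmoothStr.pushSign, h3]
  generalize mdetSign n (hΨ.pieceMap v) y = M at *
  generalize mdetSign n (Ψ v) y.1 = ψ at *
  generalize mdetSign n (S'.proj v) (hΨ.pieceMap v y) = P' at *
  generalize mdetSign n Subtype.val (hΨ.pieceMap v y) = i' at *
  generalize mdetSign n Subtype.val y = i at *
  generalize (σ v (H v)).sign ρ y.1 = s at *
  generalize mdetSign n (S.proj v) y = P at *
  generalize mdetSign n (hΨ.diffeomorph S S') (S.proj v y) = D at *
  calc D * (P * i * s) = (D * P) * i * s := by ac_rfl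
    _ = (ψ * ψ) * (P' * M * i * s) := by rw [h1, hψψ, one_mul]
    _ = P' * M * (ψ * i) * ψ * s := by ac_rfl
    _ = (M * M) * (P' * i' * (ψ * s)) := by rw [← h2]; ac_rfl
    _ = P' * i' * (ψ * s) := by rw [hmm, one_mul]

end GluingData

/-! ### The main theorem -/

theorem theorem2p2 {n : ℕ} (hn : 2 ≤ n) {V E : Type*} [Countable V] (G : LocFinGraph V E)
    (hG : G.IsConnected) (X : V → Type*) [∀ v, TopologicalSpace (X v)]
    [∀ v, T2Space (X v)] [∀ v, SecondCountableTopology (X v)] [∀ v, ConnectedSpace (X v)]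
    [∀ v, ChartedSpace (EucSpace n) (X v)] [∀ v, IsManifold (𝓡 n) ∞ (X v)]
    (ρ : Orientation ℝ (EucSpace n) (Fin n))
    (σ : ∀ v, IsOrientable n (X v) → ManifoldOrientation n (X v)) :
    (∀ Γ : GluingData G X ρ σ,
      -- the sum is a connected smooth manifold, in exactly one way
      ConnectedSpace Γ.Space ∧ T2Space Γ.Space ∧ SecondCountableTopology Γ.Space ∧
      Nonempty Γ.SmoothStr ∧
      (∀ S S' : Γ.SmoothStr, ∃ Φ : Diffeomorph (𝓡 n) (𝓡 n) S.Carrier S'.Carrier ∞,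
        ∀ v y, Φ (S.proj v y) = S'.proj v y) ∧
      -- it is oriented by the pieces if all of them are oriented
      (∀ (h : ∀ v, IsOrientable n (X v)) (S : Γ.SmoothStr),
        ∃! o : ManifoldOrientation n S.Carrier, S.IsInduced h o)) ∧
    -- independence of the embeddings
    (∀ (Γ Γ' : GluingData G X ρ σ) (S : Γ.SmoothStr) (S' : Γ'.SmoothStr),
      ∃ Φ : Diffeomorph (𝓡 n) (𝓡 n) S.Carrier S'.Carrier ∞,
        ∀ (h : ∀ v, IsOrientable n (X v)) (o : ManifoldOrientation n S.Carrier)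
          (o' : ManifoldOrientation n S'.Carrier),
          S.IsInduced h o → S'.IsInduced h o' → PreservesOrientation o o' Φ) := by
  refine ⟨fun Γ => ⟨Γ.connectedSpace_space hn hG, Γ.t2Space_space, Γ.secondCountableTopology_space,
    Γ.nonempty_smoothStr,
    -- Identity maps on the pieces, read between two smooth structures on the same quotient, induce
    -- the required diffeomorphism.
    fun S S' => ⟨(GluingData.carries_refl Γ).diffeomorph S S', fun _ _ => rfl⟩,
    fun h S => S.existsUnique_isInduced h⟩, fun Γ Γ' S S' => ?_⟩
  obtain ⟨Ψ, hΨ, hor⟩ := GluingData.exists_carries hn Γ Γ'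
  exact ⟨hΨ.diffeomorph S S', fun h _ _ ho ho' =>
    hΨ.preservesOrientation_diffeomorph hor S S' h ho ho'⟩
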